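/- Let $w\in S_n$, with one-line notation $w_1w_2\cdots w_n$. A box-ball state places the balls $1,\dots,n$ in distinct boxes labelled by the natural numbers. One move takes the balls in the order $1,2,\dots,n$ and moves each once to the nearest empty box to its right. The system of $w$ starts with $w_1,\dots,w_n$ in $n$ consecutive boxes. The increasing runs of a state are its maximal increasing sequences of balls in consecutive boxes. A state is steady if its sequence of increasing runs, read from left to right, is unchanged by all subsequent moves and the sizes of the runs weakly decrease from right to left. The soliton decomposition $\mathrm{SD}(w)$ is the array whose rows, from top to bottom, are the increasing runs of a steady state of the system of $w$ from right to left (every steady state of the system gives the same array). Let $\mathrm{P}(w)$ be the Robinson–Schensted insertion tableau of $w$. The shape of an array is the sequence of its row lengths. An array is a standard tableau if its shape is a partition of $n$, it contains each of $1,\dots,n$ exactly once, and its rows and columns increase. For $k\ge 1$, let $\mathrm{i}_k(w)$ (respectively $\mathrm{d}_k(w)$) be the largest size of a union of $k$ disjoint, possibly empty, increasing (respectively decreasing) subsequences of $w$. Let $$\mathrm{I}_k(w)=\max_{w=u_1|\cdots|u_k}\ \sum_{j=1}^k \mathrm{i}(u_j),$$ where the maximum is over all ways to write $w$ as a concatenation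 of $k$ consecutive, possibly empty, pieces and $\mathrm{i}(u)$ is the length of a longest increasing subsequence of $u$. Let $$\mathrm{D}_k(w)=\max_{w=u_1\sqcup\cdots\sqcup u_k}\ \sum_{j=1}^k \mathrm{D}(u_j),$$ where the maximum is over all ways to write $w$ as a union of $k$ disjoint, possibly empty, not necessarily consecutive subsequences, $\mathrm{D}(u)=0$ if $u$ is empty, and otherwise $\mathrm{D}(u)$ is $1$ plus the number of descents of $u$ (the indices $m$ with $u_m>u_{m+1}$). Then the system of $w$ reaches a steady state after finitely many moves, so that $\mathrm{SD}(w)$ is defined, and the following five statements are equivalent: 1. $\mathrm{SD}(w)=\mathrm{P}(w)$. 2. $\mathrm{SD}(w)$ is a standard tableau. 3. The shape of $\mathrm{SD}(w)$ equals the shape of $\mathrm{P}(w)$. 4. $\mathrm{I}_k(w)=\mathrm{i}_k(w)$ for all $k\ge 1$. 5. $\mathrm{D}_k(w)=\mathrm{d}_k(w)$ for all $k\ge 1$. -/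

import Mathlib

/-! Balls and the letters of a permutation of `n` objects are the elements of `Fin n`, i.e. the
labels `0, …, n - 1` in place of `1, …, n`; the boxes are the natural numbers. -/

namespace BoxBall

/-! ### Box-ball systems -/

/-- A box-ball state with `n` balls: the box of every ball. All states that occur below are
injective. -/
abbrev State (n : ℕ) := Fin n → ℕ

theorem exists_empty_right {n : ℕ} (s : State n) (i : Fin n) :
    ∃ p, s i < p ∧ ∀ j, s j ≠ p := by
  refine ⟨Finset.univ.sup s + 1, ?_, fun j => ?_⟩
  · have := Finset.le_sup (f := s) (Finset.mem_univ i)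
    omega
  · have := Finset.le_sup (f := s) (Finset.mem_univ j)
    omega

/-- Move ball `i` to the nearest empty box to its right. -/
def moveBall {n : ℕ} (s : State n) (i : Fin n) : State n :=
  Function.update s i (Nat.find (exists_empty_right s i))

/-- One BBS move: every ball, beginning with the smallest, is moved once to the nearest empty
box to its right. -/
def bbsMove {n : ℕ} (s : State n) : State n :=
  (List.finRange n).foldl moveBall s

/-- The initial state of the permutation `w`: the one-line notation `w 0, w 1, …, w (n - 1)` is
written in the consecutive boxes `0, …, n - 1`, so that ball `b` is in box `w⁻¹ b`. -/
def initialState {n : ℕ} (w : Equiv.Perm (Fin n)) : State n := fun b => (w.symm b : ℕ)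

/-- The state at time `t` of the box-ball system containing `w`. -/
def stateAt {n : ℕ} (w : Equiv.Perm (Fin n)) (t : ℕ) : State n := bbsMove^[t] (initialState w)

/-- The balls of a state, in the order of their boxes from left to right. -/
def ballsInOrder {n : ℕ} (s : State n) : List (Fin n) :=
  (List.finRange n).insertionSort (fun a b => s a ≤ s b)

/-- The increasing runs of a state, listed from left to right: the maximal increasing sequences
of balls in consecutive boxes. -/
def runs {n : ℕ} (s : State n) : List (List (Fin n)) :=
  (ballsInOrder s).splitBy (fun a b => decide (s b = s a + 1 ∧ a < b))

/-- A state is steady if it decomposes into solitons, that is, its increasing runs are preserved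
by all subsequent BBS moves, and if the sizes of the solitons are weakly decreasing from right to
left. -/
def IsSteady {n : ℕ} (s : State n) : Prop :=
  (∀ m : ℕ, runs (bbsMove^[m] s) = runs s) ∧
    (runs s).Pairwise (fun L R => L.length ≤ R.length)

/-- A filling of a left-justified array, as the list of its rows from top to bottom. -/
abbrev Tableau (n : ℕ) := List (List (Fin n))

/-- The increasing runs of a state, stacked with the rightmost one as the first row. -/
def runTableau {n : ℕ} (s : State n) : Tableau n := (runs s).reverse

open Classical in
/-- The soliton decomposition of `w`: the stacked solitons of the first steady state (by
`SD_eq_of_isSteady` every other steady state gives the same tableau). The value `[]` is used only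
if no steady state is ever reached. -/
noncomputable def SD {n : ℕ} (w : Equiv.Perm (Fin n)) : Tableau n :=
  if h : ∃ t, IsSteady (stateAt w t) then runTableau (stateAt w (Nat.find h)) else []

theorem SD_eq_of_isSteady {n : ℕ} (w : Equiv.Perm (Fin n)) (t : ℕ)
    (ht : IsSteady (stateAt w t)) : SD w = runTableau (stateAt w t) := by
  classical
  have h : ∃ t, IsSteady (stateAt w t) := ⟨t, ht⟩
  have hle : Nat.find h ≤ t := Nat.find_min' h ht
  have key := (Nat.find_spec h).1 (t - Nat.find h)
  have e : ∀ a, a ≤ t → bbsMove^[t - a] (stateAt w a) = stateAt w t := by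
    intro a ha
    unfold stateAt
    rw [← Function.iterate_add_apply, Nat.sub_add_cancel ha]
  rw [e _ hle] at key
  unfold SD
  rw [dif_pos h, runTableau, runTableau, key]

/-! ### Tableaux and Robinson–Schensted insertion -/

/-- The shape of a tableau: the list of its row lengths. -/
def shape {n : ℕ} (T : Tableau n) : List ℕ := T.map List.length

/-- Standard tableaux of size `n`: the rows are nonempty and increase from left to right, their
lengths weakly decrease and the columns increase from top to bottom, and every element of `Fin n`
occurs exactly once. -/
def IsStandard {n : ℕ} (T : Tableau n) : Prop :=
  (∀ R ∈ T, R ≠ [] ∧ R.Pairwise (· < ·)) ∧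
    T.Pairwise (fun R S => ∀ (j : ℕ) (hS : j < S.length), ∃ hR : j < R.length, R[j] < S[j]) ∧
    T.flatten.Perm (List.finRange n)

/-- Insert `x` into a row: `x` replaces the leftmost entry larger than `x`, which is returned as
the bumped entry, or is placed at the end of the row if there is no such entry. -/
def rowInsert {n : ℕ} (x : Fin n) : List (Fin n) → List (Fin n) × Option (Fin n)
  | [] => ([x], none)
  | y :: R => if x < y then (x :: R, some y) else (y :: (rowInsert x R).1, (rowInsert x R).2)

/-- Insert `x` into the first row of a tableau, the bumped entry into the next row, and so on. -/
def tableauInsert {n : ℕ} : Fin n → Tableau n → Tableau n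
  | x, [] => [[x]]
  | x, R :: T =>
    match rowInsert x R with
    | (R', none) => R' :: T
    | (R', some y) => R' :: tableauInsert y T

/-- The one-line notation of a permutation. -/
def word {n : ℕ} (w : Equiv.Perm (Fin n)) : List (Fin n) := (List.finRange n).map w

/-- The Robinson–Schensted insertion tableau of `w`. -/
def P {n : ℕ} (w : Equiv.Perm (Fin n)) : Tableau n :=
  (word w).foldl (fun T x => tableauInsert x T) []

/-! ### The statistics of Greene's theorem

A subsequence of `w` is given by the set of its positions. -/

/-- The subsequence of `w` at the positions `σ` is a disjoint union of `k` (possibly empty)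
increasing subsequences of `w`. -/
def IsKIncreasing {n : ℕ} (w : Equiv.Perm (Fin n)) (k : ℕ) (σ : Finset (Fin n)) : Prop :=
  ∃ c : Fin k → Finset (Fin n), Pairwise (fun i j => Disjoint (c i) (c j)) ∧
    Finset.univ.biUnion c = σ ∧ ∀ j, StrictMonoOn w (c j)

/-- The subsequence of `w` at the positions `σ` is a disjoint union of `k` (possibly empty)
decreasing subsequences of `w`. -/
def IsKDecreasing {n : ℕ} (w : Equiv.Perm (Fin n)) (k : ℕ) (σ : Finset (Fin n)) : Prop :=
  ∃ c : Fin k → Finset (Fin n), Pairwise (fun i j => Disjoint (c i) (c j)) ∧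
    Finset.univ.biUnion c = σ ∧ ∀ j, StrictAntiOn w (c j)

open Classical in
/-- The length of a longest `k`-increasing subsequence of `w`. -/
noncomputable def incr {n : ℕ} (k : ℕ) (w : Equiv.Perm (Fin n)) : ℕ :=
  (Finset.univ.filter (IsKIncreasing w k)).sup Finset.card

open Classical in
/-- The length of a longest `k`-decreasing subsequence of `w`. -/
noncomputable def decr {n : ℕ} (k : ℕ) (w : Equiv.Perm (Fin n)) : ℕ :=
  (Finset.univ.filter (IsKDecreasing w k)).sup Finset.card

/-! ### The statistics of the localized version -/

/-- The length of a longest increasing subsequence of the sequence `u`. -/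
def longestIncr {n : ℕ} (u : List (Fin n)) : ℕ :=
  (u.sublists.toFinset.filter (fun v => v.Pairwise (· < ·))).sup List.length

/-- The maximum of the sums of the `longestIncr u_j` over all ways to write the word of `w` as a
concatenation `u_1 | ⋯ | u_k` of `k` (possibly empty) consecutive pieces. The set is nonempty for
`1 ≤ k` and bounded by `n`. -/
noncomputable def localIncr {n : ℕ} (k : ℕ) (w : Equiv.Perm (Fin n)) : ℕ :=
  sSup {m | ∃ U : List (List (Fin n)), U.length = k ∧ U.flatten = word w ∧
    m = (U.map longestIncr).sum}

/-- The number of descents of the sequence `u`, i.e. of pairs of adjacent entries of which the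
left one is larger. -/
def numDescents {n : ℕ} (u : List (Fin n)) : ℕ :=
  (u.zip u.tail).countP (fun p => decide (p.2 < p.1))

/-- `0` for the empty sequence, and one more than the number of descents otherwise. -/
def descStat {n : ℕ} (u : List (Fin n)) : ℕ :=
  if u = [] then 0 else 1 + numDescents u

/-- The subsequence of the word of `w` at the positions of colour `j`. -/
def colourSubword {n k : ℕ} (w : Equiv.Perm (Fin n)) (c : Fin n → Fin k) (j : Fin k) :
    List (Fin n) :=
  ((List.finRange n).filter (fun i => decide (c i = j))).map w

/-- The maximum of the sums of the `descStat u_j` over all ways to write `w` as the union of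
disjoint (possibly empty) subsequences `u_1, …, u_k`, i.e. over all colourings of the positions
with `k` colours. -/
def localDecr {n : ℕ} (k : ℕ) (w : Equiv.Perm (Fin n)) : ℕ :=
  Finset.univ.sup (fun c : Fin n → Fin k => ∑ j, descStat (colourSubword w c j))

end BoxBall

/-!
The proof identifies all statistics with sums over two shapes. Write `λ` for the shape of `SD w` and
`μ` for the shape of `P w`.

*Localized Greene theorem.* `SegChain u v j m` says that `m` letters can be chosen from the word
`u`, cut in `j` places, such that they weakly increase within each segment. If empty boxes are read
as the letter `n`, larger than all balls, then `segChain_iterate` shows that the maximal number of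
such letters is invariant under box-ball moves, up to a shift of the empty boxes. The reason is the
carrier, which is described in `mem_carrier_succ` and `letter_bbsMove_le`: a move drags a carrier
with `n + 1` letters through the state, and reading one box replaces the pair (carrier, letter in
the box) by the pair (letter of the new state, new carrier). In the alphabet made periodic with
period `n + 1`, where a cut is a passage to the next period, this exchange of two adjacent blocks
preserves the maximal gain of a weakly increasing path (`IsExchange`). A ball never moves to an
earlier run (`runIndex_le_bbsMove`), so eventually no ball changes its run (`exists_settled`), and
such a state is steady. There the optimal chains are read off from the runs (`segChain_topSum`,
`Settled.le_topSum`). By `segChain_natWord_iff`, `localIncr k w = λ_1 + ⋯ + λ_k` (`localIncr_eq`).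
For `localDecr`, a duality between cut chains and colourings (`localDecr_add_le`,
`exists_le_localDecr`) and the Legendre type duality between the sums of the `j` largest parts and
the sums `∑ min k λ_i` yield `localDecr k w = ∑ min k λ_i` (`localDecr_eq`).

*Greene's theorem.* The maximal sizes of `k`-increasing and `k`-decreasing subsequences are
invariants of Knuth equivalence (`Knuth.hasInc_iff`), `w` is Knuth equivalent to the reading word of
`P w` (`knuth_P`), and on reading words of tableaux rows and columns are optimal, since an
increasing and a decreasing subsequence share at most one letter (`HasInc.add_le`). Hence `incr k w`
and `decr k w` are the same sums for `μ`, and the last three statements are equivalent, because each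
family of sums determines the partition.

*Tableaux.* Reading a box, the carrier undergoes a row insertion (`knuth_carrierList`), so the
reading word of `SD w` is Knuth equivalent to `w` too (`knuth_ballsInOrder`). A Knuth class contains
the reading word of only one standard tableau (`IsStandard.eq_of_knuth`), hence `SD w = P w` if
`SD w` is standard. If `λ = μ`, then `decr k w = ∑ min k λ_i` for all `k`, and an optimal `k`-decreasing
subsequence, for `k` the length of a row, matches this row into the rows above it, so that the
columns of `SD w` increase (`pairwise_colLT_of_hasInc`).
-/

namespace BoxBall

/-! ### Chains in cut words -/

/-- `SegChain u v j m`: from the word `u` one can choose `m` letters which are weakly increasing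
within each segment, where `u` is cut into segments by `j` cuts and the letters chosen before the
first cut are at least `v`. -/
inductive SegChain : List ℕ → ℕ → ℕ → ℕ → Prop
  | nil (v j : ℕ) : SegChain [] v j 0
  | skip {x : ℕ} {u : List ℕ} {v j m : ℕ} : SegChain u v j m → SegChain (x :: u) v j m
  | pick {x : ℕ} {u : List ℕ} {v j m : ℕ} : v ≤ x → SegChain u x j m →
      SegChain (x :: u) v j (m + 1)
  | cut {u : List ℕ} {v j m : ℕ} : SegChain u 0 j m → SegChain u v (j + 1) m

namespace SegChain

theorem mono_floor {u : List ℕ} {v j m : ℕ} (h : SegChain u v j m) :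
    ∀ {v' : ℕ}, v' ≤ v → SegChain u v' j m := by
  induction h with
  | nil v j => intro _ _; exact nil _ _
  | skip _ ih => intro _ hv; exact skip (ih hv)
  | pick hx h _ => intro _ hv; exact pick (hv.trans hx) h
  | cut h _ => intro _ _; exact cut h

theorem add_cut {u : List ℕ} {v j m : ℕ} (h : SegChain u v j m) (v' : ℕ) :
    SegChain u v' (j + 1) m := cut (h.mono_floor (Nat.zero_le _))

theorem append_left {u : List ℕ} {v j m : ℕ} (l : List ℕ) (h : SegChain u v j m) :
    SegChain (l ++ u) v j m := by
  induction l with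
  | nil => exact h
  | cons x l ih => exact skip ih

theorem le_length {u : List ℕ} {v j m : ℕ} (h : SegChain u v j m) : m ≤ u.length := by
  induction h with
  | nil => simp
  | skip _ ih => rw [List.length_cons]; omega
  | pick _ _ ih => rw [List.length_cons]; omega
  | cut _ ih => exact ih

theorem mono_count {u : List ℕ} {v j m : ℕ} (h : SegChain u v j m) :
    ∀ {m' : ℕ}, m' ≤ m → SegChain u v j m' := by
  induction h with
  | nil =>
    intro m' hm
    obtain rfl : m' = 0 := by omega
    exact nil _ _
  | skip _ ih => intro _ hm; exact skip (ih hm)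
  | pick hx _ ih =>
    intro m' hm
    cases m' with
    | zero => exact skip ((ih (Nat.zero_le _)).mono_floor hx)
    | succ m' => exact pick hx (ih (by omega))
  | cut _ ih => intro _ hm; exact cut (ih hm)

theorem truncate {u' : List ℕ} {v j m : ℕ} (u : List ℕ) (h : SegChain (u ++ u') v j m) :
    ∃ m', SegChain u v j m' ∧ m ≤ m' + u'.length := by
  generalize hw : u ++ u' = w at h
  induction h generalizing u with
  | nil v j =>
    obtain ⟨rfl, rfl⟩ := List.append_eq_nil_iff.1 hw
    exact ⟨0, nil _ _, by simp⟩
  | @skip x w v j m h ih =>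
    cases u with
    | nil => exact ⟨0, nil _ _, by
        have := h.le_length; simp only [List.nil_append] at hw; subst hw; simp; omega⟩
    | cons y u =>
      obtain ⟨rfl, rfl⟩ := List.cons.inj hw
      obtain ⟨m', h1, h2⟩ := ih u rfl
      exact ⟨m', skip h1, h2⟩
  | @pick x w v j m hx h ih =>
    cases u with
    | nil => exact ⟨0, nil _ _, by
        have := h.le_length; simp only [List.nil_append] at hw; subst hw; simp; omega⟩
    | cons y u =>
      obtain ⟨rfl, rfl⟩ := List.cons.inj hw
      obtain ⟨m', h1, h2⟩ := ih u rfl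
      exact ⟨m' + 1, pick hx h1, by omega⟩
  | cut h ih =>
    obtain ⟨m', h1, h2⟩ := ih u hw
    exact ⟨m', cut h1, h2⟩

/-- Splitting off the first segment. -/
theorem firstSeg {u : List ℕ} {v j m : ℕ} (h : SegChain u v j m) :
    ∃ (u₁ u₂ V : List ℕ) (m' : ℕ), u = u₁ ++ u₂ ∧ V.Sublist u₁ ∧ V.Pairwise (· ≤ ·) ∧
      (∀ a ∈ V, v ≤ a) ∧ m = V.length + m' ∧
      ((j = 0 ∧ m' = 0 ∧ u₂ = []) ∨ ∃ j', j = j' + 1 ∧ SegChain u₂ 0 j' m') := by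
  induction h with
  | nil v j =>
    refine ⟨[], [], [], 0, rfl, by simp, by simp, by simp, rfl, ?_⟩
    cases j with
    | zero => exact Or.inl ⟨rfl, rfl, rfl⟩
    | succ j => exact Or.inr ⟨j, rfl, nil _ _⟩
  | @skip x u v j m h ih =>
    obtain ⟨u₁, u₂, V, m', rfl, h1, h2, h3, h4, h5⟩ := ih
    exact ⟨x :: u₁, u₂, V, m', rfl, h1.cons _, h2, h3, h4, h5⟩
  | @pick x u v j m hx h ih =>
    obtain ⟨u₁, u₂, V, m', rfl, h1, h2, h3, h4, h5⟩ := ih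
    refine ⟨x :: u₁, u₂, x :: V, m', rfl, h1.cons_cons _, List.pairwise_cons.2 ⟨h3, h2⟩, ?_, ?_, h5⟩
    · intro a ha
      rcases List.mem_cons.1 ha with rfl | ha
      · exact hx
      · exact hx.trans (h3 a ha)
    · simp only [List.length_cons]; omega
  | @cut u v j m h ih =>
    exact ⟨[], u, [], m, rfl, by simp, by simp, by simp, by simp, Or.inr ⟨j, rfl, h⟩⟩

theorem of_sublist {u₂ : List ℕ} {j m : ℕ} (h : ∀ v, SegChain u₂ v j m) {V u₁ : List ℕ}
    (hV : V.Sublist u₁) :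
    ∀ v, V.Pairwise (· ≤ ·) → (∀ a ∈ V, v ≤ a) → SegChain (u₁ ++ u₂) v j (V.length + m) := by
  induction hV with
  | slnil => intro v _ _; simpa using h v
  | cons a _ ih => intro v h1 h2; exact skip (ih v h1 h2)
  | cons_cons a _ ih =>
    intro v h1 h2
    rw [List.pairwise_cons] at h1
    have := pick (h2 a (by simp)) (ih a h1.2 h1.1)
    rw [List.length_cons, Nat.add_right_comm]
    exact this

theorem to_pieces {j : ℕ} : ∀ {u : List ℕ} {m : ℕ}, SegChain u 0 j m →
    ∃ U : List (List ℕ × List ℕ), U.length = j + 1 ∧ (U.map Prod.fst).flatten = u ∧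
      (∀ p ∈ U, p.2.Sublist p.1 ∧ p.2.Pairwise (· ≤ ·)) ∧
      m = (U.map (fun p => p.2.length)).sum := by
  induction j with
  | zero =>
    intro u m h
    obtain ⟨u₁, u₂, V, m', rfl, h1, h2, h3, h4, h5⟩ := h.firstSeg
    rcases h5 with ⟨_, rfl, rfl⟩ | ⟨j', h5, _⟩
    · exact ⟨[(u₁, V)], rfl, by simp, by simpa using ⟨h1, h2⟩, by simpa using h4⟩
    · omega
  | succ j ih =>
    intro u m h
    obtain ⟨u₁, u₂, V, m', rfl, h1, h2, h3, h4, h5⟩ := h.firstSeg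
    rcases h5 with ⟨h5, _, _⟩ | ⟨j', h5, h6⟩
    · omega
    · obtain rfl : j = j' := by omega
      obtain ⟨U, k1, k2, k3, k4⟩ := ih h6
      refine ⟨(u₁, V) :: U, by simp [k1], by simp [k2], ?_, by simp [h4, k4]⟩
      intro p hp
      rcases List.mem_cons.1 hp with rfl | hp
      · exact ⟨h1, h2⟩
      · exact k3 p hp

theorem of_pieces (U : List (List ℕ × List ℕ))
    (hU : ∀ p ∈ U, p.2.Sublist p.1 ∧ p.2.Pairwise (· ≤ ·)) (v : ℕ) :
    SegChain (U.map Prod.fst).flatten v U.length (U.map (fun p => p.2.length)).sum := by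
  induction U generalizing v with
  | nil => exact nil _ _
  | cons p U ih =>
    have hp := hU p (by simp)
    have := of_sublist (ih (fun q hq => hU q (by simp [hq]))) hp.1 0 hp.2 (by simp)
    simpa using cut (v := v) this

end SegChain

/-! ### Descents of coloured words -/

/-- The number of descents of the word `l u`. -/
def descFrom : ℕ → List ℕ → ℕ
  | _, [] => 0
  | l, x :: u => (if x < l then 1 else 0) + descFrom x u

theorem numDescents_cons {n : ℕ} (x : Fin n) (u : List (Fin n)) :
    numDescents (x :: u) = descFrom x (u.map Fin.val) := by
  induction u generalizing x with
  | nil => rfl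
  | cons y u ih =>
    have := ih y
    simp only [numDescents, List.tail_cons, List.zip_cons_cons, List.countP_cons, List.map_cons,
      descFrom] at this ⊢
    rw [this, Nat.add_comm]
    simp

theorem descStat_eq {n : ℕ} (u : List (Fin n)) : descStat u = descFrom n (u.map Fin.val) := by
  cases u with
  | nil => rfl
  | cons x u => simp [descStat, numDescents_cons, descFrom]

section Duality

variable {ι : Type*} {k : ℕ}

/-- The total number of descents of the colour classes of the word `f` along `ps`, where the class
of colour `i` is preceded by the letter `l i`. -/
def colourDesc (f : ι → ℕ) (c : ι → Fin k) (ps : List ι) (l : Fin k → ℕ) : ℕ :=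
  ∑ i, descFrom (l i) ((ps.filter (fun p => decide (c p = i))).map f)

theorem colourDesc_cons (f : ι → ℕ) (c : ι → Fin k) (p : ι) (ps : List ι) (l : Fin k → ℕ) :
    colourDesc f c (p :: ps) l =
      (if f p < l (c p) then 1 else 0) + colourDesc f c ps (Function.update l (c p) (f p)) := by
  unfold colourDesc
  rw [← Finset.add_sum_erase _ _ (Finset.mem_univ (c p)),
    ← Finset.add_sum_erase (a := c p) _ (fun i => descFrom (Function.update l (c p) (f p) i) _)
      (Finset.mem_univ (c p)), ← Nat.add_assoc]
  congr 1
  · simp [descFrom]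
  · refine Finset.sum_congr rfl fun i hi => ?_
    have hi : i ≠ c p := Finset.ne_of_mem_erase hi
    rw [List.filter_cons_of_neg (by simpa using hi.symm), Function.update_of_ne hi]

/-- The number of colours whose current letter exceeds `v`. -/
def above (l : Fin k → ℕ) (v : ℕ) : ℕ := (Finset.univ.filter (fun i => v < l i)).card

theorem above_update (l : Fin k → ℕ) (i : Fin k) (x v : ℕ) :
    above (Function.update l i x) v + (if v < l i then 1 else 0) =
      above l v + (if v < x then 1 else 0) := by
  unfold above
  simp only [Finset.card_filter]
  rw [← Finset.add_sum_erase _ _ (Finset.mem_univ i),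
    ← Finset.add_sum_erase (a := i) _ (fun j => if v < l j then 1 else 0) (Finset.mem_univ i)]
  have : ∑ j ∈ Finset.univ.erase i, (if v < Function.update l i x j then 1 else 0) =
      ∑ j ∈ Finset.univ.erase i, (if v < l j then 1 else 0) := by
    refine Finset.sum_congr rfl fun j hj => ?_
    rw [Function.update_of_ne (Finset.ne_of_mem_erase hj)]
  rw [this]
  simp only [Function.update_self]
  omega

theorem above_le (l : Fin k → ℕ) (v : ℕ) : above l v ≤ k := by
  simpa [above] using Finset.card_le_univ (Finset.univ.filter (fun i => v < l i))

theorem above_anti (l : Fin k → ℕ) {v v' : ℕ} (h : v ≤ v') : above l v' ≤ above l v :=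
  Finset.card_le_card fun i hi => by
    simp only [Finset.mem_filter, Finset.mem_univ, true_and] at hi ⊢
    omega

/-- Weak duality between colourings and chains in cut words. In a descent of a colour class the
letter `x` is preceded by a larger one, so `x` either costs a descent or a colour whose current
letter was at most `x`; the number of the colours above the floor of the chain keeps track of the
latter. -/
theorem colourDesc_add_le (f : ι → ℕ) (c : ι → Fin k) {u : List ℕ} {v j m : ℕ}
    (h : SegChain u v j m) : ∀ (ps : List ι) (l : Fin k → ℕ), ps.map f = u →
      colourDesc f c ps l + m ≤ ps.length + k * j + above l v := by
  induction h with
  | nil v j =>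
    intro ps l hu
    obtain rfl := List.map_eq_nil_iff.1 hu
    simp [colourDesc, descFrom]
  | @skip x u v j m h ih =>
    intro ps l hu
    obtain ⟨p, ps, rfl, rfl, hps⟩ := List.map_eq_cons_iff.1 hu
    have h1 := ih ps (Function.update l (c p) (f p)) hps
    have h2 := above_update l (c p) (f p) v
    rw [colourDesc_cons, List.length_cons]
    split_ifs at * <;> omega
  | @pick x u v j m hx h ih =>
    intro ps l hu
    obtain ⟨p, ps, rfl, rfl, hps⟩ := List.map_eq_cons_iff.1 hu
    have h1 := ih ps (Function.update l (c p) (f p)) hps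
    have h2 := above_update l (c p) (f p) (f p)
    have h3 := above_anti l hx
    rw [colourDesc_cons, List.length_cons]
    split_ifs at * <;> omega
  | @cut u v j m h ih =>
    intro ps l hu
    have h1 := ih ps l hu
    have h2 := above_le l 0
    rw [Nat.mul_succ]
    omega

/-- Strong duality: the greedy colouring, which gives each letter `x` the colour with the smallest
current letter above `x` (or the smallest current letter at all), is optimal, as is seen by
constructing a chain along with it. -/
theorem exists_colourDesc_ge [DecidableEq ι] (hk : 0 < k) (f : ι → ℕ) :
    ∀ (ps : List ι), ps.Nodup → ∀ l : Fin k → ℕ, ∃ (c : ι → Fin k) (v j m : ℕ),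
      SegChain (ps.map f) v j m ∧
        ps.length + k * j + above l v ≤ colourDesc f c ps l + m := by
  have : NeZero k := ⟨hk.ne'⟩
  intro ps
  induction ps with
  | nil =>
    intro _ l
    refine ⟨fun _ => 0, Finset.univ.sup l, 0, 0, SegChain.nil _ _, ?_⟩
    have : above l (Finset.univ.sup l) = 0 := by
      rw [above, Finset.card_eq_zero, Finset.filter_eq_empty_iff]
      intro i _
      exact not_lt.2 (Finset.le_sup (f := l) (Finset.mem_univ i))
    simp [this]
  | cons p ps ih =>
    intro hnd l
    rw [List.nodup_cons] at hnd
    set x := f p with hx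
    have key : ∀ i : Fin k, ∃ (c : ι → Fin k) (v j m : ℕ),
        SegChain (ps.map f) v j m ∧
        ps.length + k * j + above (Function.update l i x) v + (if x < l i then 1 else 0) ≤
          colourDesc f c (p :: ps) l + m := by
      intro i
      obtain ⟨c, v, j, m, h1, h2⟩ := ih hnd.2 (Function.update l i x)
      refine ⟨Function.update c p i, v, j, m, h1, ?_⟩
      have : colourDesc f (Function.update c p i) ps (Function.update l i x) =
          colourDesc f c ps (Function.update l i x) := by
        unfold colourDesc
        refine Finset.sum_congr rfl fun j _ => ?_
        congr 2
        refine List.filter_congr fun q hq => ?_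
        have : q ≠ p := fun h => hnd.1 (h ▸ hq)
        rw [Function.update_of_ne this]
      rw [colourDesc_cons, Function.update_self, ← hx, this]
      omega
    by_cases hex : ∃ i, x < l i
    · obtain ⟨i, hi, hmin⟩ := Finset.exists_min_image (Finset.univ.filter (fun i => x < l i)) l
        (by obtain ⟨i, hi⟩ := hex; exact ⟨i, by simpa using hi⟩)
      simp only [Finset.mem_filter, Finset.mem_univ, true_and] at hi hmin
      obtain ⟨c, v, j, m, h1, h2⟩ := key i
      have h3 := above_update l i x v
      rw [if_pos hi] at h2
      by_cases hv : x ≤ v ∧ v < l i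
      · refine ⟨c, x, j, m + 1, SegChain.pick le_rfl (h1.mono_floor hv.1), ?_⟩
        have : above l x ≤ above l v := Finset.card_le_card fun i' hi' => by
          simp only [Finset.mem_filter, Finset.mem_univ, true_and] at hi' ⊢
          have := hmin i' hi'
          omega
        rw [if_pos hv.2, if_neg (by omega)] at h3
        rw [List.length_cons]
        omega
      · refine ⟨c, v, j, m, SegChain.skip h1, ?_⟩
        rw [List.length_cons]
        split_ifs at h3 <;> omega
    · push Not at hex
      obtain ⟨i, -, hmin⟩ := Finset.exists_min_image Finset.univ l ⟨(0 : Fin k), by simp⟩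
      obtain ⟨c, v, j, m, h1, h2⟩ := key i
      have h3 := above_update l i x v
      have h0 : above l x = 0 := by
        rw [above, Finset.card_eq_zero, Finset.filter_eq_empty_iff]
        intro i _
        exact not_lt.2 (hex i)
      have hi := hex i
      by_cases hv : x ≤ v
      · refine ⟨c, x, j, m + 1, SegChain.pick le_rfl (h1.mono_floor hv), ?_⟩
        rw [List.length_cons]
        omega
      · by_cases hv' : l i ≤ v
        · refine ⟨c, v, j, m, SegChain.skip h1, ?_⟩
          rw [List.length_cons]
          split_ifs at h3 <;> omega
        · refine ⟨c, x, j + 1, m + 1, SegChain.pick le_rfl (h1.add_cut x), ?_⟩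
          have : above l v = k := by
            have : Finset.univ.filter (fun i => v < l i) = Finset.univ :=
              Finset.filter_true_of_mem fun i' _ => by
                have := hmin i' (by simp)
                omega
            rw [above, this, Finset.card_fin]
          rw [List.length_cons, Nat.mul_succ]
          split_ifs at h3 <;> omega

end Duality

/-! ### The localized statistics in terms of chains -/

variable {n : ℕ}

/-- The word of `w` with natural numbers as letters. -/
def natWord (w : Equiv.Perm (Fin n)) : List ℕ := (List.finRange n).map (fun i => (w i : ℕ))

theorem natWord_eq (w : Equiv.Perm (Fin n)) : natWord w = (word w).map Fin.val := by
  simp [natWord, word]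

theorem natWord_length (w : Equiv.Perm (Fin n)) : (natWord w).length = n := by simp [natWord]

theorem word_nodup (w : Equiv.Perm (Fin n)) : (word w).Nodup :=
  (List.nodup_finRange n).map w.injective

theorem lt_of_mem_natWord {w : Equiv.Perm (Fin n)} {a : ℕ} (h : a ∈ natWord w) : a < n := by
  simp only [natWord, List.mem_map] at h
  obtain ⟨i, _, rfl⟩ := h
  exact (w i).2

/-- A floor above all letters prevents any choice before the first cut. -/
theorem segChain_of_top {u : List ℕ} {e j m : ℕ} (hu : ∀ a ∈ u, a < e) (h : SegChain u e j m) :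
    (j = 0 ∧ m = 0) ∨ ∃ j', j = j' + 1 ∧ SegChain u 0 j' m := by
  obtain ⟨u₁, u₂, V, m', rfl, h1, h2, h3, h4, h5⟩ := h.firstSeg
  have hV : V = [] := List.eq_nil_iff_forall_not_mem.2 fun a ha => by
    have := hu a (List.mem_append_left _ (h1.subset ha))
    have := h3 a ha
    omega
  subst hV
  simp only [List.length_nil, Nat.zero_add] at h4
  subst h4
  rcases h5 with ⟨h5, h6, _⟩ | ⟨j', h5, h6⟩
  · exact Or.inl ⟨h5, h6⟩
  · exact Or.inr ⟨j', h5, h6.append_left _⟩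

theorem le_longestIncr {u V : List (Fin n)} (hV : V.Sublist u) (h : V.Pairwise (· < ·)) :
    V.length ≤ longestIncr u :=
  Finset.le_sup (f := List.length) (by simpa using ⟨hV, h⟩)

theorem exists_longestIncr (u : List (Fin n)) :
    ∃ V : List (Fin n), V.Sublist u ∧ V.Pairwise (· < ·) ∧ V.length = longestIncr u := by
  obtain ⟨V, hV, h⟩ := Finset.exists_mem_eq_sup
    (u.sublists.toFinset.filter (fun v => v.Pairwise (· < ·))) ⟨[], by simp⟩ List.length
  simp only [Finset.mem_filter, List.mem_toFinset, List.mem_sublists] at hV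
  exact ⟨V, hV.1, hV.2, h.symm⟩

theorem longestIncr_le (u : List (Fin n)) : longestIncr u ≤ u.length := by
  obtain ⟨V, hV, _, h⟩ := exists_longestIncr u
  exact h ▸ hV.length_le

theorem localIncr_bddAbove (k : ℕ) (w : Equiv.Perm (Fin n)) :
    BddAbove {m | ∃ U : List (List (Fin n)), U.length = k ∧ U.flatten = word w ∧
      m = (U.map longestIncr).sum} := by
  refine ⟨n, ?_⟩
  rintro m ⟨U, -, h, rfl⟩
  have : (U.map longestIncr).sum ≤ (U.map List.length).sum :=
    List.sum_le_sum fun u _ => longestIncr_le u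
  rw [← List.length_flatten, h] at this
  simpa [word] using this

theorem exists_map_fst {U : List (List ℕ × List ℕ)} {W : List (Fin n)}
    (h : (U.map Prod.fst).flatten = W.map Fin.val) :
    ∃ U' : List (List (Fin n) × List ℕ), (U'.map Prod.fst).flatten = W ∧
      U'.map (fun p => (p.1.map Fin.val, p.2)) = U := by
  induction U generalizing W with
  | nil => exact ⟨[], by simpa using h.symm, rfl⟩
  | cons p U ih =>
    simp only [List.map_cons, List.flatten_cons] at h
    obtain ⟨W₁, W₂, rfl, h1, h2⟩ := List.append_eq_map_iff.1 h
    obtain ⟨U', k1, k2⟩ := ih h2.symm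
    refine ⟨(W₁, p.2) :: U', by simp [k1], ?_⟩
    simp [k2, h1]

/-- The pieces of a word cut in `j` places give a lower bound for `localIncr (j + 1)`. -/
theorem le_localIncr {w : Equiv.Perm (Fin n)} {j m : ℕ} (h : SegChain (natWord w) 0 j m) :
    m ≤ localIncr (j + 1) w := by
  obtain ⟨U, h1, h2, h3, h4⟩ := h.to_pieces
  rw [natWord_eq] at h2
  obtain ⟨U', k1, rfl⟩ := exists_map_fst h2
  have hnd : ∀ p ∈ U', p.1.Nodup := by
    intro p hp
    have := word_nodup w
    rw [← k1, List.nodup_flatten] at this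
    exact this.1 p.1 (List.mem_map_of_mem hp)
  have hle : (U'.map (fun p => p.2.length)).sum ≤ (U'.map (fun p => longestIncr p.1)).sum := by
    refine List.sum_le_sum fun p hp => ?_
    obtain ⟨h5, h6⟩ := h3 (p.1.map Fin.val, p.2)
      (List.mem_map_of_mem (f := fun p : List (Fin n) × List ℕ => (p.1.map Fin.val, p.2)) hp)
    obtain ⟨V, hV, hV2⟩ := List.sublist_map_iff.1 h5
    simp only at hV2 h6
    rw [hV2, List.length_map]
    refine le_longestIncr hV ?_
    rw [hV2, List.pairwise_map] at h6
    have h7 : V.Pairwise (· ≠ ·) := (hnd p hp).sublist hV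
    exact (h6.and h7).imp fun ⟨a, b⟩ => lt_of_le_of_ne a b
  have : m ≤ (U'.map (fun p => longestIncr p.1)).sum := by
    rw [h4]; simpa [Function.comp_def] using hle
  refine this.trans (le_csSup (localIncr_bddAbove _ _) ⟨U'.map Prod.fst, by simpa using h1, k1, ?_⟩)
  rw [List.map_map]; rfl

/-- An optimal decomposition into `k` pieces gives a chain with `k` cuts, one of them at the very
beginning, so that the floor does not matter. -/
theorem segChain_localIncr (w : Equiv.Perm (Fin n)) {k : ℕ} (hk : 1 ≤ k) (v : ℕ) :
    SegChain (natWord w) v k (localIncr k w) := by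
  obtain ⟨U, h1, h2, h3⟩ := Nat.sSup_mem (s := {m | ∃ U : List (List (Fin n)), U.length = k ∧
      U.flatten = word w ∧ m = (U.map longestIncr).sum})
    ⟨_, word w :: List.replicate (k - 1) [], by simp; omega, by simp, rfl⟩ (localIncr_bddAbove k w)
  choose V hV1 hV2 hV3 using exists_longestIncr (n := n)
  have := SegChain.of_pieces (U.map (fun u => (u.map Fin.val, (V u).map Fin.val))) (by
    intro p hp
    obtain ⟨u, _, rfl⟩ := List.mem_map.1 hp
    exact ⟨(hV1 u).map _, List.pairwise_map.2 ((hV2 u).imp fun h => le_of_lt h)⟩) v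
  have e : localIncr k w = (U.map longestIncr).sum := h3
  rw [e, natWord_eq, ← h2, List.map_flatten]
  simpa [Function.comp_def, hV3, h1] using this

theorem sum_descStat_eq {k : ℕ} (w : Equiv.Perm (Fin n)) (c : Fin n → Fin k) :
    ∑ j, descStat (colourSubword w c j) =
      colourDesc (fun i => (w i : ℕ)) c (List.finRange n) (fun _ => n) := by
  simp [descStat_eq, colourSubword, colourDesc, Function.comp_def]

/-- Weak duality for a permutation: in front of every colour class stands a letter `n`. -/
theorem localDecr_add_le (w : Equiv.Perm (Fin n)) (k : ℕ) {j m : ℕ}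
    (h : SegChain (natWord w) n j m) : localDecr k w + m ≤ n + k * j := by
  obtain ⟨c, -, hc⟩ | hc : (∃ c : Fin n → Fin k, c ∈ Finset.univ ∧
      localDecr k w = ∑ j, descStat (colourSubword w c j)) ∨ localDecr k w = 0 := by
    rcases (Finset.univ : Finset (Fin n → Fin k)).eq_empty_or_nonempty with he | hne
    · right; rw [localDecr, he]; rfl
    · left
      exact Finset.exists_mem_eq_sup _ hne _
  · rw [hc, sum_descStat_eq]
    have := colourDesc_add_le (fun i => (w i : ℕ)) c h (List.finRange n) (fun _ => n) rfl
    simpa [above] using this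
  · have := h.le_length
    rw [natWord_length] at this
    omega

/-- Strong duality for a permutation. -/
theorem exists_le_localDecr (w : Equiv.Perm (Fin n)) {k : ℕ} (hk : 1 ≤ k) :
    ∃ j m, SegChain (natWord w) n j m ∧ n + k * j ≤ localDecr k w + m := by
  obtain ⟨c, v, j, m, h1, h2⟩ := exists_colourDesc_ge hk (fun i => (w i : ℕ)) (List.finRange n)
    (List.nodup_finRange n) (fun _ => n)
  have h3 : colourDesc (fun i => (w i : ℕ)) c (List.finRange n) (fun _ => n) ≤ localDecr k w := by
    rw [← sum_descStat_eq]
    exact Finset.le_sup (f := fun c : Fin n → Fin k => ∑ j, descStat (colourSubword w c j))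
      (Finset.mem_univ c)
  rw [List.length_finRange] at h2
  by_cases hv : v < n
  · refine ⟨j + 1, m, h1.add_cut n, ?_⟩
    have : above (fun _ : Fin k => n) v = k := by simp [above, hv]
    rw [Nat.mul_succ]
    omega
  · exact ⟨j, m, h1.mono_floor (by omega), by omega⟩

/-! ### Blocks in the affine alphabet -/

/-- A block of letters, as seen in the affine alphabet `ℤ`: `wt v` is the number of letters of
the block of which `v` is a lift, and `cap` is the number of letters. -/
structure Block where
  cap : ℕ
  wt : ℤ → ℕ

/-- The weight of the interval `[a, b]`. -/
noncomputable def cnt (f : ℤ → ℕ) (a b : ℤ) : ℕ := ∑ v ∈ Finset.Icc a b, f v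

/-- The number of letters of the block which a path from `a` to `b` can use. -/
noncomputable def Block.gain (B : Block) (a b : ℤ) : ℕ := min B.cap (cnt B.wt a b)

/-- A weakly increasing path from `a` to `b` through the sequence `L` of blocks can gain `m`. -/
def PathGain : List Block → ℤ → ℤ → ℕ → Prop
  | [], a, b, m => a ≤ b ∧ m = 0
  | B :: L, a, b, m => ∃ t m', a ≤ t ∧ PathGain L t b m' ∧ m ≤ B.gain a t + m'

/-- The indicator function of the lifts of the letter `x`. -/
def lifts (N x : ℤ) (v : ℤ) : ℕ := if N ∣ v - x then 1 else 0

section Exchange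

theorem cnt_mono (f : ℤ → ℕ) {a a' b b' : ℤ} (ha : a' ≤ a) (hb : b ≤ b') :
    cnt f a b ≤ cnt f a' b' :=
  Finset.sum_le_sum_of_subset (Finset.Icc_subset_Icc ha hb)

theorem cnt_split (f : ℤ → ℕ) {a b : ℤ} (c : ℤ) (h1 : a ≤ c) (h2 : c ≤ b + 1) :
    cnt f a b = cnt f a (c - 1) + cnt f c b := by
  unfold cnt
  rw [← Finset.sum_union]
  · congr 1
    ext v
    simp only [Finset.mem_Icc, Finset.mem_union]
    omega
  · rw [Finset.disjoint_left]
    intro v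
    simp only [Finset.mem_Icc]
    omega

theorem cnt_self (f : ℤ → ℕ) (a : ℤ) : cnt f a a = f a := by simp [cnt]

theorem cnt_eq_zero {f : ℤ → ℕ} {a b : ℤ} (h : ∀ v, a ≤ v → v ≤ b → f v = 0) : cnt f a b = 0 :=
  Finset.sum_eq_zero fun v hv => h v (Finset.mem_Icc.1 hv).1 (Finset.mem_Icc.1 hv).2

theorem le_cnt {f : ℤ → ℕ} {a b v : ℤ} (h1 : a ≤ v) (h2 : v ≤ b) : f v ≤ cnt f a b :=
  Finset.single_le_sum (f := f) (fun _ _ => Nat.zero_le _) (Finset.mem_Icc.2 ⟨h1, h2⟩)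

theorem exists_of_cnt_pos {f : ℤ → ℕ} {a b : ℤ} (h : cnt f a b ≠ 0) :
    ∃ v, a ≤ v ∧ v ≤ b ∧ f v ≠ 0 := by
  by_contra! hc
  exact h (cnt_eq_zero hc)

theorem cnt_reflect (f : ℤ → ℕ) (a b : ℤ) : cnt (fun v => f (-v)) (-b) (-a) = cnt f a b := by
  unfold cnt
  refine Finset.sum_nbij' (fun v => -v) (fun v => -v) ?_ ?_ ?_ ?_ ?_ <;>
    simp only [Finset.mem_Icc] <;> intros <;> first | omega | simp

theorem cnt_lifts_le {N x y a b a' b' : ℤ} (d : ℤ) (hd : N ∣ y + d - x)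
    (h : ∀ v, a ≤ v → v ≤ b → N ∣ v - y → a' ≤ v + d ∧ v + d ≤ b') :
    cnt (lifts N y) a b ≤ cnt (lifts N x) a' b' := by
  unfold cnt lifts
  rw [← Finset.card_filter, ← Finset.card_filter]
  refine Finset.card_le_card_of_injOn (fun v => v + d) ?_ (fun _ _ _ _ h => by simpa using h)
  intro v hv
  simp only [Finset.coe_filter, Finset.mem_Icc, Set.mem_ofPred_eq] at hv ⊢
  refine ⟨h v hv.1.1 hv.1.2 hv.2, ?_⟩
  have : v + d - x = (v - y) + (y + d - x) := by ring
  rw [this]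
  exact dvd_add hv.2 hd

theorem eq_or_le_of_dvd {N u v : ℤ} (h : N ∣ u - v) (huv : v < u) : v + N ≤ u := by
  have := Int.le_of_dvd (by omega) h
  omega

/-- The first lift of `y` from `a` on. -/
theorem exists_first_lift {N : ℤ} (hN : 0 < N) (y a : ℤ) :
    ∃ Y, a ≤ Y ∧ Y < a + N ∧ N ∣ Y - y := by
  refine ⟨a + (y - a) % N, ?_, ?_, ?_⟩
  · have := Int.emod_nonneg (y - a) hN.ne'; omega
  · have := Int.emod_lt_of_pos (y - a) hN; omega
  · have : a + (y - a) % N - y = -(N * ((y - a) / N)) := by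
      have := Int.emod_add_mul_ediv (y - a) N
      linarith
    rw [this]
    exact (dvd_mul_right _ _).neg_right

/-- The hypotheses of the exchange of a block `ω` with a letter `x`: `y` is the cyclically next
letter of the block after `x`, and the block `ω'` arises from `ω` by replacing `y` with `x`. -/
structure IsExchange (N x y : ℤ) (m : ℕ) (ω ω' : ℤ → ℕ) : Prop where
  pos : 0 < N
  lt : x < y
  le : y ≤ x + N
  per : ∀ v u, N ∣ v - u → ω v = ω u
  per' : ∀ v u, N ∣ v - u → ω' v = ω' u
  gap : ∀ v, x < v → v < y → ω v = 0
  mem : 1 ≤ ω y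
  total : ∀ z, cnt ω (z + 1) (z + N) = m
  total' : ∀ z, cnt ω' (z + 1) (z + N) = m
  rel : ∀ v, ω' v + lifts N y v = ω v + lifts N x v

theorem IsExchange.reflect {N x y : ℤ} {m : ℕ} {ω ω' : ℤ → ℕ} (h : IsExchange N x y m ω ω') :
    IsExchange N (-y) (-x) m (fun v => ω' (-v)) (fun v => ω (-v)) where
  pos := h.pos
  lt := by have := h.lt; omega
  le := by have := h.le; omega
  per v u huv := h.per' _ _ (by rw [show -v - -u = -(v - u) by ring]; exact huv.neg_right)
  per' v u huv := h.per _ _ (by rw [show -v - -u = -(v - u) by ring]; exact huv.neg_right)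
  gap v hv1 hv2 := by
    have h1 := h.gap (-v) (by omega) (by omega)
    have h2 := h.rel (-v)
    have h3 : ¬ N ∣ -v - x := fun hd => by
      have := eq_or_le_of_dvd hd (by omega)
      have := h.le
      omega
    rw [h1, lifts, lifts, if_neg h3] at h2
    omega
  mem := by
    have h2 := h.rel x
    rw [neg_neg]
    simp only [lifts, sub_self, dvd_zero, if_true] at h2
    split_ifs at h2 with hd
    · have := h.per x y hd
      have := h.mem
      omega
    · omega
  total z := by
    have := h.total' (-z - N - 1)
    rw [← cnt_reflect] at this
    rw [← this]
    congr 1 <;> ring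
  total' z := by
    have := h.total (-z - N - 1)
    rw [← cnt_reflect] at this
    rw [← this]
    congr 1 <;> ring
  rel v := by
    have := h.rel (-v)
    have e : ∀ a, lifts N (-a) v = lifts N a (-v) := by
      intro a
      simp only [lifts, show v - -a = -(-v - a) by ring, dvd_neg]
    rw [e, e]
    omega

variable {N x y : ℤ} {m : ℕ} {ω ω' : ℤ → ℕ}

theorem IsExchange.cnt_rel (h : IsExchange N x y m ω ω') (a b : ℤ) :
    cnt ω' a b + cnt (lifts N y) a b = cnt ω a b + cnt (lifts N x) a b := by
  unfold cnt
  rw [← Finset.sum_add_distrib, ← Finset.sum_add_distrib]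
  exact Finset.sum_congr rfl fun v _ => h.rel v

/-- The letter `x` after the block `ω` can be replaced by the letter `y` before the block `ω'`
without loss for paths from `a` to `b`. Let `Y` be the first lift of `y` from `a` on and `X₀` the
preceding lift of `x`, so that `ω` has no letters between them. The new path passes from the letter
to the block at `Y` if it can collect `y` in this way without loss, and at `a` otherwise. -/
theorem IsExchange.exchange (h : IsExchange N x y m ω ω') {a t b : ℤ} (hat : a ≤ t) (htb : t ≤ b) :
    ∃ t', a ≤ t' ∧ t' ≤ b ∧ min m (cnt ω a t) + min 1 (cnt (lifts N x) t b) ≤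
      min 1 (cnt (lifts N y) a t') + min m (cnt ω' t' b) := by
  have hN := h.pos
  have hlt := h.lt
  have hle := h.le
  obtain ⟨Y, haY, hYa, hY⟩ := exists_first_lift hN y a
  have hωY : 1 ≤ ω Y := by rw [h.per Y y hY]; exact h.mem
  have hmono : cnt ω a t ≤ cnt ω a b := cnt_mono _ le_rfl htb
  set X₀ := Y - (y - x) with hX₀
  have hX₀x : N ∣ X₀ - x := by rw [show X₀ - x = Y - y by omega]; exact hY
  have hyY : ∀ v, a ≤ v → v < Y → lifts N y v = 0 := by
    intro v hv1 hv2
    rw [lifts, if_neg]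
    intro hd
    have : N ∣ Y - v := by rw [show Y - v = (Y - y) - (v - y) by ring]; exact dvd_sub hY hd
    have := eq_or_le_of_dvd this hv2
    omega
  have hone : lifts N x X₀ = 1 := by rw [lifts, if_pos hX₀x]
  have honeY : lifts N y Y = 1 := by rw [lifts, if_pos hY]
  have hgap : cnt ω (X₀ + 1) (Y - 1) = 0 := cnt_eq_zero fun v h1 h2 => by
    rw [h.per v (v - Y + y) (by rw [show v - (v - Y + y) = Y - y by ring]; exact hY)]
    exact h.gap _ (by omega) (by omega)
  have hfew : ∀ c, c < Y → cnt ω a c + 1 ≤ m := by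
    intro c hc
    have h1 := h.total (Y - N)
    rw [cnt_split ω Y (by omega) (by omega), sub_add_cancel, cnt_self] at h1
    have h2 : cnt ω a c ≤ cnt ω (Y - N + 1) (Y - 1) := cnt_mono _ (by omega) (by omega)
    omega
  have hdec : ∀ X, N ∣ X - x → X₀ < X → X₀ + N ≤ X := fun X hX hlt => by
    refine eq_or_le_of_dvd ?_ hlt
    rw [show X - X₀ = (X - x) - (X₀ - x) by ring]
    exact dvd_sub hX hX₀x
  -- every lift of `y` in `[Y, X]` is followed by a lift of `x` in this interval
  have hC2 : ∀ X, N ∣ X - x → cnt ω Y X ≤ cnt ω' Y X := by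
    intro X hX
    have h1 := h.cnt_rel Y X
    have h2 : cnt (lifts N y) Y X ≤ cnt (lifts N x) Y X := by
      refine cnt_lifts_le (x - y + N) ⟨1, by ring⟩ fun v hv1 hv2 hv => ⟨by omega, ?_⟩
      have : N ∣ X - (v + (x - y)) := by
        rw [show X - (v + (x - y)) = (X - x) - (v - y) by ring]; exact dvd_sub hX hv
      have := eq_or_le_of_dvd this (by omega)
      omega
    omega
  have hx_of : cnt (lifts N x) t b ≠ 0 → ∃ X, t ≤ X ∧ X ≤ b ∧ N ∣ X - x := by
    intro h1
    obtain ⟨X, h2, h3, h4⟩ := exists_of_cnt_pos h1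
    refine ⟨X, h2, h3, ?_⟩
    by_contra hd
    exact h4 (if_neg hd)
  by_cases hYb : b < Y
  · have h1 : cnt (lifts N y) a b = 0 := cnt_eq_zero fun v hv1 hv2 => hyY v hv1 (by omega)
    have h2 := h.cnt_rel a b
    refine ⟨a, le_rfl, hat.trans htb, ?_⟩
    have h3 : cnt (lifts N x) t b ≤ cnt (lifts N x) a b := cnt_mono _ hat le_rfl
    have h4 := hfew t (by omega)
    omega
  push Not at hYb
  -- each lift of `y` but the first one, `Y`, is preceded by a lift of `x`
  have hC1 : cnt ω Y b ≤ cnt ω' Y b + 1 := by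
    have h1 := h.cnt_rel Y b
    have h2 : cnt (lifts N y) (Y + 1) b ≤ cnt (lifts N x) Y b := by
      refine cnt_lifts_le (x - y) ⟨0, by ring⟩ fun v hv1 hv2 hv => ⟨?_, by omega⟩
      have : N ∣ v - Y := by rw [show v - Y = (v - y) - (Y - y) by ring]; exact dvd_sub hv hY
      have := eq_or_le_of_dvd this (by omega)
      omega
    have h3 := cnt_split (lifts N y) (a := Y) (b := b) (Y + 1) (by omega) (by omega)
    rw [add_sub_cancel_right, cnt_self, honeY] at h3
    omega
  have hY1 : 1 ≤ cnt (lifts N y) a Y := honeY ▸ le_cnt haY le_rfl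
  by_cases hXa : X₀ < a
  · have h0 : ∀ c, Y ≤ c + 1 → cnt ω a c = cnt ω Y c := by
      intro c hc
      have h1 : cnt ω a (Y - 1) ≤ cnt ω (X₀ + 1) (Y - 1) := cnt_mono _ (by omega) le_rfl
      rw [cnt_split ω Y haY hc]
      omega
    refine ⟨Y, haY, hYb, ?_⟩
    by_cases hx : cnt (lifts N x) t b = 0
    · have := h0 b (by omega)
      omega
    · obtain ⟨X, hX1, hX2, hX3⟩ := hx_of hx
      have h2 := hdec X hX3 (by omega)
      have h3 := h0 X (by omega)
      have h4 := hC2 X hX3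
      have h5 : cnt ω' Y X ≤ cnt ω' Y b := cnt_mono _ le_rfl hX2
      have h6 : cnt ω a t ≤ cnt ω a X := cnt_mono _ le_rfl hX1
      omega
  · push Not at hXa
    have h1 : cnt (lifts N y) a (Y - 1) = 0 :=
      cnt_eq_zero fun v hv1 hv2 => hyY v hv1 (by omega)
    have h2 := h.cnt_rel a (Y - 1)
    have h3 : 1 ≤ cnt (lifts N x) a (Y - 1) := hone ▸ le_cnt hXa (by omega)
    have h4 := cnt_split ω Y haY (b := b) (by omega)
    have h5 := cnt_split ω' Y haY (b := b) (by omega)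
    by_cases hx : cnt (lifts N x) t b = 0
    · exact ⟨a, le_rfl, hat.trans htb, by omega⟩
    · obtain ⟨X, hX1, hX2, hX3⟩ := hx_of hx
      by_cases hX : X₀ < X
      · have h6 := hdec X hX3 hX
        refine ⟨Y, haY, hYb, ?_⟩
        have h7 := h.total X₀
        rw [cnt_split ω Y (by omega) (by omega)] at h7
        have h8 := hC2 (X₀ + N) (by
          rw [show X₀ + N - x = (X₀ - x) + N by ring]; exact dvd_add hX₀x dvd_rfl)
        have h9 : cnt ω' Y (X₀ + N) ≤ cnt ω' Y b := cnt_mono _ le_rfl (by omega)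
        omega
      · have h6 := hfew t (by omega)
        have h7 : cnt ω a t ≤ cnt ω a (Y - 1) := cnt_mono _ le_rfl (by omega)
        exact ⟨a, le_rfl, hat.trans htb, by omega⟩

/-- The converse exchange follows by the reflection `v ↦ -v`. -/
theorem IsExchange.exchange' (h : IsExchange N x y m ω ω') {a t b : ℤ} (hat : a ≤ t)
    (htb : t ≤ b) : ∃ t', a ≤ t' ∧ t' ≤ b ∧
      min 1 (cnt (lifts N y) a t) + min m (cnt ω' t b) ≤
        min m (cnt ω a t') + min 1 (cnt (lifts N x) t' b) := by
  obtain ⟨t', h1, h2, h3⟩ := h.reflect.exchange (neg_le_neg htb) (neg_le_neg hat)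
  refine ⟨-t', by omega, by omega, ?_⟩
  have e : ∀ z, lifts N (-z) = fun v => lifts N z (-v) := by
    intro z
    funext v
    simp only [lifts, show v - -z = -(-v - z) by ring, dvd_neg]
  rw [e, e, cnt_reflect, cnt_reflect] at h3
  have h4 := cnt_reflect ω a (-t')
  have h5 := cnt_reflect (lifts N x) (-t') b
  rw [neg_neg] at h4 h5
  rw [← h4, ← h5]
  omega

end Exchange

/-! ### Paths and chains -/

theorem PathGain.le {L : List Block} {a b : ℤ} {m : ℕ} (h : PathGain L a b m) : a ≤ b := by
  induction L generalizing a m with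
  | nil => exact h.1
  | cons B L ih =>
    obtain ⟨t, m', h1, h2, -⟩ := h
    exact h1.trans (ih h2)

theorem PathGain.mono_left {L : List Block} {a a' b : ℤ} {m : ℕ} (h : PathGain L a b m)
    (ha : a' ≤ a) : PathGain L a' b m := by
  cases L with
  | nil => exact ⟨ha.trans h.1, h.2⟩
  | cons B L =>
    obtain ⟨t, m', h1, h2, h3⟩ := h
    refine ⟨t, m', ha.trans h1, h2, h3.trans (Nat.add_le_add_right ?_ _)⟩
    exact min_le_min le_rfl (cnt_mono _ ha le_rfl)

/-- Two adjacent blocks can be exchanged locally. -/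
theorem PathGain.exchange {B₁ B₂ B₁' B₂' : Block}
    (hB : ∀ a t b, a ≤ t → t ≤ b → ∃ t', a ≤ t' ∧ t' ≤ b ∧
      B₁.gain a t + B₂.gain t b ≤ B₁'.gain a t' + B₂'.gain t' b) (L R : List Block) :
    ∀ {a b : ℤ} {m : ℕ}, PathGain (L ++ B₁ :: B₂ :: R) a b m →
      PathGain (L ++ B₁' :: B₂' :: R) a b m := by
  induction L with
  | nil =>
    rintro a b m ⟨t, m', h1, ⟨t₂, m₂, h2, h3, h4⟩, h5⟩
    obtain ⟨t', k1, k2, k3⟩ := hB a t t₂ h1 h2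
    exact ⟨t', B₂'.gain t' t₂ + m₂, k1, ⟨t₂, m₂, k2, h3, le_rfl⟩, by omega⟩
  | cons B L ih =>
    rintro a b m ⟨t, m', h1, h2, h3⟩
    exact ⟨t, m', h1, ih h2, h3⟩

theorem PathGain.congr_append {R R' : List Block}
    (hR : ∀ a b m, PathGain R a b m → PathGain R' a b m) (L : List Block) :
    ∀ {a b : ℤ} {m : ℕ}, PathGain (L ++ R) a b m → PathGain (L ++ R') a b m := by
  induction L with
  | nil => intro a b m; exact hR a b m
  | cons B L ih =>
    rintro a b m ⟨t, m', h1, h2, h3⟩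
    exact ⟨t, m', h1, ih h2, h3⟩

/-- The block of a single letter. -/
def letterBlock (N : ℤ) (x : ℕ) : Block := ⟨1, lifts N x⟩

/-- The block of `r` copies of the same letter. -/
def repBlock (N : ℤ) (r : ℕ) (x : ℕ) : Block := ⟨r, fun v => r * lifts N x v⟩

theorem repBlock_gain (N : ℤ) (r x : ℕ) (a b : ℤ) :
    (repBlock N r x).gain a b = r * (letterBlock N x).gain a b := by
  unfold repBlock letterBlock Block.gain cnt
  simp only [← Finset.mul_sum]
  set s := ∑ v ∈ Finset.Icc a b, lifts N (↑x) v
  rcases Nat.eq_zero_or_pos s with h | h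
  · simp [h]
  · rw [min_eq_left (a := 1) h, min_eq_left (Nat.le_mul_of_pos_right r h), mul_one]

theorem letterBlock_gain_split {N : ℤ} {x : ℕ} {a b : ℤ}
    (h : (letterBlock N x).gain a b ≠ 0) : ∃ v, a ≤ v ∧ v ≤ b ∧ N ∣ v - x := by
  have h1 : cnt (lifts N x) a b ≠ 0 := by
    intro h0
    simp [Block.gain, letterBlock, h0] at h
  obtain ⟨v, h2, h3, h4⟩ := exists_of_cnt_pos h1
  refine ⟨v, h2, h3, ?_⟩
  by_contra hd
  exact h4 (if_neg hd)

theorem letterBlock_gain_eq {N : ℤ} {x : ℕ} {a b v : ℤ} (h1 : a ≤ v) (h2 : v ≤ b)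
    (h3 : N ∣ v - x) : (letterBlock N x).gain a b = 1 := by
  have : lifts N x v ≤ cnt (lifts N x) a b := le_cnt h1 h2
  rw [lifts, if_pos h3] at this
  exact min_eq_left this

theorem letterBlock_gain_le (N : ℤ) (x : ℕ) (a b : ℤ) : (letterBlock N x).gain a b ≤ 1 :=
  min_le_left _ _

/-- Equal letters in succession can be merged into one block. -/
theorem pathGain_rep (N : ℤ) (x : ℕ) (R : List Block) (r : ℕ) (a b : ℤ) (m : ℕ) :
    PathGain (List.replicate r (letterBlock N x) ++ R) a b m ↔
      PathGain (repBlock N r x :: R) a b m := by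
  constructor
  · induction r generalizing a m with
    | zero =>
      intro h
      exact ⟨a, m, le_rfl, h, by omega⟩
    | succ r ih =>
      rintro ⟨t, m', h1, h2, h3⟩
      obtain ⟨t₂, m₂, k1, k2, k3⟩ := ih t m' h2
      refine ⟨t₂, m₂, h1.trans k1, k2, ?_⟩
      rw [repBlock_gain] at k3 ⊢
      have e1 : (letterBlock N x).gain a t ≤ (letterBlock N x).gain a t₂ :=
        min_le_min le_rfl (cnt_mono _ le_rfl k1)
      have e2 : (letterBlock N x).gain t t₂ ≤ (letterBlock N x).gain a t₂ :=
        min_le_min le_rfl (cnt_mono _ h1 le_rfl)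
      have e3 := Nat.mul_le_mul_left r e2
      rw [Nat.succ_mul]
      omega
  · rintro ⟨t, m', h1, h2, h3⟩
    rw [repBlock_gain] at h3
    by_cases h0 : (letterBlock N x).gain a t = 0
    · rw [h0, mul_zero, zero_add] at h3
      clear h0
      induction r generalizing a t m with
      | zero =>
        have := h2.mono_left h1
        rw [List.replicate_zero, List.nil_append]
        cases R with
        | nil => exact ⟨this.1, by have := this.2; omega⟩
        | cons B R =>
          obtain ⟨t', m'', l1, l2, l3⟩ := this
          exact ⟨t', m'', l1, l2, by omega⟩
      | succ r ih =>
        exact ⟨t, m, h1, ih t m t le_rfl h2 h3, by omega⟩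
    · obtain ⟨v, k1, k2, k3⟩ := letterBlock_gain_split h0
      have h4 : (letterBlock N x).gain a t ≤ 1 := letterBlock_gain_le _ _ _ _
      have h5 : m ≤ r + m' := by
        have := Nat.mul_le_mul_left r h4
        omega
      clear h3 h4 h0
      induction r generalizing a m with
      | zero =>
        have := h2.mono_left h1
        rw [List.replicate_zero, List.nil_append]
        cases R with
        | nil => exact ⟨this.1, by have := this.2; omega⟩
        | cons B R =>
          obtain ⟨t', m'', l1, l2, l3⟩ := this
          exact ⟨t', m'', l1, l2, by omega⟩
      | succ r ih =>
        refine ⟨v, m - 1, k1, ih v (m - 1) (by omega) le_rfl (by omega), ?_⟩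
        rw [letterBlock_gain_eq k1 le_rfl k3]
        omega

/-- A chain in a word with `j` cuts is a path in the affine alphabet: at every cut it passes to the
next period, so that it ends at the last letter of period `j`. -/
theorem SegChain.pathGain {N : ℕ} {u : List ℕ} {v j m : ℕ} (h : SegChain u v j m)
    (hu : ∀ x ∈ u, x < N) (hv : v < N) :
    PathGain (u.map (letterBlock N)) v ((j : ℤ) * N + (N - 1)) m := by
  have shift : ∀ (u : List ℕ) (a b : ℤ) (m : ℕ), PathGain (u.map (letterBlock N)) a b m →
      PathGain (u.map (letterBlock N)) (a + N) (b + N) m := by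
    intro u
    induction u with
    | nil => intro a b m h; exact ⟨by have := h.1; omega, h.2⟩
    | cons x u ih =>
      rintro a b m ⟨t, m', h1, h2, h3⟩
      refine ⟨t + N, m', by omega, ih _ _ _ h2, ?_⟩
      have : (letterBlock N x).gain a t ≤ (letterBlock N x).gain (a + N) (t + N) := by
        by_cases h0 : (letterBlock N x).gain a t = 0
        · omega
        · obtain ⟨v, k1, k2, k3⟩ := letterBlock_gain_split h0
          rw [letterBlock_gain_eq (a := a + N) (v := v + N) (by omega) (by omega)]
          · exact letterBlock_gain_le _ _ _ _
          · rw [show v + (N : ℤ) - x = (v - x) + N by ring]; exact dvd_add k3 dvd_rfl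
      omega
  induction h with
  | nil v j =>
    refine ⟨?_, rfl⟩
    have : (0 : ℤ) ≤ j * N := by positivity
    omega
  | @skip x u v j m h ih =>
    exact ⟨v, m, le_rfl, ih (fun x hx => hu x (by simp [hx])) hv, by omega⟩
  | @pick x u v j m hx h ih =>
    have hxN := hu x (by simp)
    refine ⟨x, m, by omega, ih (fun x hx => hu x (by simp [hx])) hxN, ?_⟩
    rw [letterBlock_gain_eq (v := (x : ℤ)) (by omega) le_rfl (by simp)]
    omega
  | @cut u v j m h ih =>
    have := shift _ _ _ _ (ih hu (by omega))
    have e : ((j : ℤ) * N + (N - 1)) + N = ((j + 1 : ℕ) : ℤ) * N + (N - 1) := by push_cast; ring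
    rw [e] at this
    exact this.mono_left (by omega)

/-- The start of a path, in terms of its remainder (the floor of a chain) and its quotient (the
number of cuts already made), can be moved to the left. -/
theorem SegChain.raise {N : ℕ} (hN : 0 < N) {u : List ℕ} {J m : ℕ} {a t : ℤ} (ha : 0 ≤ a)
    (hat : a ≤ t) (ht : t / N ≤ J)
    (h : SegChain u (t % N).toNat (J - (t / N).toNat) m) :
    SegChain u (a % N).toNat (J - (a / N).toNat) m := by
  have hN' : (0 : ℤ) < N := by exact_mod_cast hN
  have h1 : a / N ≤ t / N := Int.ediv_le_ediv hN' hat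
  have h2 : 0 ≤ a / N := Int.ediv_nonneg ha hN'.le
  rcases h1.eq_or_lt with h3 | h3
  · rw [h3]
    refine h.mono_floor ?_
    have e1 := Int.emod_add_mul_ediv a N
    have e2 := Int.emod_add_mul_ediv t N
    rw [h3] at e1
    omega
  · have : ∃ d, J - (a / N).toNat = (J - (t / N).toNat) + (d + 1) :=
      ⟨(t / N).toNat - (a / N).toNat - 1, by omega⟩
    obtain ⟨d, hd⟩ := this
    rw [hd]
    have : ∀ d v, SegChain u v ((J - (t / N).toNat) + (d + 1)) m := by
      intro d
      induction d with
      | zero => exact fun v => h.add_cut v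
      | succ d ih => exact fun v => (ih 0).add_cut v
    exact this d _

/-- Conversely, a path in the affine alphabet is a chain, which is cut whenever the path passes to
the next period. -/
theorem SegChain.of_pathGain {N : ℕ} (hN : 0 < N) {u : List ℕ} (hu : ∀ x ∈ u, x < N) {J : ℕ} :
    ∀ {a : ℤ} {m : ℕ}, 0 ≤ a → PathGain (u.map (letterBlock N)) a ((J : ℤ) * N + (N - 1)) m →
      SegChain u (a % N).toNat (J - (a / N).toNat) m := by
  have hN' : (0 : ℤ) < N := by exact_mod_cast hN
  have top : ∀ t : ℤ, t ≤ (J : ℤ) * N + (N - 1) → t / N ≤ J := by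
    intro t ht
    have : t / N < J + 1 := Int.ediv_lt_of_lt_mul hN' (by linarith)
    omega
  induction u with
  | nil =>
    rintro a m ha ⟨-, rfl⟩
    exact nil _ _
  | cons x u ih =>
    rintro a m ha ⟨t, m', h1, h2, h3⟩
    have ih' := ih (fun x hx => hu x (by simp [hx])) (ha.trans h1) h2
    have ht := top t h2.le
    by_cases h0 : (letterBlock N x).gain a t = 0
    · have : SegChain u (a % N).toNat (J - (a / N).toNat) m' := raise hN ha h1 ht ih'
      rw [h0, zero_add] at h3
      exact this.skip.mono_count h3
    · obtain ⟨X, k1, k2, k3⟩ := letterBlock_gain_split h0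
      have hxN := hu x (by simp)
      have hX : X % N = x := by
        rw [Int.emod_eq_emod_iff_emod_sub_eq_zero.2 (Int.emod_eq_zero_of_dvd k3),
          Int.emod_eq_of_lt (by omega) (by exact_mod_cast hxN)]
      have h4 := raise hN (ha.trans k1) k2 ht ih'
      rw [hX, Int.toNat_natCast] at h4
      have h5 : SegChain (x :: u) (X % N).toNat (J - (X / N).toNat) (m' + 1) := by
        rw [hX, Int.toNat_natCast]
        exact h4.pick le_rfl
      have h6 := letterBlock_gain_le N x a t
      exact (raise hN ha k1 ((Int.ediv_le_ediv hN' k2).trans ht) h5).mono_count (by omega)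

/-! ### One move of the box-ball system -/

theorem moveBall_self (s : State n) (i : Fin n) :
    IsLeast {p | s i < p ∧ ∀ j, s j ≠ p} (moveBall s i i) := by
  rw [moveBall, Function.update_self]
  exact ⟨Nat.find_spec (exists_empty_right s i), fun p hp => Nat.find_min' _ hp⟩

theorem moveBall_of_ne (s : State n) {i j : Fin n} (h : j ≠ i) : moveBall s i j = s j := by
  rw [moveBall, Function.update_of_ne h]

theorem foldl_moveBall (s : State n) (l : List (Fin n)) (hl : l.Pairwise (· < ·)) :
    (∀ b, b ∉ l → l.foldl moveBall s b = s b) ∧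
    ∀ b ∈ l, IsLeast {p | s b < p ∧ (∀ j < b, l.foldl moveBall s j ≠ p) ∧ ∀ j > b, s j ≠ p}
      (l.foldl moveBall s b) := by
  induction l using List.reverseRecOn with
  | nil => simp
  | append_singleton l a ih =>
    rw [List.pairwise_append] at hl
    obtain ⟨ih1, ih2⟩ := ih hl.1
    have hla : ∀ b ∈ l, b < a := fun b hb => hl.2.2 b hb a (by simp)
    have hal : ∀ b, a ≤ b → b ∉ l := fun b hb h => (hla b h).not_ge hb
    simp only [List.foldl_append, List.foldl_cons, List.foldl_nil]
    refine ⟨fun b hb => ?_, fun b hb => ?_⟩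
    · simp only [List.mem_append, List.mem_singleton, not_or] at hb
      rw [moveBall_of_ne _ hb.2, ih1 b hb.1]
    · rw [List.mem_append, List.mem_singleton] at hb
      rcases hb with hb | rfl
      · have e : ∀ j, j ≤ b → moveBall (l.foldl moveBall s) a j = l.foldl moveBall s j :=
          fun j hj => moveBall_of_ne _ (hj.trans_lt (hla b hb)).ne
        rw [e b le_rfl]
        convert ih2 b hb using 5 with p
        refine forall₂_congr fun j hj => ?_
        rw [e j hj.le]
      · convert moveBall_self (l.foldl moveBall s) b using 2
        ext p
        rw [ih1 b (hal b le_rfl)]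
        constructor
        · rintro ⟨h1, h2, h3⟩
          refine ⟨h1, fun j => ?_⟩
          rcases lt_trichotomy j b with h | rfl | h
          · rw [← moveBall_of_ne (l.foldl moveBall s) h.ne]
            exact h2 j h
          · rw [ih1 j (hal j le_rfl)]; exact h1.ne
          · rw [ih1 j (hal j h.le)]; exact h3 j h
        · rintro ⟨h1, h2⟩
          refine ⟨h1, fun j hj => ?_, fun j hj => ?_⟩
          · rw [moveBall_of_ne _ hj.ne]; exact h2 j
          · rw [← ih1 j (hal j (le_of_lt hj))]; exact h2 j

/-- The new box of the ball `b` is the first one to the right which is neither the new box of a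
smaller ball nor the old box of a larger ball. -/
theorem bbsMove_isLeast (s : State n) (b : Fin n) :
    IsLeast {p | s b < p ∧ (∀ j < b, bbsMove s j ≠ p) ∧ ∀ j > b, s j ≠ p} (bbsMove s b) :=
  (foldl_moveBall s (List.finRange n) (List.sortedLT_finRange n).pairwise).2 b (List.mem_finRange b)

theorem lt_bbsMove (s : State n) (b : Fin n) : s b < bbsMove s b := (bbsMove_isLeast s b).1.1

theorem bbsMove_injective (s : State n) : Function.Injective (bbsMove s) := by
  intro a b h
  rcases lt_trichotomy a b with hab | hab | hab
  · exact absurd h ((bbsMove_isLeast s b).1.2.1 a hab)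
  · exact hab
  · exact absurd h.symm ((bbsMove_isLeast s a).1.2.1 b hab)

/-- A ball lands either in an empty box or in the old box of a smaller ball. -/
theorem lt_of_bbsMove_eq (s : State n) {x b : Fin n} (h : bbsMove s b = s x) : x < b := by
  rcases lt_trichotomy x b with hab | rfl | hab
  · exact hab
  · exact absurd h (lt_bbsMove s x).ne'
  · exact absurd h.symm ((bbsMove_isLeast s b).1.2.2 x hab)

/-- A box passed by the ball `b` is the new box of a smaller ball or the old box of a larger
ball. -/
theorem exists_of_lt_bbsMove (s : State n) {b : Fin n} {p : ℕ} (h1 : s b < p)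
    (h2 : p < bbsMove s b) : (∃ j < b, bbsMove s j = p) ∨ ∃ j > b, s j = p := by
  by_contra! hc
  exact h2.not_ge ((bbsMove_isLeast s b).2 ⟨h1, hc.1, hc.2⟩)

/-- The ball in box `p`, if any. -/
def ballAt (s : State n) (p : ℕ) : Option (Fin n) := (List.finRange n).find? (fun b => s b = p)

theorem ballAt_eq_some {s : State n} (hs : Function.Injective s) {p : ℕ} {b : Fin n} :
    ballAt s p = some b ↔ s b = p := by
  constructor
  · intro h
    simpa using List.find?_some h
  · intro h
    cases h' : ballAt s p with
    | none => simpa [h] using List.find?_eq_none.1 h' b (List.mem_finRange b)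
    | some c =>
      have : s c = p := by simpa using List.find?_some h'
      rw [hs (this.trans h.symm)]

theorem ballAt_eq_none {s : State n} {p : ℕ} : ballAt s p = none ↔ ∀ b, s b ≠ p := by
  simp [ballAt]

/-- The letter in box `p`: the ball in the box, or `n` for an empty box. -/
def letter (s : State n) (p : ℕ) : ℕ := (ballAt s p).elim n Fin.val

theorem letter_apply {s : State n} (hs : Function.Injective s) (b : Fin n) :
    letter s (s b) = b := by
  rw [letter, (ballAt_eq_some hs).2 rfl]; rfl

theorem letter_eq_iff {s : State n} (hs : Function.Injective s) {p : ℕ} {b : Fin n} :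
    letter s p = b ↔ s b = p := by
  constructor
  · intro h
    cases h' : ballAt s p with
    | none => rw [letter, h'] at h; exact absurd h b.2.ne'
    | some c =>
      rw [letter, h'] at h
      rw [← (ballAt_eq_some hs).1 h', Fin.ext h]
  · rintro rfl; exact letter_apply hs b

theorem letter_le (s : State n) (p : ℕ) : letter s p ≤ n := by
  unfold letter
  cases ballAt s p with
  | none => exact le_rfl
  | some b => exact b.2.le

theorem exists_of_letter_lt {s : State n} (hs : Function.Injective s) {p : ℕ}
    (h : letter s p < n) : ∃ b : Fin n, s b = p ∧ letter s p = b :=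
  ⟨⟨letter s p, h⟩, (letter_eq_iff hs).1 rfl, rfl⟩

theorem letter_eq_top {s : State n} {p : ℕ} (h : ∀ b, s b ≠ p) : letter s p = n := by
  rw [letter, ballAt_eq_none.2 h]; rfl

/-- The carrier before reading box `p`: the balls which have been picked up in a box on the left
of `p` and have not yet been dropped. -/
def carrier (s : State n) (p : ℕ) : Finset (Fin n) :=
  Finset.univ.filter (fun b => s b < p ∧ p ≤ bbsMove s b)

theorem mem_carrier {s : State n} {p : ℕ} {b : Fin n} :
    b ∈ carrier s p ↔ s b < p ∧ p ≤ bbsMove s b := by simp [carrier]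

theorem mem_carrier_succ {s : State n} {p : ℕ} {b : Fin n} :
    b ∈ carrier s (p + 1) ↔ (b ∈ carrier s p ∧ bbsMove s b ≠ p) ∨ s b = p := by
  have := lt_bbsMove s b
  simp only [mem_carrier]
  omega

/-- The ball dropped into box `p` is the smallest ball of the carrier which exceeds the ball in
the box. -/
theorem letter_bbsMove_le {s : State n} (hs : Function.Injective s) {p : ℕ} {c : Fin n}
    (hc : c ∈ carrier s p) (h : letter s p < c ∨ letter s p = n) :
    letter (bbsMove s) p ≤ c := by
  have hq := bbsMove_injective s
  rw [mem_carrier] at hc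
  have h' : ¬ ∃ j > c, s j = p := by
    rintro ⟨j, hj, hjp⟩
    rw [← letter_eq_iff hs] at hjp
    rw [hjp] at h
    have := j.2
    have : (c : ℕ) < j := hj
    omega
  rcases hc.2.eq_or_lt with h1 | h1
  · rw [h1, letter_apply hq]
  · obtain ⟨j, hj, rfl⟩ := (exists_of_lt_bbsMove s hc.1 h1).resolve_right h'
    rw [letter_apply hq]
    exact Fin.le_def.1 hj.le

theorem letter_lt_letter_bbsMove {s : State n} (hs : Function.Injective s) {p : ℕ}
    (h : letter s p < n) : letter s p < letter (bbsMove s) p := by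
  have hq := bbsMove_injective s
  rcases (letter_le (bbsMove s) p).eq_or_lt with h1 | h1
  · omega
  · obtain ⟨x, hx, hx'⟩ := exists_of_letter_lt hs h
    obtain ⟨y, hy, hy'⟩ := exists_of_letter_lt hq h1
    rw [hx', hy']
    exact lt_of_bbsMove_eq s (hy.trans hx.symm)

theorem mem_carrier_of_bbsMove_eq {s : State n} {p : ℕ} {y : Fin n} (h : bbsMove s y = p) :
    y ∈ carrier s p := by
  have := lt_bbsMove s y
  rw [mem_carrier]; omega

/-! ### The move as an exchange of blocks -/

/-- The multiplicity of the letter `r` in the carrier `C`, which is filled up to `n + 1` letters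
with empty boxes. -/
def carrierMult (C : Finset (Fin n)) (r : ℕ) : ℕ :=
  if h : r < n then (if (⟨r, h⟩ : Fin n) ∈ C then 1 else 0) else n + 1 - C.card

/-- The carrier as a block of `n + 1` letters. -/
noncomputable def carrierBlock (C : Finset (Fin n)) : Block :=
  ⟨n + 1, fun v => carrierMult C (v % (n + 1 : ℤ)).toNat⟩

theorem sum_carrierMult (C : Finset (Fin n)) :
    ∑ r ∈ Finset.range n, carrierMult C r = C.card := by
  rw [Finset.sum_range]
  simp [carrierMult]

theorem cnt_period (f : ℕ → ℕ) (z : ℤ) :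
    cnt (fun v => f (v % (n + 1 : ℤ)).toNat) (z + 1) (z + (n + 1 : ℤ)) =
      ∑ r ∈ Finset.range (n + 1), f r := by
  have hN : (0 : ℤ) < n + 1 := by positivity
  unfold cnt
  refine Finset.sum_nbij' (fun v => (v % (n + 1 : ℤ)).toNat)
    (fun r => z + 1 + ((r : ℤ) - (z + 1)) % (n + 1 : ℤ)) ?_ ?_ ?_ ?_ ?_
  · intro v _
    have := Int.emod_nonneg v hN.ne'
    have := Int.emod_lt_of_pos v hN
    simp only [Finset.mem_range]
    omega
  · intro r _
    have := Int.emod_nonneg ((r : ℤ) - (z + 1)) hN.ne'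
    have := Int.emod_lt_of_pos ((r : ℤ) - (z + 1)) hN
    simp only [Finset.mem_Icc]
    omega
  · intro v hv
    simp only [Finset.mem_Icc] at hv
    rw [Int.toNat_of_nonneg (Int.emod_nonneg v hN.ne'), Int.emod_sub_emod,
      Int.emod_eq_of_lt (by omega) (by omega)]
    omega
  · intro r hr
    simp only [Finset.mem_range] at hr
    rw [Int.add_emod_emod]
    rw [add_sub_cancel, Int.emod_eq_of_lt (by omega) (by omega)]
    simp
  · intro v _; rfl

theorem emod_eq_emod_iff_dvd_sub {a b N : ℤ} : a % N = b % N ↔ N ∣ a - b := by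
  rw [Int.emod_eq_emod_iff_emod_sub_eq_zero, Int.dvd_iff_emod_eq_zero]

theorem lifts_eq {x : ℕ} (hx : x < n + 1) (v : ℤ) :
    lifts (n + 1 : ℤ) x v = if (v % (n + 1 : ℤ)).toNat = x then 1 else 0 := by
  have hN : (0 : ℤ) < n + 1 := by positivity
  have h0 := Int.emod_nonneg v hN.ne'
  have : ((n + 1 : ℤ) ∣ v - x) ↔ (v % (n + 1 : ℤ)).toNat = x := by
    rw [← emod_eq_emod_iff_dvd_sub, Int.emod_eq_of_lt (a := (x : ℤ)) (by omega) (by omega)]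
    omega
  simp only [lifts, this]

theorem lifts_add (N x v : ℤ) : lifts N (x + N) v = lifts N x v := by
  have : N ∣ v - (x + N) ↔ N ∣ v - x := by
    rw [← sub_sub, dvd_sub_self_right]
  simp only [lifts, this]

/-- Reading box `p`, the carrier takes up the old letter of the box and drops the new one. Owing to
the empty boxes in the carrier this also holds if one of these letters is `n`. -/
theorem carrierMult_succ {s : State n} (hs : Function.Injective s) (p : ℕ) {r : ℕ}
    (hr : r < n + 1) : carrierMult (carrier s (p + 1)) r +
        (if r = letter (bbsMove s) p then 1 else 0) =
      carrierMult (carrier s p) r + (if r = letter s p then 1 else 0) := by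
  have hq := bbsMove_injective s
  have key : ∀ r < n, carrierMult (carrier s (p + 1)) r +
        (if r = letter (bbsMove s) p then 1 else 0) =
      carrierMult (carrier s p) r + (if r = letter s p then 1 else 0) := by
    intro r hr
    have e1 : r = letter (bbsMove s) p ↔ bbsMove s ⟨r, hr⟩ = p := by
      rw [← letter_eq_iff hq, eq_comm]
    have e2 : r = letter s p ↔ s ⟨r, hr⟩ = p := by rw [← letter_eq_iff hs, eq_comm]
    have h := lt_bbsMove s ⟨r, hr⟩
    simp only [carrierMult, dif_pos hr, e1, e2, mem_carrier]
    split_ifs <;> omega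
  rcases Nat.lt_succ_iff_lt_or_eq.1 hr with h | rfl
  · exact key r h
  · have h1 := Finset.sum_congr rfl (fun i hi => key i (Finset.mem_range.1 hi))
    rw [Finset.sum_add_distrib, Finset.sum_add_distrib, sum_carrierMult, sum_carrierMult,
      Finset.sum_ite_eq' (Finset.range r), Finset.sum_ite_eq' (Finset.range r)] at h1
    have h2 := letter_le s p
    have h3 := letter_le (bbsMove s) p
    have h4 : (carrier s p).card ≤ r := by simpa using Finset.card_le_univ (carrier s p)
    have h5 : (carrier s (p + 1)).card ≤ r := by
      simpa using Finset.card_le_univ (carrier s (p + 1))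
    simp only [Finset.mem_range, carrierMult, lt_irrefl, dif_neg, not_false_iff] at h1 ⊢
    split_ifs at h1 ⊢ <;> omega

/-- Reading a box is an exchange of blocks. The dropped letter is the cyclically next letter of the
carrier after the letter in the box, so its lift is raised by one period unless it is larger. -/
theorem isExchange_carrier {s : State n} (hs : Function.Injective s) (p : ℕ) :
    IsExchange (n + 1 : ℤ) (letter s p)
      (if letter s p < letter (bbsMove s) p then (letter (bbsMove s) p : ℤ)
        else letter (bbsMove s) p + (n + 1 : ℤ)) (n + 1)
      (carrierBlock (carrier s p)).wt (carrierBlock (carrier s (p + 1))).wt := by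
  have hq := bbsMove_injective s
  have hx := letter_le s p
  have hy := letter_le (bbsMove s) p
  have hlt := letter_lt_letter_bbsMove hs (p := p)
  have hN : (0 : ℤ) < n + 1 := by positivity
  set x := letter s p with hxdef
  set y := letter (bbsMove s) p with hydef
  have hcard : ∀ p, (carrier s p).card ≤ n := fun p => by
    simpa using Finset.card_le_univ (carrier s p)
  have hmem : 1 ≤ carrierMult (carrier s p) y := by
    rcases hy.eq_or_lt with h | h
    · have := hcard p
      rw [h, carrierMult, dif_neg (lt_irrefl n)]
      omega
    · rw [carrierMult, dif_pos h, if_pos]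
      exact mem_carrier_of_bbsMove_eq ((letter_eq_iff hq (b := ⟨y, h⟩)).1 rfl)
  have hgap : ∀ r : ℕ, r < y → (x < r ∨ x = n) → carrierMult (carrier s p) r = 0 := by
    intro r hr h
    rw [carrierMult, dif_pos (by omega), if_neg]
    intro hc
    have := letter_bbsMove_le hs hc h
    simp only at this
    omega
  have htot : ∀ p z, cnt (carrierBlock (carrier s p)).wt (z + 1) (z + (n + 1 : ℤ)) = n + 1 := by
    intro p z
    have := hcard p
    rw [carrierBlock, cnt_period, Finset.sum_range_succ, sum_carrierMult, carrierMult,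
      dif_neg (lt_irrefl n)]
    omega
  have hrel : ∀ v, (carrierBlock (carrier s (p + 1))).wt v + lifts (n + 1 : ℤ) y v =
      (carrierBlock (carrier s p)).wt v + lifts (n + 1 : ℤ) x v := by
    intro v
    have h0 := Int.emod_nonneg v hN.ne'
    have h1 := Int.emod_lt_of_pos v hN
    rw [lifts_eq (by omega), lifts_eq (by omega)]
    exact carrierMult_succ hs p (by omega)
  have hper : ∀ p (v u : ℤ), (n + 1 : ℤ) ∣ v - u →
      (carrierBlock (carrier s p)).wt v = (carrierBlock (carrier s p)).wt u := by
    intro p v u h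
    simp only [carrierBlock]
    rw [emod_eq_emod_iff_dvd_sub.2 h]
  have hval : ∀ r : ℕ, r < n + 1 → (carrierBlock (carrier s p)).wt r =
      carrierMult (carrier s p) r := by
    intro r hr
    simp only [carrierBlock]
    rw [Int.emod_eq_of_lt (by omega) (by omega), Int.toNat_natCast]
  split_ifs with h
  · refine ⟨hN, by omega, by omega, hper p, hper _, ?_, ?_, htot p, htot _, hrel⟩
    · intro v h1 h2
      lift v to ℕ using by omega
      rw [hval v (by omega)]
      exact hgap v (by omega) (by omega)
    · rw [hval y (by omega)]; exact hmem
  · have hxn : x = n := by omega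
    refine ⟨hN, by omega, by omega, hper p, hper _, ?_, ?_, htot p, htot _, ?_⟩
    · intro v h1 h2
      rw [hper p v (v - (n + 1)) (by simp)]
      obtain ⟨r, hr⟩ : ∃ r : ℕ, v - (n + 1 : ℤ) = r := ⟨(v - (n + 1)).toNat, by omega⟩
      rw [hr, hval r (by omega)]
      exact hgap r (by omega) (Or.inr hxn)
    · rw [hper p _ y (by simp), hval y (by omega)]; exact hmem
    · intro v; rw [lifts_add]; exact hrel v

/-- The letters in the boxes `a, …, b - 1`. -/
def letters (s : State n) (a b : ℕ) : List ℕ := (List.range' a (b - a)).map (letter s)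

theorem letters_cons (s : State n) {a b : ℕ} (h : a < b) :
    letters s a b = letter s a :: letters s (a + 1) b := by
  have : b - a = (b - (a + 1)) + 1 := by omega
  rw [letters, this, List.range'_succ, List.map_cons, letters]

theorem letters_append (s : State n) {a b c : ℕ} (h1 : a ≤ b) (h2 : b ≤ c) :
    letters s a b ++ letters s b c = letters s a c := by
  have e : c - a = (b - a) + (c - b) := by omega
  rw [letters, letters, letters, ← List.map_append, e, ← List.range'_append]
  congr 3
  omega

theorem letters_self (s : State n) (a : ℕ) : letters s a a = [] := by simp [letters]

theorem letters_succ (s : State n) {a b : ℕ} (h : a ≤ b) :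
    letters s a (b + 1) = letters s a b ++ [letter s b] := by
  rw [← letters_append s h (Nat.le_succ b), letters_cons s (Nat.lt_succ_self b), letters_self]

theorem letters_eq_replicate {s : State n} {a b : ℕ} (h : ∀ c, s c < a) :
    letters s a b = List.replicate (b - a) n := by
  rw [List.eq_replicate_iff]
  refine ⟨by simp [letters], ?_⟩
  intro x hx
  obtain ⟨p, hp, rfl⟩ := List.mem_map.1 hx
  rw [List.mem_range'_1] at hp
  exact letter_eq_top fun c => by have := h c; omega

theorem letters_length (s : State n) (a b : ℕ) : (letters s a b).length = b - a := by
  simp [letters]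

theorem carrierBlock_empty :
    carrierBlock (∅ : Finset (Fin n)) = repBlock (n + 1 : ℤ) (n + 1) n := by
  unfold carrierBlock repBlock
  congr 1
  funext v
  have hN : (0 : ℤ) < n + 1 := by positivity
  have h0 := Int.emod_nonneg v hN.ne'
  have h1 := Int.emod_lt_of_pos v hN
  rw [lifts_eq (Nat.lt_succ_self n)]
  unfold carrierMult
  split_ifs with h2 h3 <;> simp at * <;> omega

/-- Reading the boxes `0, …, p - 1`, the carrier passes through the word and turns the letters of
`s` into those of `bbsMove s`. -/
theorem pathGain_carrier {s : State n} (hs : Function.Injective s) (L : List Block) {M : ℕ}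
    {a b : ℤ} {m : ℕ} {p : ℕ} (hp : p ≤ M) :
    PathGain (L ++ carrierBlock (carrier s 0) ::
        (letters s 0 M).map (letterBlock (n + 1 : ℤ))) a b m ↔
    PathGain ((L ++ (letters (bbsMove s) 0 p).map (letterBlock (n + 1 : ℤ))) ++
        carrierBlock (carrier s p) :: (letters s p M).map (letterBlock (n + 1 : ℤ))) a b m := by
  induction p with
  | zero => simp [letters_self]
  | succ p ih =>
    rw [ih (by omega), letters_cons s (by omega), letters_succ _ (Nat.zero_le p), List.map_append,
      ← List.append_assoc]
    have hE := isExchange_carrier hs p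
    have hy : ∀ a b : ℤ, (letterBlock (n + 1 : ℤ) (letter (bbsMove s) p)).gain a b =
        min 1 (cnt (lifts (n + 1 : ℤ) (if letter s p < letter (bbsMove s) p then
          (letter (bbsMove s) p : ℤ) else letter (bbsMove s) p + (n + 1 : ℤ))) a b) := by
      intro a b
      have : lifts (n + 1 : ℤ) (if letter s p < letter (bbsMove s) p then
          (letter (bbsMove s) p : ℤ) else letter (bbsMove s) p + (n + 1 : ℤ)) =
          lifts (n + 1 : ℤ) (letter (bbsMove s) p) := by
        split_ifs
        · rfl
        · funext v; exact lifts_add _ _ _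
      rw [this]; rfl
    set L' := L ++ List.map (letterBlock (n + 1 : ℤ)) (letters (bbsMove s) 0 p)
    simp only [List.map_cons, List.append_assoc, List.map_nil, List.cons_append, List.nil_append]
    constructor
    · refine PathGain.exchange (fun a t b h1 h2 => ?_) L' _
      obtain ⟨t', k1, k2, k3⟩ := hE.exchange h1 h2
      refine ⟨t', k1, k2, ?_⟩
      rw [hy]
      exact k3
    · refine PathGain.exchange (fun a t b h1 h2 => ?_) L' _
      obtain ⟨t', k1, k2, k3⟩ := hE.exchange' h1 h2
      refine ⟨t', k1, k2, ?_⟩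
      rw [hy]
      exact k3

theorem lt_succ_of_mem_letters {s : State n} {a b x : ℕ} (h : x ∈ letters s a b) : x < n + 1 := by
  obtain ⟨p, -, rfl⟩ := List.mem_map.1 h
  exact Nat.lt_succ_of_le (letter_le s p)

theorem segChain_iff_pathGain {u : List ℕ} (hu : ∀ x ∈ u, x < n + 1) {j m : ℕ} :
    SegChain u 0 j m ↔
      PathGain (u.map (letterBlock (n + 1 : ℤ))) 0 ((j : ℤ) * (n + 1 : ℤ) + n) m := by
  have e : ((j : ℤ) * (n + 1 : ℤ) + n) = (j : ℤ) * ((n + 1 : ℕ) : ℤ) + (((n + 1 : ℕ) : ℤ) - 1) := by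
    push_cast; ring
  have e2 : (n + 1 : ℤ) = ((n + 1 : ℕ) : ℤ) := by push_cast; ring
  rw [e, e2]
  constructor
  · intro h
    exact h.pathGain hu (Nat.succ_pos n)
  · intro h
    simpa using SegChain.of_pathGain (Nat.succ_pos n) hu le_rfl h

/-- The chains in cut words are invariant under a move: passing the carrier from the left to the
right through the word exchanges blocks, and the carrier is empty at both ends. -/
theorem segChain_bbsMove {s : State n} (hs : Function.Injective s) {M : ℕ}
    (hM : ∀ b, bbsMove s b < M) (A j m : ℕ) :
    SegChain (List.replicate (A + (n + 1)) n ++ letters s 0 M) 0 j m ↔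
      SegChain (List.replicate A n ++ letters (bbsMove s) 0 (M + (n + 1))) 0 j m := by
  have h0 : carrier s 0 = ∅ := Finset.eq_empty_of_forall_notMem fun b hb => by
    rw [mem_carrier] at hb; omega
  have hM' : carrier s M = ∅ := Finset.eq_empty_of_forall_notMem fun b hb => by
    have := hM b
    rw [mem_carrier] at hb; omega
  rw [segChain_iff_pathGain, segChain_iff_pathGain]
  · have e1 : letters (bbsMove s) 0 (M + (n + 1)) =
        letters (bbsMove s) 0 M ++ List.replicate (n + 1) n := by
      rw [← letters_append _ (Nat.zero_le M) (Nat.le_add_right M (n + 1)),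
        letters_eq_replicate (a := M) hM, Nat.add_sub_cancel_left]
    have key := pathGain_carrier hs (List.replicate A (letterBlock (n + 1 : ℤ) n)) (M := M)
      (a := 0) (b := (j : ℤ) * (n + 1 : ℤ) + n) (m := m) le_rfl
    rw [h0, hM', letters_self, carrierBlock_empty] at key
    rw [e1, ← List.replicate_append_replicate]
    simp only [List.map_append, List.map_replicate, List.append_assoc]
    constructor
    · intro h
      have := key.1 (PathGain.congr_append (fun a b m => (pathGain_rep _ _ _ _ a b m).1) _ h)
      rw [← List.append_assoc]
      refine PathGain.congr_append (fun a b m h => ?_) _ this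
      simpa using (pathGain_rep _ _ _ _ a b m).2 h
    · intro h
      refine PathGain.congr_append (fun a b m => (pathGain_rep _ _ _ _ a b m).2) _ (key.2 ?_)
      rw [← List.append_assoc] at h
      refine PathGain.congr_append (fun a b m h => ?_) _ h
      rw [← List.append_nil (List.replicate _ _)] at h
      exact (pathGain_rep _ _ _ _ a b m).1 h
  all_goals
    intro x hx
    rcases List.mem_append.1 hx with hx | hx
    · rw [List.eq_of_mem_replicate hx]; exact Nat.lt_succ_self n
    · exact lt_succ_of_mem_letters hx

/-! ### The dynamics of the increasing runs -/

/-- The letter in the box to the left of `p`; the box to the left of box `0` counts as empty. -/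
def prevLetter (s : State n) : ℕ → ℕ
  | 0 => n
  | p + 1 => letter s p

/-- An increasing run starts in box `p`. -/
def IsStart (s : State n) (p : ℕ) : Prop := letter s p < prevLetter s p

/-- An increasing run ends in the box to the left of `p`. -/
def IsEnd (s : State n) (p : ℕ) : Prop :=
  prevLetter s p < n ∧ ¬ (prevLetter s p < letter s p ∧ letter s p < n)

instance (s : State n) (p : ℕ) : Decidable (IsStart s p) := by unfold IsStart; infer_instance

instance (s : State n) (p : ℕ) : Decidable (IsEnd s p) := by unfold IsEnd; infer_instance

/-- After a move, the runs start exactly where the runs ended before the move. -/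
theorem isStart_bbsMove {s : State n} (hs : Function.Injective s) (p : ℕ) :
    IsStart (bbsMove s) p ↔ IsEnd s p := by
  have hq := bbsMove_injective s
  cases p with
  | zero =>
    have : letter (bbsMove s) 0 = n := letter_eq_top fun b => by
      have := lt_bbsMove s b; omega
    simp [IsStart, IsEnd, prevLetter, this]
  | succ p =>
    simp only [IsStart, IsEnd, prevLetter]
    constructor
    · intro h
      have hy := letter_le (bbsMove s) p
      obtain ⟨c, hc, hc'⟩ := exists_of_letter_lt hq (lt_of_lt_of_le h hy)
      have hmem := mem_carrier_of_bbsMove_eq hc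
      rw [hc'] at h
      have hx : letter s p < n := by
        by_contra hx
        have hx : letter s p = n := le_antisymm (letter_le s p) (not_lt.1 hx)
        rcases mem_carrier_succ.1 hmem with h1 | h1
        · exact h.not_ge (letter_bbsMove_le hs h1.1 (Or.inr hx))
        · rw [(letter_eq_iff hs).2 h1] at hx
          exact c.2.ne hx
      refine ⟨hx, fun ⟨h2, h3⟩ => ?_⟩
      have h4 := letter_lt_letter_bbsMove hs h3
      rcases mem_carrier_succ.1 hmem with h1 | h1
      · exact h.not_ge (letter_bbsMove_le hs h1.1 (Or.inl (by omega)))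
      · rw [(letter_eq_iff hs).2 h1] at h2
        omega
    · rintro ⟨h1, h2⟩
      obtain ⟨b, hb, hb'⟩ := exists_of_letter_lt hs h1
      have hmem : b ∈ carrier s (p + 1) := mem_carrier_succ.2 (Or.inr hb)
      have h3 := letter_lt_letter_bbsMove hs h1
      refine lt_of_le_of_lt (letter_bbsMove_le hs hmem ?_) (hb' ▸ h3)
      have h4 := letter_le s (p + 1)
      have h5 : letter s (p + 1) ≠ b := fun h => by
        rw [letter_eq_iff hs] at h
        omega
      omega

/-- The number of runs which start in one of the boxes `0, …, x`. -/
def numStarts (s : State n) (x : ℕ) : ℕ := ((Finset.range (x + 1)).filter (IsStart s)).card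

/-- The number of runs which end before one of the boxes `0, …, x`. -/
def numEnds (s : State n) (x : ℕ) : ℕ := ((Finset.range (x + 1)).filter (IsEnd s)).card

theorem numStarts_succ (s : State n) (x : ℕ) :
    numStarts s (x + 1) = numStarts s x + if IsStart s (x + 1) then 1 else 0 := by
  rw [numStarts, Finset.range_add_one, Finset.filter_insert]
  split_ifs with h
  · rw [Finset.card_insert_of_notMem (by simp)]; rfl
  · rfl

theorem numEnds_succ (s : State n) (x : ℕ) :
    numEnds s (x + 1) = numEnds s x + if IsEnd s (x + 1) then 1 else 0 := by
  rw [numEnds, Finset.range_add_one, Finset.filter_insert]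
  split_ifs with h
  · rw [Finset.card_insert_of_notMem (by simp)]; rfl
  · rfl

theorem numStarts_bbsMove {s : State n} (hs : Function.Injective s) (x : ℕ) :
    numStarts (bbsMove s) x = numEnds s x := by
  simp only [numStarts, numEnds, isStart_bbsMove hs]

theorem numStarts_mono (s : State n) : Monotone (numStarts s) := fun _ _ h =>
  Finset.card_le_card (Finset.filter_subset_filter _ (Finset.range_mono (by omega)))

theorem numEnds_mono (s : State n) : Monotone (numEnds s) := fun _ _ h =>
  Finset.card_le_card (Finset.filter_subset_filter _ (Finset.range_mono (by omega)))

theorem numStarts_eq {s : State n} (hs : Function.Injective s) (x : ℕ) :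
    numStarts s x = numEnds s x + if letter s x < n then 1 else 0 := by
  induction x with
  | zero =>
    simp only [numStarts, numEnds, Nat.zero_add, Finset.range_one, Finset.filter_singleton,
      IsStart, IsEnd, prevLetter]
    by_cases h : letter s 0 < n <;> simp [h]
  | succ x ih =>
    rw [numStarts_succ, numEnds_succ, ih]
    simp only [IsStart, IsEnd, prevLetter]
    have h1 := letter_le s x
    have h2 := letter_le s (x + 1)
    have h3 : letter s x < n → letter s (x + 1) ≠ letter s x := fun h h' => by
      obtain ⟨b, hb, hb'⟩ := exists_of_letter_lt hs h
      rw [hb', letter_eq_iff hs] at h'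
      omega
    by_cases k1 : letter s (x + 1) < letter s x <;> by_cases k2 : letter s x < n <;>
      by_cases k3 : letter s (x + 1) < n <;> by_cases k4 : letter s x < letter s (x + 1) <;>
      simp [k1, k2, k3, k4] <;> omega

/-- The index of the run which contains the ball `b`, counted from the left, beginning with `1`. -/
def runIndex (s : State n) (b : Fin n) : ℕ := numStarts s (s b)

theorem runIndex_eq_succ {s : State n} (hs : Function.Injective s) (b : Fin n) :
    runIndex s b = numEnds s (s b) + 1 := by
  rw [runIndex, numStarts_eq hs, letter_apply hs, if_pos b.2]

/-- If no run ends from the ball in box `x` on up to box `y`, then the letters increase on the way.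
-/
theorem letter_le_of_numEnds_eq {s : State n} {x y : ℕ} (hxy : x ≤ y)
    (h : numEnds s x = numEnds s y) (hx : letter s x < n) :
    letter s x ≤ letter s y ∧ letter s y < n := by
  induction y, hxy using Nat.le_induction with
  | base => exact ⟨le_rfl, hx⟩
  | succ y hxy ih =>
    have h1 := numEnds_mono s hxy
    have h2 := numEnds_succ s y
    split_ifs at h2 with h3
    · omega
    · obtain ⟨h4, h5⟩ := ih (by omega)
      simp only [IsEnd, prevLetter] at h3
      push Not at h3
      have := h3 h5
      omega

/-- A ball can only move on to a run further to the right, as it lands behind the end of its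
run. -/
theorem runIndex_le_bbsMove {s : State n} (hs : Function.Injective s) (b : Fin n) :
    runIndex s b ≤ runIndex (bbsMove s) b := by
  rw [runIndex_eq_succ hs, runIndex, numStarts_bbsMove hs]
  have hlt := lt_bbsMove s b
  by_contra hc
  obtain ⟨h1, h2⟩ := letter_le_of_numEnds_eq hlt.le
    (le_antisymm (numEnds_mono s hlt.le) (by omega)) (by rw [letter_apply hs]; exact b.2)
  rw [letter_apply hs] at h1
  obtain ⟨d, hd, hd'⟩ := exists_of_letter_lt hs h2
  have := lt_of_bbsMove_eq s hd.symm
  rw [hd'] at h1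
  exact absurd h1 (not_le.2 this)

theorem numStarts_le {s : State n} (hs : Function.Injective s) (x : ℕ) : numStarts s x ≤ n := by
  have : (Finset.range (x + 1)).filter (IsStart s) ⊆ Finset.univ.image s := by
    intro p hp
    rw [Finset.mem_filter] at hp
    have h1 : prevLetter s p ≤ n := by
      cases p with
      | zero => exact le_rfl
      | succ p => exact letter_le s p
    obtain ⟨b, hb, -⟩ := exists_of_letter_lt hs (lt_of_lt_of_le hp.2 h1)
    exact Finset.mem_image.2 ⟨b, Finset.mem_univ b, hb⟩
  refine (Finset.card_le_card this).trans (Finset.card_image_le.trans ?_)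
  simp

theorem not_isStart_of_numStarts_eq {s : State n} {x y p : ℕ} (h : numStarts s x = numStarts s y)
    (h1 : x < p) (h2 : p ≤ y) : ¬ IsStart s p := by
  intro hp
  obtain ⟨p, rfl⟩ : ∃ p', p = p' + 1 := ⟨p - 1, by omega⟩
  have h3 := numStarts_succ s p
  rw [if_pos hp] at h3
  have h4 := numStarts_mono s (show x ≤ p by omega)
  have h5 := numStarts_mono s h2
  omega

theorem letter_mono {s : State n} {x y : ℕ} (h : numStarts s x = numStarts s y) {p p' : ℕ}
    (h1 : x ≤ p) (h2 : p ≤ p') (h3 : p' ≤ y) : letter s p ≤ letter s p' := by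
  induction p', h2 using Nat.le_induction with
  | base => exact le_rfl
  | succ p' hp ih =>
    have := not_isStart_of_numStarts_eq h (show x < p' + 1 by omega) h3
    simp only [IsStart, prevLetter] at this
    have := ih (by omega)
    omega

theorem exists_ball_between {s : State n} (hs : Function.Injective s) {a b : Fin n}
    (h : runIndex s a = runIndex s b) {p : ℕ} (h1 : s a ≤ p) (h2 : p ≤ s b) :
    ∃ c, s c = p ∧ a ≤ c ∧ c ≤ b ∧ runIndex s c = runIndex s a := by
  have k1 := letter_mono h le_rfl h1 h2
  have k2 := letter_mono h h1 h2 le_rfl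
  rw [letter_apply hs] at k1 k2
  obtain ⟨c, rfl, hc⟩ := exists_of_letter_lt hs (lt_of_le_of_lt k2 b.2)
  rw [hc] at k1 k2
  have := numStarts_mono s h1
  have := numStarts_mono s h2
  exact ⟨c, rfl, k1, k2, by unfold runIndex at *; omega⟩

theorem le_iff_runIndex {s : State n} (hs : Function.Injective s) (a b : Fin n) :
    s a ≤ s b ↔ runIndex s a < runIndex s b ∨ (runIndex s a = runIndex s b ∧ a ≤ b) := by
  have key : ∀ a b, s a ≤ s b →
      runIndex s a < runIndex s b ∨ (runIndex s a = runIndex s b ∧ a ≤ b) := by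
    intro a b h
    rcases (numStarts_mono s h).lt_or_eq with h1 | h1
    · exact Or.inl h1
    · obtain ⟨c, hc, h2, -⟩ := exists_ball_between hs h1 h le_rfl
      exact Or.inr ⟨h1, hs hc ▸ h2⟩
  refine ⟨key a b, fun h => ?_⟩
  by_contra hc
  push Not at hc
  rcases key b a hc.le with h1 | ⟨h1, h2⟩
  · omega
  · have : a = b := le_antisymm (by omega) h2
    subst this
    exact lt_irrefl _ hc

/-- The run with index `r`, as a list. -/
def runAt (s : State n) (r : ℕ) : List (Fin n) :=
  (List.finRange n).filter (fun b => decide (runIndex s b = r))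

theorem mem_runAt {s : State n} {r : ℕ} {b : Fin n} : b ∈ runAt s r ↔ runIndex s b = r := by
  simp [runAt]

theorem runAt_pairwise (s : State n) (r : ℕ) : (runAt s r).Pairwise (· < ·) :=
  (List.sortedLT_finRange n).pairwise.filter _

/-- The number of runs. -/
def numRuns (s : State n) : ℕ := Finset.univ.sup (runIndex s)

theorem runIndex_le_numRuns (s : State n) (b : Fin n) : runIndex s b ≤ numRuns s :=
  Finset.le_sup (f := runIndex s) (Finset.mem_univ b)

theorem runIndex_pos {s : State n} (hs : Function.Injective s) (b : Fin n) : 1 ≤ runIndex s b := by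
  rw [runIndex_eq_succ hs]; omega

theorem exists_runIndex_eq {s : State n} (hs : Function.Injective s) {r : ℕ} (h1 : 1 ≤ r)
    (h2 : r ≤ numRuns s) : ∃ b, runIndex s b = r := by
  have hne : (Finset.univ : Finset (Fin n)).Nonempty := by
    by_contra hc
    rw [Finset.not_nonempty_iff_eq_empty] at hc
    rw [numRuns, hc, Finset.sup_empty] at h2
    exact absurd h2 (by simp; omega)
  obtain ⟨b, -, hb⟩ := Finset.exists_mem_eq_sup _ hne (runIndex s)
  have hex : ∃ p, r ≤ numStarts s p := ⟨s b, h2.trans hb.le⟩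
  have hp := Nat.find_spec hex
  have hmin : ∀ p, p < Nat.find hex → numStarts s p < r := fun p hp =>
    not_le.1 (Nat.find_min hex hp)
  generalize Nat.find hex = p at hp hmin
  have key : numStarts s p = r ∧ IsStart s p := by
    cases p with
    | zero =>
      have : numStarts s 0 ≤ if IsStart s 0 then 1 else 0 := by
        simp only [numStarts, Nat.zero_add, Finset.range_one, Finset.filter_singleton]
        split_ifs <;> simp
      split_ifs at this with h
      · exact ⟨by omega, h⟩
      · omega
    | succ p =>
      have h3 := hmin p (by omega)
      have h4 := numStarts_succ s p
      split_ifs at h4 with h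
      · exact ⟨by omega, h⟩
      · omega
  have h3 : prevLetter s p ≤ n := by
    cases p with
    | zero => exact le_rfl
    | succ p => exact letter_le s p
  obtain ⟨c, rfl, -⟩ := exists_of_letter_lt hs (lt_of_lt_of_le key.2 h3)
  exact ⟨c, key.1⟩

theorem runAt_ne_nil {s : State n} (hs : Function.Injective s) {r : ℕ} (h1 : 1 ≤ r)
    (h2 : r ≤ numRuns s) : runAt s r ≠ [] := by
  obtain ⟨b, hb⟩ := exists_runIndex_eq hs h1 h2
  exact List.ne_nil_of_mem (mem_runAt.2 hb)

theorem runAt_isChain {s : State n} (hs : Function.Injective s) (r : ℕ) :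
    (runAt s r).IsChain (fun a b => s b = s a + 1 ∧ a < b) := by
  rw [List.isChain_iff_getElem]
  intro i hi
  have hsort := runAt_pairwise s r
  have hmono : StrictMono (runAt s r).get :=
    fun i j hij => List.pairwise_iff_getElem.1 hsort i j i.2 j.2 hij
  have ha := mem_runAt.1 (List.getElem_mem (l := runAt s r) (n := i) (by omega))
  have hb := mem_runAt.1 (List.getElem_mem hi)
  have hab : (runAt s r)[i] < (runAt s r)[i + 1] :=
    hmono (a := ⟨i, by omega⟩) (b := ⟨i + 1, hi⟩) (by simp)
  set a := (runAt s r)[i]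
  set b := (runAt s r)[i + 1]
  refine ⟨?_, hab⟩
  have hsab : s a < s b := by
    refine lt_of_le_of_ne ((le_iff_runIndex hs a b).2 (Or.inr ⟨ha.trans hb.symm, hab.le⟩)) ?_
    exact fun h => hab.ne (hs h)
  obtain ⟨c, hc, h1, h2, h3⟩ :=
    exists_ball_between hs (ha.trans hb.symm) (p := s a + 1) (by omega) hsab
  have hac : a < c := lt_of_le_of_ne h1 fun h => by subst h; omega
  obtain ⟨k, hk, hkc⟩ := List.getElem_of_mem (mem_runAt.2 (h3.trans ha))
  have k1 : i < k := by
    have := (hmono.lt_iff_lt (a := ⟨i, by omega⟩) (b := ⟨k, hk⟩)).1 (by simpa [hkc] using hac)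
    exact this
  have k2 : k ≤ i + 1 := by
    have := (hmono.le_iff_le (a := ⟨k, hk⟩) (b := ⟨i + 1, hi⟩)).1 (by simpa [hkc] using h2)
    exact this
  obtain rfl : k = i + 1 := by omega
  rw [← hc, ← hkc]

theorem runIndex_eq_of_adjacent {s : State n} (hs : Function.Injective s) {a b : Fin n}
    (h : s b = s a + 1) (hab : a < b) : runIndex s b = runIndex s a := by
  have : ¬ IsStart s (s a + 1) := by
    simp only [IsStart, prevLetter]
    rw [← h, letter_apply hs, letter_apply hs, not_lt]
    exact hab.le
  rw [runIndex, runIndex, h, numStarts_succ, if_neg this, Nat.add_zero]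

theorem flatten_runAt {s : State n} (hs : Function.Injective s) :
    ((List.range' 1 (numRuns s)).map (runAt s)).flatten = ballsInOrder s := by
  have hpw : ((List.range' 1 (numRuns s)).map (runAt s)).flatten.Pairwise
      (fun a b => s a < s b) := by
    rw [List.pairwise_flatten]
    constructor
    · intro l hl
      obtain ⟨r, -, rfl⟩ := List.mem_map.1 hl
      refine ((runAt_pairwise s r).imp_of_mem ?_)
      intro a b ha hb hab
      refine lt_of_le_of_ne ((le_iff_runIndex hs a b).2 (Or.inr ⟨?_, hab.le⟩))
        fun h => hab.ne (hs h)
      rw [mem_runAt.1 ha, mem_runAt.1 hb]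
    · rw [List.pairwise_map]
      refine (List.pairwise_lt_range' 1).imp ?_
      intro r r' h a ha b hb
      have ha := mem_runAt.1 ha
      have hb := mem_runAt.1 hb
      refine lt_of_le_of_ne ((le_iff_runIndex hs a b).2 (Or.inl (by omega))) fun h => ?_
      rw [hs h] at ha
      omega
  have hperm : ((List.range' 1 (numRuns s)).map (runAt s)).flatten.Perm (ballsInOrder s) := by
    refine List.Perm.trans ?_ (List.perm_insertionSort _ _).symm
    rw [List.perm_ext_iff_of_nodup _ (List.nodup_finRange n)]
    · intro b
      simp only [List.mem_flatten, List.mem_map, List.mem_range'_1, List.mem_finRange, iff_true]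
      refine ⟨_, ⟨runIndex s b, ⟨runIndex_pos hs b, ?_⟩, rfl⟩, mem_runAt.2 rfl⟩
      have := runIndex_le_numRuns s b
      omega
    · exact hpw.imp fun h => by rintro rfl; exact lt_irrefl _ h
  refine hperm.eq_of_pairwise (le := fun a b => s a ≤ s b)
    (fun a b _ _ h1 h2 => hs (le_antisymm h1 h2))
    (hpw.imp le_of_lt) ?_
  have : IsTrans (Fin n) (fun a b => s a ≤ s b) := ⟨fun _ _ _ => le_trans⟩
  have : Std.Total (fun a b : Fin n => s a ≤ s b) := ⟨fun a b => le_total _ _⟩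
  exact List.pairwise_insertionSort _ _

theorem runs_eq {s : State n} (hs : Function.Injective s) :
    runs s = (List.range' 1 (numRuns s)).map (runAt s) := by
  rw [runs, ← flatten_runAt hs]
  refine List.splitBy_flatten ?_ ?_ ?_
  · intro h
    obtain ⟨r, hr, hr'⟩ := List.mem_map.1 h
    rw [List.mem_range'_1] at hr
    exact runAt_ne_nil hs hr.1 (by omega) hr'
  · intro l hl
    obtain ⟨r, -, rfl⟩ := List.mem_map.1 hl
    simpa using runAt_isChain hs r
  · refine List.Pairwise.isChain ?_
    rw [List.pairwise_map]
    refine (List.pairwise_lt_range' 1).imp_of_mem ?_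
    intro r r' hr hr' h
    rw [List.mem_range'_1] at hr hr'
    have h1 := runAt_ne_nil hs hr.1 (by omega)
    have h2 := runAt_ne_nil hs hr'.1 (by omega)
    refine ⟨h1, h2, ?_⟩
    rw [decide_eq_false_iff_not]
    rintro ⟨h3, h4⟩
    have h5 := runIndex_eq_of_adjacent hs h3 h4
    rw [mem_runAt.1 (List.getLast_mem h1), mem_runAt.1 (List.head_mem h2)] at h5
    omega

/-! ### Existence of steady states -/

/-- No ball changes its run in later moves. -/
def Settled (s : State n) : Prop := ∀ m, runIndex (bbsMove^[m] s) = runIndex s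

theorem iterate_injective {s : State n} (hs : Function.Injective s) (m : ℕ) :
    Function.Injective (bbsMove^[m] s) := by
  cases m with
  | zero => exact hs
  | succ m => rw [Function.iterate_succ_apply']; exact bbsMove_injective _

theorem initialState_injective (w : Equiv.Perm (Fin n)) : Function.Injective (initialState w) :=
  fun _ _ h => w.symm.injective (Fin.ext h)

theorem stateAt_injective (w : Equiv.Perm (Fin n)) (t : ℕ) : Function.Injective (stateAt w t) :=
  iterate_injective (initialState_injective w) t

/-- The index of the run of a ball never decreases and is at most `n`, hence is eventually constant
for all balls. -/
theorem exists_settled {s : State n} (hs : Function.Injective s) :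
    ∃ t, Settled (bbsMove^[t] s) := by
  have hstep : ∀ t b, runIndex (bbsMove^[t] s) b ≤ runIndex (bbsMove^[t + 1] s) b := by
    intro t b
    rw [Function.iterate_succ_apply']
    exact runIndex_le_bbsMove (iterate_injective hs t) b
  have hmono : ∀ b, Monotone (fun t => runIndex (bbsMove^[t] s) b) :=
    fun b => monotone_nat_of_le_succ fun t => hstep t b
  set f : ℕ → ℕ := fun t => ∑ b, runIndex (bbsMove^[t] s) b
  have hbdd : BddAbove (Set.range f) := by
    refine ⟨∑ _b : Fin n, n, ?_⟩
    rintro _ ⟨t, rfl⟩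
    exact Finset.sum_le_sum fun b _ => numStarts_le (iterate_injective hs t) _
  obtain ⟨t, ht⟩ := Nat.sSup_mem (Set.range_nonempty f) hbdd
  refine ⟨t, fun m => ?_⟩
  have h1 : f (m + t) ≤ f t := by rw [ht]; exact le_csSup hbdd ⟨_, rfl⟩
  have h2 : ∀ b ∈ Finset.univ, runIndex (bbsMove^[t] s) b ≤ runIndex (bbsMove^[m + t] s) b :=
    fun b _ => hmono b (Nat.le_add_left t m)
  funext b
  rw [← Function.iterate_add_apply]
  exact ((Finset.sum_eq_sum_iff_of_le h2).1
    (le_antisymm (Finset.sum_le_sum h2) h1) b (by simp)).symm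

theorem Settled.bbsMove {s : State n} (h : Settled s) : Settled (bbsMove s) := by
  intro m
  rw [← Function.iterate_succ_apply, h (m + 1)]
  exact (h 1).symm

theorem getElem_runAt {s : State n} (hs : Function.Injective s) (r : ℕ) {i : ℕ}
    (hi : i < (runAt s r).length) :
    s (runAt s r)[i] = s ((runAt s r)[0]'(by omega)) + i := by
  induction i with
  | zero => rfl
  | succ i ih =>
    have := (List.isChain_iff_getElem.1 (runAt_isChain hs r) i hi).1
    rw [this, ih (by omega)]
    omega

theorem runAt_congr {s s' : State n} (h : runIndex s = runIndex s') : runAt s = runAt s' := by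
  funext r
  simp only [runAt, h]

/-- In a settled state, every ball moves by the length of its run. -/
theorem Settled.bbsMove_eq {s : State n} (hs : Function.Injective s) (h : Settled s) (b : Fin n) :
    BoxBall.bbsMove s b = s b + (runAt s (runIndex s b)).length := by
  have hq := bbsMove_injective s
  set r := runIndex s b with hr
  have hidx : runIndex (BoxBall.bbsMove s) = runIndex s := h 1
  have hrun : runAt (BoxBall.bbsMove s) r = runAt s r := by rw [runAt_congr hidx]
  obtain ⟨i, hi, hib⟩ := List.getElem_of_mem (mem_runAt.2 hr.symm)
  set R := runAt s r with hR
  have hpos : ∀ k (hk : k < R.length), s R[k] = s (R[0]'(by omega)) + k :=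
    fun k hk => getElem_runAt hs r hk
  have hposq : ∀ k (hk : k < R.length),
      BoxBall.bbsMove s R[k] = BoxBall.bbsMove s (R[0]'(by omega)) + k := by
    intro k hk
    have := getElem_runAt hq r (i := k) (by rw [hrun]; exact hk)
    simpa only [hrun] using this
  have hL : 0 < R.length := by omega
  set p := s R[0] + (R.length - 1) with hp
  have hlast : s R[R.length - 1] = p := hpos _ (by omega)
  have hlastr : runIndex s R[R.length - 1] = r := mem_runAt.1 (List.getElem_mem _)
  -- the first ball of the run lands right behind the last one, in box `p + 1`
  have hend : IsEnd s (p + 1) := by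
    simp only [IsEnd, prevLetter]
    rw [← hlast, letter_apply hs]
    refine ⟨Fin.is_lt _, fun ⟨h1, h2⟩ => ?_⟩
    obtain ⟨d, hd, hd'⟩ := exists_of_letter_lt hs h2
    have h3 := runIndex_eq_of_adjacent hs hd (by rw [hd'] at h1; exact h1)
    rw [hlastr] at h3
    obtain ⟨k, hk, hkd⟩ : ∃ k, ∃ hk : k < R.length, R[k] = d :=
      List.getElem_of_mem (mem_runAt.2 h3)
    have h4 := hpos k hk
    rw [hkd, hd, hlast] at h4
    omega
  have hstart := (isStart_bbsMove hs (p + 1)).2 hend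
  obtain ⟨c, hc, -⟩ := exists_of_letter_lt hq (lt_of_lt_of_le hstart (letter_le _ p))
  have hcr : runIndex s c = r := by
    rw [← hidx, runIndex, hc, numStarts_bbsMove hs, numEnds_succ, if_pos hend, ← hlast,
      ← runIndex_eq_succ hs, hlastr]
  obtain ⟨k, hk, hkc⟩ : ∃ k, ∃ hk : k < R.length, R[k] = c :=
    List.getElem_of_mem (mem_runAt.2 hcr)
  have hk0 : k = 0 := by
    by_contra hk0
    simp only [IsStart, prevLetter] at hstart
    have h1 := hposq k hk
    have h2 := hposq (k - 1) (by omega)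
    rw [hkc, hc] at h1
    have h3 : BoxBall.bbsMove s R[k - 1] = p := by omega
    rw [← hc, ← h3, letter_apply hq, letter_apply hq, ← hkc] at hstart
    have h4 := List.pairwise_iff_getElem.1 (runAt_pairwise s r) (k - 1) k
      (by omega : k - 1 < R.length) hk (by omega)
    exact absurd hstart (not_lt.2 (Fin.le_def.1 h4.le))
  subst hk0
  have h1 := hposq i hi
  have h2 := hpos i hi
  rw [hkc, hc] at h1
  have hib' : R[i] = b := hib
  rw [hib'] at h1 h2
  omega

theorem Settled.iterate_eq {s : State n} (hs : Function.Injective s) (h : Settled s) (b : Fin n)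
    (m : ℕ) : BoxBall.bbsMove^[m] s b = s b + m * (runAt s (runIndex s b)).length := by
  induction m generalizing s with
  | zero => simp
  | succ m ih =>
    have h1 : runIndex (BoxBall.bbsMove s) = runIndex s := h 1
    rw [Function.iterate_succ_apply, ih (bbsMove_injective s) h.bbsMove, h.bbsMove_eq hs,
      runAt_congr h1, h1]
    ring

/-- Otherwise the faster run would overtake one on its right. -/
theorem Settled.length_mono {s : State n} (hs : Function.Injective s) (h : Settled s) {r r' : ℕ}
    (hrr' : r ≤ r') (h' : r' ≤ numRuns s) : (runAt s r).length ≤ (runAt s r').length := by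
  rcases (runAt s r).eq_nil_or_concat with h0 | ⟨_, a, h0⟩
  · simp [h0]
  have ha : runIndex s a = r := mem_runAt.1 (by rw [h0]; simp)
  have h1 : 1 ≤ r := ha ▸ runIndex_pos hs a
  rcases hrr'.eq_or_lt with rfl | hlt
  · exact le_rfl
  obtain ⟨b, hb⟩ := exists_runIndex_eq hs (h1.trans hrr') h'
  by_contra hc
  set m := s b + 1
  have h2 : runIndex (BoxBall.bbsMove^[m] s) a < runIndex (BoxBall.bbsMove^[m] s) b := by
    rw [h m]; omega
  have h3 := (le_iff_runIndex (iterate_injective hs m) a b).2 (Or.inl h2)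
  rw [h.iterate_eq hs, h.iterate_eq hs, ha, hb] at h3
  have h4 : m * ((runAt s r').length + 1) ≤ m * (runAt s r).length :=
    Nat.mul_le_mul_left m (by omega)
  rw [Nat.mul_add] at h4
  omega

/-- A settled state is steady: the runs keep their balls, and faster runs are on the right. -/
theorem Settled.isSteady {s : State n} (hs : Function.Injective s) (h : Settled s) :
    IsSteady s := by
  constructor
  · intro m
    rw [runs_eq hs, runs_eq (iterate_injective hs m), numRuns, numRuns, runAt_congr (h m), h m]
  · rw [runs_eq hs, List.pairwise_map]
    refine (List.pairwise_lt_range' 1).imp_of_mem ?_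
    intro r r' _ hr' hlt
    rw [List.mem_range'_1] at hr'
    exact h.length_mono hs hlt.le (by omega)

/-! ### Chains in the word of a settled state -/

theorem length_runAt (s : State n) (r : ℕ) :
    (runAt s r).length = (Finset.univ.filter (fun b => runIndex s b = r)).card := by
  have hnd : (runAt s r).Nodup := (runAt_pairwise s r).imp ne_of_lt
  rw [← List.toFinset_card_of_nodup hnd]
  congr 1
  ext b
  simp [mem_runAt]

/-- The total length of the `j` rightmost runs. -/
def topSum (s : State n) (j : ℕ) : ℕ :=
  ∑ r ∈ Finset.Ioc (numRuns s - j) (numRuns s), (runAt s r).length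

theorem topSum_eq_card (s : State n) (j : ℕ) :
    topSum s j = (Finset.univ.filter (fun b => numRuns s - j < runIndex s b)).card := by
  rw [Finset.card_eq_sum_card_fiberwise (f := runIndex s)
    (t := Finset.Ioc (numRuns s - j) (numRuns s))]
  · refine Finset.sum_congr rfl fun r hr => ?_
    rw [length_runAt, Finset.filter_filter]
    congr 1
    ext b
    simp only [Finset.mem_filter, Finset.mem_univ, true_and, Finset.mem_Ioc] at hr ⊢
    omega
  · intro b hb
    have := runIndex_le_numRuns s b
    simp only [Finset.coe_filter, Finset.mem_univ, true_and, Set.mem_ofPred_eq, Finset.coe_Ioc,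
      Set.mem_Ioc] at hb ⊢
    omega

theorem numStarts_le_numRuns {s : State n} (hs : Function.Injective s) (x : ℕ) :
    numStarts s x ≤ numRuns s := by
  have hball : ∀ p, IsStart s p → numStarts s p ≤ numRuns s := by
    intro p hp
    have h3 : prevLetter s p ≤ n := by
      cases p with
      | zero => exact le_rfl
      | succ p => exact letter_le s p
    obtain ⟨c, rfl, -⟩ := exists_of_letter_lt hs (lt_of_lt_of_le hp h3)
    exact runIndex_le_numRuns s c
  induction x with
  | zero =>
    by_cases h : IsStart s 0
    · exact hball 0 h
    · simp [numStarts, Finset.filter_singleton, h]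
  | succ x ih =>
    by_cases h : IsStart s (x + 1)
    · exact hball _ h
    · rw [numStarts_succ, if_neg h]; exact ih

/-- The number of runs which start before box `p`. -/
def numStartsBefore (s : State n) : ℕ → ℕ
  | 0 => 0
  | p + 1 => numStarts s p

theorem numStarts_eq_before (s : State n) (p : ℕ) :
    numStarts s p = numStartsBefore s p + if IsStart s p then 1 else 0 := by
  cases p with
  | zero =>
    simp only [numStarts, numStartsBefore, Nat.zero_add, Finset.range_one, Finset.filter_singleton]
    split_ifs <;> simp
  | succ p => exact numStarts_succ s p

theorem sum_empty_or {s : State n} (hs : Function.Injective s) {M : ℕ} (hM : ∀ b, s b < M)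
    (Q : ℕ → Prop) [DecidablePred Q] :
    ∑ p ∈ Finset.Ico 0 M, (if letter s p = n ∨ Q p then 1 else 0) =
      (M - n) + (Finset.univ.filter (fun b => Q (s b))).card := by
  have hsub : Finset.univ.image s ⊆ Finset.Ico 0 M := by
    intro p hp
    obtain ⟨b, -, rfl⟩ := Finset.mem_image.1 hp
    simpa using hM b
  rw [← Finset.sum_sdiff hsub, Finset.sum_image (fun a _ b _ h => hs h)]
  congr 1
  · rw [Finset.sum_congr rfl (g := fun _ => 1), Finset.sum_const, smul_eq_mul, mul_one,
      Finset.card_sdiff_of_subset hsub, Finset.card_image_of_injective _ hs]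
    · simp
    · intro p hp
      rw [Finset.mem_sdiff] at hp
      rw [if_pos]
      left
      refine letter_eq_top fun b hb => hp.2 ?_
      exact Finset.mem_image.2 ⟨b, Finset.mem_univ b, hb⟩
  · rw [Finset.card_filter]
    refine Finset.sum_congr rfl fun b _ => ?_
    have : letter s (s b) ≠ n := by rw [letter_apply hs]; exact b.2.ne
    simp [this]

theorem segChain_replicate {u : List ℕ} {j m : ℕ} (A : ℕ) (h : SegChain u n j m) :
    SegChain (List.replicate A n ++ u) n j (A + m) := by
  induction A with
  | zero => simpa using h
  | succ A ih =>
    rw [List.replicate_succ, List.cons_append, Nat.add_right_comm]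
    exact ih.pick le_rfl

/-- Cutting the word of a state in front of each of the `j` rightmost runs, one can choose all
empty boxes and all balls in these runs. -/
theorem segChain_topSum {s : State n} (hs : Function.Injective s) {M : ℕ} (hM : ∀ b, s b < M)
    (A j : ℕ) :
    SegChain (List.replicate A n ++ letters s 0 M) n j (A + ((M - n) + topSum s j)) := by
  refine segChain_replicate A ?_
  set k := numRuns s with hk
  -- the statement for the suffix from box `p` on
  have key : ∀ d p, p + d = M → SegChain (letters s p M)
      (if k - j < numStartsBefore s p then prevLetter s p else n) (min j (k - numStartsBefore s p))
      (∑ p' ∈ Finset.Ico p M, (if letter s p' = n ∨ k - j < numStarts s p' then 1 else 0)) := by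
    intro d
    induction d with
    | zero =>
      rintro p rfl
      rw [Nat.add_zero, letters_self, Finset.Ico_self, Finset.sum_empty]
      exact SegChain.nil _ _
    | succ d ih =>
      intro p hp
      have ih : SegChain (letters s (p + 1) M) (if k - j < numStarts s p then letter s p else n)
          (min j (k - numStarts s p)) (∑ p' ∈ Finset.Ico (p + 1) M,
            (if letter s p' = n ∨ k - j < numStarts s p' then 1 else 0)) := ih (p + 1) (by omega)
      rw [letters_cons s (by omega), Finset.sum_eq_sum_Ico_succ_bot (by omega)]
      have h1 := numStarts_eq_before s p
      have h2 := numStarts_le_numRuns hs p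
      have h3 := letter_le s p
      set G := ∑ p' ∈ Finset.Ico (p + 1) M,
        (if letter s p' = n ∨ k - j < numStarts s p' then 1 else 0)
      by_cases hst : IsStart s p
      · rw [if_pos hst] at h1
        by_cases hc : k - j < numStarts s p
        · rw [if_pos hc] at ih
          rw [if_pos (Or.inr hc), Nat.add_comm 1 G]
          have e : min j (k - numStartsBefore s p) = min j (k - numStarts s p) + 1 := by omega
          rw [e]
          exact (ih.pick le_rfl).add_cut _
        · rw [if_neg hc] at ih
          rw [if_neg (by omega)]
          have hlt : letter s p < n := lt_of_lt_of_le hst (by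
            cases p with
            | zero => exact le_rfl
            | succ p => exact letter_le s p)
          rw [if_neg (by omega), Nat.zero_add]
          have e : min j (k - numStartsBefore s p) = min j (k - numStarts s p) := by omega
          rw [e]
          exact ih.skip
      · rw [if_neg hst, Nat.add_zero] at h1
        simp only [IsStart, not_lt] at hst
        rw [← h1]
        by_cases hc : k - j < numStarts s p
        · rw [if_pos hc] at ih ⊢
          rw [if_pos (Or.inr hc), Nat.add_comm 1 G]
          exact ih.pick hst
        · rw [if_neg hc] at ih ⊢
          by_cases he : letter s p = n
          · rw [if_pos (Or.inl he), Nat.add_comm 1 G]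
            rw [he]
            exact ih.pick le_rfl
          · rw [if_neg (by tauto), Nat.zero_add]
            exact ih.skip
  have h0 := key M 0 (by omega)
  rw [sum_empty_or hs hM, numStartsBefore, if_neg (by omega), Nat.sub_zero] at h0
  have e : topSum s j = (Finset.univ.filter (fun b => k - j < numStarts s (s b))).card :=
    topSum_eq_card s j
  rw [e]
  have : ∀ d, SegChain (letters s 0 M) n (min j k + d) ((M - n) +
      (Finset.univ.filter (fun b => k - j < numStarts s (s b))).card) := by
    intro d
    induction d with
    | zero => exact h0
    | succ d ih => exact ih.add_cut n
  have := this (j - min j k)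
  rwa [Nat.add_sub_cancel' (min_le_left j k)] at this

/-- The number of letters `≤ v` in the carrier. -/
def carrierLE (s : State n) (p v : ℕ) : ℕ :=
  ∑ r ∈ Finset.range (v + 1), carrierMult (carrier s p) r

/-- The change of the number of small letters in the carrier when box `p` is read. -/
theorem carrierLE_succ {s : State n} (hs : Function.Injective s) (p : ℕ) {v : ℕ} (hv : v < n) :
    carrierLE s (p + 1) v + (if letter (bbsMove s) p ≤ v then 1 else 0) =
      carrierLE s p v + (if letter s p ≤ v then 1 else 0) := by
  have h := Finset.sum_congr (rfl : Finset.range (v + 1) = _)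
    (fun r hr => carrierMult_succ hs p (r := r) (by rw [Finset.mem_range] at hr; omega))
  rw [Finset.sum_add_distrib, Finset.sum_add_distrib, Finset.sum_ite_eq', Finset.sum_ite_eq'] at h
  simpa [carrierLE, Nat.lt_succ_iff] using h

theorem carrierLE_mono (s : State n) (p : ℕ) {v v' : ℕ} (h : v ≤ v') :
    carrierLE s p v ≤ carrierLE s p v' :=
  Finset.sum_le_sum_of_subset (Finset.range_mono (by omega))

theorem carrierLE_eq_card (s : State n) (p : ℕ) (x : Fin n) :
    carrierLE s p x = ((carrier s p).filter (fun c => c ≤ x)).card := by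
  have e : ∀ r ∈ Finset.range n, r ∉ Finset.range (x + 1) →
      (if r ≤ x then carrierMult (carrier s p) r else 0) = 0 := by
    intro r _ hr
    rw [Finset.mem_range] at hr
    rw [if_neg (by omega)]
  have e2 : carrierLE s p x = ∑ r ∈ Finset.range n,
      if r ≤ x then carrierMult (carrier s p) r else 0 := by
    rw [← Finset.sum_subset (Finset.range_mono (by omega : (x : ℕ) + 1 ≤ n)) e]
    refine Finset.sum_congr rfl fun r hr => ?_
    rw [Finset.mem_range] at hr
    rw [if_pos (by omega)]
  rw [e2, Finset.sum_range, Finset.card_filter,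
    ← Finset.sum_filter_add_sum_filter_not Finset.univ (· ∈ carrier s p)]
  rw [Finset.sum_eq_zero (s := Finset.univ.filter (· ∉ carrier s p)), Nat.add_zero]
  · have e3 : Finset.univ.filter (· ∈ carrier s p) = carrier s p := Finset.filter_univ_mem _
    rw [e3]
    refine Finset.sum_congr rfl fun c hc => ?_
    have hm : carrierMult (carrier s p) c = 1 := by
      rw [carrierMult, dif_pos c.2, if_pos (by simpa using hc)]
    rw [hm]
    exact if_congr Iff.rfl rfl rfl
  · intro c hc
    have hm : carrierMult (carrier s p) c = 0 := by
      rw [carrierMult, dif_pos c.2, if_neg (by simpa using hc)]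
    rw [hm]
    simp

/-- A chain within one segment of a state, up to the letter `v`, exceeds the number of empty boxes
at most by the number of letters `≤ v` in the carrier. -/
theorem length_le_carrierLE {s : State n} (hs : Function.Injective s) {a p : ℕ} (hap : a ≤ p) :
    ∀ {V : List ℕ} {v : ℕ}, v < n → V.Sublist (letters s a p) → V.Pairwise (· ≤ ·) →
      (∀ x ∈ V, x ≤ v) → V.length ≤ (letters s a p).count n + carrierLE s p v := by
  induction p, hap using Nat.le_induction with
  | base =>
    intro V v _ hV _ _
    rw [letters_self, List.sublist_nil] at hV
    simp [hV]
  | succ p hap ih =>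
    intro V v hv hV hV2 hV3
    rw [letters_succ s hap] at hV ⊢
    rw [List.sublist_append_iff] at hV
    obtain ⟨V₁, V₂, rfl, h1, h2⟩ := hV
    have h3 := carrierLE_succ hs p hv
    have h4 := letter_lt_letter_bbsMove hs (p := p)
    have h5 := letter_le s p
    rw [List.pairwise_append] at hV2
    rw [List.count_append]
    rcases List.sublist_cons_iff.1 h2 with h2' | ⟨V₃, rfl, h2'⟩
    · rw [List.sublist_nil] at h2'
      subst h2'
      have h6 := ih hv h1 hV2.1 (fun x hx => hV3 x (by simp [hx]))
      rw [List.append_nil]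
      by_cases he : letter s p = n
      · rw [he, List.count_singleton_self]
        rw [he] at h3
        split_ifs at h3 <;> omega
      · have := h4 (by omega)
        split_ifs at h3 <;> omega
    · rw [List.sublist_nil] at h2'
      subst h2'
      have hx := hV3 (letter s p) (by simp)
      have hxn : letter s p < n := by omega
      have h6 := ih hxn h1 hV2.1 (fun x hx => hV2.2.2 x hx _ (by simp))
      have h7 := carrierLE_succ hs p hxn
      have h8 := carrierLE_mono s (p + 1) hx
      rw [if_pos le_rfl, if_neg (not_le.2 (h4 hxn))] at h7
      rw [List.length_append, List.length_singleton]
      omega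

/-- In a settled state, a ball which is carried over a larger ball `x` belongs to the run of `x`:
otherwise it would pass to a later run. -/
theorem Settled.runIndex_eq_of_mem_carrier {s : State n} (hs : Function.Injective s)
    (h : Settled s) {x c : Fin n} (hc : c ∈ carrier s (s x + 1)) (hcx : c ≤ x) :
    runIndex s c = runIndex s x := by
  rw [mem_carrier] at hc
  refine le_antisymm (numStarts_mono s (by omega)) ?_
  by_contra hlt
  have h1 : runIndex (BoxBall.bbsMove s) c = runIndex s c := congrFun (h 1) c
  rw [runIndex, numStarts_bbsMove hs] at h1
  have h2 := runIndex_eq_succ hs x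
  have h3 := numEnds_mono s (show s x ≤ BoxBall.bbsMove s c by omega)
  obtain ⟨h4, h5⟩ := letter_le_of_numEnds_eq (s := s) (x := s x) (y := BoxBall.bbsMove s c)
    (by omega) (by omega) (by rw [letter_apply hs]; exact x.2)
  obtain ⟨d, hd, hd'⟩ := exists_of_letter_lt hs h5
  have h6 := lt_of_bbsMove_eq s hd.symm
  rw [hd', letter_apply hs] at h4
  exact absurd (lt_of_lt_of_le h6 hcx) (not_lt.2 h4)

/-- The number of balls of the `r`-th run in the boxes `a, …, b - 1`. -/
def runCount (s : State n) (r a b : ℕ) : ℕ :=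
  (Finset.univ.filter (fun c => runIndex s c = r ∧ a ≤ s c ∧ s c < b)).card

theorem runCount_mono (s : State n) (r : ℕ) {a a' b b' : ℕ} (ha : a' ≤ a) (hb : b ≤ b') :
    runCount s r a b ≤ runCount s r a' b' :=
  Finset.card_le_card fun c hc => by
    simp only [Finset.mem_filter, Finset.mem_univ, true_and] at hc ⊢
    omega

theorem runCount_add (s : State n) (r : ℕ) {a b c : ℕ} (h1 : a ≤ b) (h2 : b ≤ c) :
    runCount s r a b + runCount s r b c = runCount s r a c := by
  unfold runCount
  rw [← Finset.card_union_of_disjoint]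
  · congr 1
    ext x
    simp only [Finset.mem_union, Finset.mem_filter, Finset.mem_univ, true_and]
    omega
  · rw [Finset.disjoint_left]
    intro x
    simp only [Finset.mem_filter, Finset.mem_univ, true_and]
    omega

/-- A chain within one segment of a settled state uses effectively a single run. -/
theorem Settled.length_le {s : State n} (hs : Function.Injective s) (h : Settled s) {a b : ℕ}
    (hab : a ≤ b) : ∀ {V : List ℕ}, V.Sublist (letters s a b) → V.Pairwise (· ≤ ·) →
      ∃ r, V.length ≤ (letters s a b).count n + runCount s r a b := by
  induction b, hab using Nat.le_induction with
  | base =>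
    intro V hV _
    rw [letters_self, List.sublist_nil] at hV
    exact ⟨0, by simp [hV]⟩
  | succ b hab ih =>
    intro V hV hV2
    have hV' := hV
    rw [letters_succ s hab] at hV
    rw [List.sublist_append_iff] at hV
    obtain ⟨V₁, V₂, rfl, h1, h2⟩ := hV
    have hV3 := hV2
    rw [List.pairwise_append] at hV3
    obtain ⟨r, hr⟩ := ih h1 hV3.1
    have hmono := runCount_mono s r le_rfl (show b ≤ b + 1 by omega) (a := a)
    rw [letters_succ s hab, List.count_append]
    rcases List.sublist_cons_iff.1 h2 with h2' | ⟨V₃, rfl, h2'⟩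
    · rw [List.sublist_nil] at h2'
      subst h2'
      exact ⟨r, by rw [List.append_nil]; omega⟩
    · rw [List.sublist_nil] at h2'
      subst h2'
      by_cases he : letter s b = n
      · refine ⟨r, ?_⟩
        rw [he, List.count_singleton_self, List.length_append, List.length_singleton]
        omega
      · have hlt : letter s b < n := lt_of_le_of_ne (letter_le s b) he
        obtain ⟨x, rfl, hx⟩ := exists_of_letter_lt hs hlt
        refine ⟨runIndex s x, ?_⟩
        by_cases hbefore : ∃ c, runIndex s c = runIndex s x ∧ s c < a
        · -- all boxes of the window belong to the run of `x`
          obtain ⟨c, hc, hca⟩ := hbefore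
          have hle : (V₁ ++ [letter s (s x)]).length ≤ s x + 1 - a := by
            have := hV'.length_le
            rwa [letters_length] at this
          have hcard : (Finset.Ico a (s x + 1)).card ≤ runCount s (runIndex s x) a (s x + 1) := by
            have hsub : Finset.Ico a (s x + 1) ⊆ (Finset.univ.filter (fun c =>
                runIndex s c = runIndex s x ∧ a ≤ s c ∧ s c < s x + 1)).image s := by
              intro p hp
              rw [Finset.mem_Ico] at hp
              obtain ⟨d, rfl, -, -, hd⟩ := exists_ball_between hs hc (p := p) (by omega) (by omega)
              refine Finset.mem_image.2 ⟨d, ?_, rfl⟩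
              simp only [Finset.mem_filter, Finset.mem_univ, true_and]
              exact ⟨hd.trans hc, hp.1, hp.2⟩
            exact (Finset.card_le_card hsub).trans Finset.card_image_le
          rw [Nat.card_Ico] at hcard
          omega
        · -- the carrier bounds the chain, and the carried balls `≤ x` belong to the run of `x`
          push Not at hbefore
          have h3 := length_le_carrierLE hs (show a ≤ s x + 1 by omega) (v := x) x.2 hV' hV2 (by
            intro y hy
            rw [← hx]
            rcases List.mem_append.1 hy with hy | hy
            · exact hV3.2.2 y hy _ (by simp)
            · rw [List.mem_singleton.1 hy])
          have h4 : carrierLE s (s x + 1) x ≤ runCount s (runIndex s x) a (s x + 1) := by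
            rw [carrierLE_eq_card]
            refine Finset.card_le_card fun c hc => ?_
            rw [Finset.mem_filter] at hc
            have h5 := h.runIndex_eq_of_mem_carrier hs hc.1 hc.2
            have h6 := mem_carrier.1 hc.1
            simp only [Finset.mem_filter, Finset.mem_univ, true_and]
            exact ⟨h5, hbefore c h5, h6.1⟩
          rw [letters_succ s hab, List.count_append] at h3
          omega

theorem letters_split {s : State n} {a b : ℕ} (hab : a ≤ b) {u₁ u₂ : List ℕ}
    (h : letters s a b = u₁ ++ u₂) :
    ∃ p, a ≤ p ∧ p ≤ b ∧ u₁ = letters s a p ∧ u₂ = letters s p b := by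
  have hl := congrArg List.length h
  rw [letters_length, List.length_append] at hl
  refine ⟨a + u₁.length, by omega, by omega, ?_⟩
  rw [← letters_append s (b := a + u₁.length) (by omega) (by omega)] at h
  obtain ⟨h1, h2⟩ := List.append_inj h (by rw [letters_length]; omega)
  exact ⟨h1.symm, h2.symm⟩

/-- Every segment uses a single run, and a run used in several segments is counted only once. -/
theorem Settled.segChain_le {s : State n} (hs : Function.Injective s) (h : Settled s) {M : ℕ}
    {j : ℕ} : ∀ {p m : ℕ}, p ≤ M → SegChain (letters s p M) 0 j m → ∃ S : Finset ℕ,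
      S.card ≤ j + 1 ∧ m ≤ (letters s p M).count n + ∑ r ∈ S, runCount s r p M := by
  induction j with
  | zero =>
    intro p m hp hm
    obtain ⟨u₁, u₂, V, m', h0, h1, h2, -, h4, h5⟩ := hm.firstSeg
    rcases h5 with ⟨-, rfl, rfl⟩ | ⟨j', h5, -⟩
    · rw [List.append_nil] at h0
      obtain ⟨r, hr⟩ := h.length_le hs hp (h0 ▸ h1) h2
      exact ⟨{r}, by simp, by simpa [h4] using hr⟩
    · omega
  | succ j ih =>
    intro p m hp hm
    obtain ⟨u₁, u₂, V, m', h0, h1, h2, -, h4, h5⟩ := hm.firstSeg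
    rcases h5 with ⟨h5, -, -⟩ | ⟨j', h5, h6⟩
    · omega
    obtain rfl : j = j' := by omega
    obtain ⟨p', hp1, hp2, rfl, rfl⟩ := letters_split hp h0
    obtain ⟨S, hS1, hS2⟩ := ih hp2 h6
    obtain ⟨r, hr⟩ := h.length_le hs hp1 h1 h2
    refine ⟨insert r S, (Finset.card_insert_le r S).trans (by omega), ?_⟩
    rw [h0, List.count_append]
    have h7 : runCount s r p p' + ∑ r ∈ S, runCount s r p' M ≤
        ∑ r ∈ insert r S, runCount s r p M := by
      by_cases hrS : r ∈ S
      · rw [Finset.insert_eq_of_mem hrS, ← Finset.add_sum_erase _ _ hrS,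
          ← Finset.add_sum_erase (a := r) _ (fun r => runCount s r p M) hrS, ← Nat.add_assoc,
          runCount_add s r hp1 hp2]
        exact Nat.add_le_add_left (Finset.sum_le_sum fun r _ => runCount_mono s r hp1 le_rfl) _
      · rw [Finset.sum_insert hrS]
        exact Nat.add_le_add (runCount_mono s r le_rfl hp2)
          (Finset.sum_le_sum fun r _ => runCount_mono s r hp1 le_rfl)
    omega

/-- Any `j` runs have at most the total length of the `j` rightmost ones. -/
theorem Settled.sum_runCount_le {s : State n} (hs : Function.Injective s) (h : Settled s)
    (M j : ℕ) {S : Finset ℕ} (hS : S.card ≤ j) :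
    ∑ r ∈ S, runCount s r 0 M ≤ topSum s j := by
  have h1 : ∀ r, runCount s r 0 M ≤ (runAt s r).length := fun r => by
    rw [length_runAt]
    exact Finset.card_le_card fun c hc => by
      simp only [Finset.mem_filter, Finset.mem_univ, true_and] at hc ⊢
      exact hc.1
  refine (Finset.sum_le_sum fun r _ => h1 r).trans ?_
  set k := numRuns s with hk
  set T := Finset.Ioc (k - j) k with hT
  change _ ≤ ∑ r ∈ T, (runAt s r).length
  have h0 : ∀ r, k < r → (runAt s r).length = 0 := fun r hr => by
    rw [List.length_eq_zero_iff, List.eq_nil_iff_forall_not_mem]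
    intro b hb
    have := runIndex_le_numRuns s b
    rw [mem_runAt.1 hb] at this
    omega
  have h00 : (runAt s 0).length = 0 := by
    rw [List.length_eq_zero_iff, List.eq_nil_iff_forall_not_mem]
    intro b hb
    have := runIndex_pos hs b
    rw [mem_runAt.1 hb] at this
    omega
  have e1 : ∑ r ∈ S \ T, (runAt s r).length ≤ (S \ T).card * (runAt s (k - j)).length := by
    rw [← smul_eq_mul]
    refine Finset.sum_le_card_nsmul _ _ _ fun r hr => ?_
    rw [Finset.mem_sdiff, hT, Finset.mem_Ioc] at hr
    by_cases hrk : k < r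
    · rw [h0 r hrk]; exact Nat.zero_le _
    · exact h.length_mono hs (by omega) (by omega)
  have e2 : (T \ S).card * (runAt s (k - j)).length ≤ ∑ r ∈ T \ S, (runAt s r).length := by
    rw [← smul_eq_mul]
    refine Finset.card_nsmul_le_sum _ _ _ fun r hr => ?_
    rw [Finset.mem_sdiff, hT, Finset.mem_Ioc] at hr
    exact h.length_mono hs (by omega) (by omega)
  have e3 : (S \ T).card * (runAt s (k - j)).length ≤ (T \ S).card * (runAt s (k - j)).length := by
    by_cases hkj : k ≤ j
    · rw [Nat.sub_eq_zero_of_le hkj, h00]; simp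
    · refine Nat.mul_le_mul_right _ ?_
      have hTc : T.card = j := by rw [hT, Nat.card_Ioc]; omega
      have := Finset.card_sdiff_add_card_inter S T
      have := Finset.card_sdiff_add_card_inter T S
      rw [Finset.inter_comm] at this
      omega
  rw [← Finset.sum_inter_add_sum_sdiff S T, ← Finset.sum_inter_add_sum_sdiff T S,
    Finset.inter_comm T S]
  omega

/-- A chain in a word which begins with letters `n` either does not use them, or is bound to choose
only letters `n` up to the next cut. -/
theorem SegChain.of_replicate {Y : List ℕ} {A v j m : ℕ}
    (h : SegChain (List.replicate A n ++ Y) v j m) :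
    SegChain Y v j m ∨ ∃ m', SegChain Y n j m' ∧ m ≤ A + m' := by
  generalize hw : List.replicate A n ++ Y = w at h
  induction h generalizing A with
  | nil v j =>
    obtain ⟨-, rfl⟩ := List.append_eq_nil_iff.1 hw
    exact Or.inl (nil _ _)
  | @skip x w v j m h ih =>
    cases A with
    | zero =>
      rw [List.replicate_zero, List.nil_append] at hw
      exact Or.inl (hw ▸ h.skip)
    | succ A =>
      rw [List.replicate_succ, List.cons_append] at hw
      obtain ⟨rfl, rfl⟩ := List.cons.inj hw
      rcases ih rfl with h | ⟨m', h1, h2⟩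
      · exact Or.inl h
      · exact Or.inr ⟨m', h1, by omega⟩
  | @pick x w v j m hx h ih =>
    cases A with
    | zero =>
      rw [List.replicate_zero, List.nil_append] at hw
      exact Or.inl (hw ▸ h.pick hx)
    | succ A =>
      rw [List.replicate_succ, List.cons_append] at hw
      obtain ⟨rfl, rfl⟩ := List.cons.inj hw
      rcases ih rfl with h | ⟨m', h1, h2⟩
      · exact Or.inr ⟨m, h, by omega⟩
      · exact Or.inr ⟨m', h1, by omega⟩
  | cut h ih =>
    rcases ih hw with h | ⟨m', h1, h2⟩
    · exact Or.inl h.cut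
    · exact Or.inr ⟨m', h1.add_cut n, h2⟩

theorem count_letters_eq_sum (s : State n) {a b : ℕ} (hab : a ≤ b) :
    (letters s a b).count n = ∑ p ∈ Finset.Ico a b, if letter s p = n then 1 else 0 := by
  induction b, hab using Nat.le_induction with
  | base => simp [letters_self]
  | succ b hab ih =>
    rw [letters_succ s hab, List.count_append, ih, Finset.sum_Ico_succ_top hab,
      List.count_singleton]
    simp

theorem count_letters {s : State n} (hs : Function.Injective s) {M : ℕ} (hM : ∀ b, s b < M) :
    (letters s 0 M).count n = M - n := by
  have h := sum_empty_or hs hM (fun _ => False)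
  simp only [or_false, Finset.filter_false, Finset.card_empty, Nat.add_zero] at h
  rw [← h, count_letters_eq_sum s (Nat.zero_le M)]

theorem le_of_injective {s : State n} (hs : Function.Injective s) {M : ℕ} (hM : ∀ b, s b < M) :
    n ≤ M := by
  have := Fintype.card_le_of_injective (fun b => (⟨s b, hM b⟩ : Fin M))
    (fun a b h => hs (by simpa using h))
  simpa using this

/-- The upper bound for chains in cut words of settled states. The letters `n` in front, at least as
many as there are balls, make it optimal to choose them, whence the balls up to the first cut are
lost and only `j` segments remain for the runs. -/
theorem Settled.le_topSum {s : State n} (hs : Function.Injective s) (h : Settled s) {M A j m : ℕ}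
    (hM : ∀ b, s b < M) (hA : n ≤ A)
    (hm : SegChain (List.replicate A n ++ letters s 0 M) 0 j m) :
    m ≤ A + ((M - n) + topSum s j) := by
  have hnM := le_of_injective hs hM
  rcases hm.of_replicate with h1 | ⟨m', h1, h2⟩
  · -- without the letters `n` in front, at most all the other `M ≤ A + (M - n)` letters are chosen
    have := h1.le_length
    rw [letters_length] at this
    omega
  · obtain ⟨u₁, u₂, V, m'', k0, k1, -, k3, k4, k5⟩ := h1.firstSeg
    obtain ⟨p, -, hp, rfl, rfl⟩ := letters_split (Nat.zero_le M) k0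
    have hV : V.length ≤ (letters s 0 p).count n := by
      have : V.count n = V.length := List.count_eq_length.2 fun x hx => by
        have := lt_succ_of_mem_letters (k1.subset hx)
        have := k3 x hx
        omega
      rw [← this]
      exact k1.count_le n
    have hcount := count_letters hs hM
    rw [k0, List.count_append] at hcount
    rcases k5 with ⟨-, rfl, -⟩ | ⟨j', rfl, k6⟩
    · omega
    · obtain ⟨S, hS1, hS2⟩ := h.segChain_le hs hp k6
      have h3 := h.sum_runCount_le hs M (j' + 1) hS1
      have h4 : ∑ r ∈ S, runCount s r p M ≤ ∑ r ∈ S, runCount s r 0 M :=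
        Finset.sum_le_sum fun r _ => runCount_mono s r (Nat.zero_le _) le_rfl
      omega

/-! ### From the initial state to a settled state -/

/-- Every move passes `n + 1` empty boxes from the left end of the word to the right end. -/
theorem segChain_iterate {s : State n} (hs : Function.Injective s) {M : ℕ} (t : ℕ)
    (hM : ∀ i ≤ t, ∀ b, bbsMove^[i] s b < M) (A j m : ℕ) :
    SegChain (List.replicate (A + t * (n + 1)) n ++ letters s 0 M) 0 j m ↔
      SegChain (List.replicate A n ++ letters (bbsMove^[t] s) 0 (M + t * (n + 1))) 0 j m := by
  induction t generalizing A with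
  | zero => simp
  | succ t ih =>
    have e : A + (t + 1) * (n + 1) = (A + (n + 1)) + t * (n + 1) := by ring
    rw [e, ih (fun i hi => hM i (by omega)), segChain_bbsMove (iterate_injective hs t)]
    · rw [← Function.iterate_succ_apply' bbsMove t s, Nat.add_assoc M, ← Nat.succ_mul]
    · intro b
      have := hM (t + 1) le_rfl b
      rw [Function.iterate_succ_apply'] at this
      omega

theorem natWord_eq_letters (w : Equiv.Perm (Fin n)) :
    natWord w = letters (initialState w) 0 n := by
  have hs := initialState_injective w
  rw [natWord, letters]
  refine List.ext_getElem (by simp) fun i h1 h2 => ?_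
  simp only [List.length_map, List.length_finRange] at h1
  simp only [List.getElem_map, List.getElem_finRange, List.getElem_range']
  symm
  rw [letter_eq_iff hs]
  simp [initialState]

theorem SegChain.append_replicate {u : List ℕ} {v j m : ℕ} (h : SegChain u v j m)
    (hu : ∀ x ∈ u, x ≤ n) (hv : v ≤ n) (B : ℕ) :
    SegChain (u ++ List.replicate B n) v j (m + B) := by
  induction h with
  | nil v j =>
    have := segChain_replicate (n := n) B (SegChain.nil n j)
    rw [List.append_nil, Nat.add_comm] at this
    exact this.mono_floor hv
  | skip h ih => exact (ih (fun x hx => hu x (by simp [hx])) hv).skip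
  | pick hx h ih =>
    rw [Nat.add_right_comm]
    exact (ih (fun x hx => hu x (by simp [hx])) (hu _ (by simp))).pick hx
  | cut h ih => exact (ih hu (Nat.zero_le _)).cut

/-- The localized version of Greene's theorem for the system of `w`: the total length of the `j`
longest solitons is the maximal size of a chain in the word of `w` cut into `j` pieces. -/
theorem segChain_natWord_iff (w : Equiv.Perm (Fin n)) {t : ℕ} (h : Settled (stateAt w t))
    (j m : ℕ) : SegChain (natWord w) n j m ↔ m ≤ topSum (stateAt w t) j := by
  have hs0 := initialState_injective w
  have hs := stateAt_injective w t
  obtain ⟨M, hM⟩ : ∃ M, ∀ i ≤ t, ∀ b, bbsMove^[i] (initialState w) b < M := by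
    refine ⟨(Finset.range (t + 1)).sup
      (fun i => Finset.univ.sup (bbsMove^[i] (initialState w))) + 1,
      fun i hi b => Nat.lt_succ_of_le ?_⟩
    exact (Finset.le_sup (f := bbsMove^[i] (initialState w)) (Finset.mem_univ b)).trans
      (Finset.le_sup (f := fun i => Finset.univ.sup (bbsMove^[i] (initialState w)))
        (Finset.mem_range.2 (by omega)))
  have hM0 : ∀ b, initialState w b < M := hM 0 (Nat.zero_le t)
  have hnM : n ≤ M := le_of_injective hs0 hM0
  have hMt : ∀ b, stateAt w t b < M + t * (n + 1) := fun b =>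
    lt_of_lt_of_le (hM t le_rfl b) (Nat.le_add_right _ _)
  have hword : letters (initialState w) 0 M = natWord w ++ List.replicate (M - n) n := by
    rw [← letters_append _ (Nat.zero_le n) hnM, ← natWord_eq_letters,
      letters_eq_replicate (s := initialState w) fun b => (w.symm b).2]
  have hlt : ∀ x ∈ natWord w, x ≤ n := fun x hx => (lt_of_mem_natWord hx).le
  have hit := fun m => segChain_iterate hs0 t hM n j m
  rw [hword] at hit
  constructor
  · intro hm
    have h1 := (segChain_replicate (n + t * (n + 1))
      (hm.append_replicate hlt le_rfl (M - n))).mono_floor (Nat.zero_le n)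
    have h2 := h.le_topSum hs hMt le_rfl ((hit _).1 h1)
    omega
  · intro hm
    refine SegChain.mono_count ?_ hm
    have h1 := (hit _).2 ((segChain_topSum hs hMt n j).mono_floor (Nat.zero_le n))
    rcases h1.of_replicate with h2 | ⟨m', h2, h3⟩
    · have h3 := h2.le_length
      rw [List.length_append, natWord_length, List.length_replicate] at h3
      have h4 : topSum (stateAt w t) j = 0 := by omega
      rw [h4]
      have := (SegChain.nil n j).append_left (natWord w)
      rwa [List.append_nil] at this
    · obtain ⟨m'', h4, h5⟩ := h2.truncate
      rw [List.length_replicate] at h5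
      exact h4.mono_count (by omega)

/-! ### Knuth equivalence and Greene's invariants -/

/-- The elementary Knuth transformations. -/
inductive KnuthStep : List (Fin n) → List (Fin n) → Prop
  | swap_left (a b : List (Fin n)) {x y z : Fin n} (hxy : x < y) (hyz : y < z) :
      KnuthStep (a ++ x :: z :: y :: b) (a ++ z :: x :: y :: b)
  | swap_right (a b : List (Fin n)) {x y z : Fin n} (hxy : x < y) (hyz : y < z) :
      KnuthStep (a ++ y :: x :: z :: b) (a ++ y :: z :: x :: b)

/-- Knuth equivalence of words. -/
def Knuth (u v : List (Fin n)) : Prop := Relation.EqvGen KnuthStep u v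

theorem KnuthStep.knuth {u v : List (Fin n)} (h : KnuthStep u v) : Knuth u v := .rel _ _ h

theorem Knuth.refl (u : List (Fin n)) : Knuth u u := Relation.EqvGen.refl u

theorem Knuth.of_eq {u v : List (Fin n)} (h : u = v) : Knuth u v := h ▸ Relation.EqvGen.refl u

theorem Knuth.symm {u v : List (Fin n)} (h : Knuth u v) : Knuth v u := Relation.EqvGen.symm _ _ h

theorem Knuth.trans {u v v' : List (Fin n)} (h : Knuth u v) (h' : Knuth v v') : Knuth u v' :=
  Relation.EqvGen.trans _ _ _ h h'

theorem Knuth.lift {f : List (Fin n) → List (Fin n)}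
    (hf : ∀ u v, KnuthStep u v → Knuth (f u) (f v)) {u v : List (Fin n)} (h : Knuth u v) :
    Knuth (f u) (f v) := by
  induction h with
  | rel u v h => exact hf u v h
  | refl u => exact .refl _
  | symm u v _ ih => exact ih.symm
  | trans u v v' _ _ ih ih' => exact ih.trans ih'

theorem Knuth.append_left (a : List (Fin n)) {u v : List (Fin n)} (h : Knuth u v) :
    Knuth (a ++ u) (a ++ v) := by
  refine h.lift (f := fun u => a ++ u) fun u v h => ?_
  cases h with
  | swap_left a' b hxy hyz => simpa using (KnuthStep.swap_left (a ++ a') b hxy hyz).knuth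
  | swap_right a' b hxy hyz => simpa using (KnuthStep.swap_right (a ++ a') b hxy hyz).knuth

theorem Knuth.append_right (b : List (Fin n)) {u v : List (Fin n)} (h : Knuth u v) :
    Knuth (u ++ b) (v ++ b) := by
  refine h.lift (f := fun u => u ++ b) fun u v h => ?_
  cases h with
  | swap_left a b' hxy hyz => simpa using (KnuthStep.swap_left a (b' ++ b) hxy hyz).knuth
  | swap_right a b' hxy hyz => simpa using (KnuthStep.swap_right a (b' ++ b) hxy hyz).knuth

theorem Knuth.cons (a : Fin n) {u v : List (Fin n)} (h : Knuth u v) : Knuth (a :: u) (a :: v) :=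
  h.append_left [a]

theorem Knuth.reverse {u v : List (Fin n)} (h : Knuth u v) : Knuth u.reverse v.reverse := by
  refine h.lift (f := List.reverse) fun u v h => ?_
  cases h with
  | swap_left a b hxy hyz =>
    simpa using (KnuthStep.swap_right b.reverse a.reverse hxy hyz).knuth.symm
  | swap_right a b hxy hyz =>
    simpa using (KnuthStep.swap_left b.reverse a.reverse hxy hyz).knuth.symm

/-- Knuth equivalence is inherited by the subwords of the small letters. -/
theorem Knuth.filter_lt (N : ℕ) {u v : List (Fin n)} (h : Knuth u v) :
    Knuth (u.filter (fun x => decide (x.val < N))) (v.filter (fun x => decide (x.val < N))) := by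
  refine h.lift (f := List.filter _) fun u v h => ?_
  cases h with
  | @swap_left a b x y z hxy hyz =>
    by_cases hz : z.val < N
    · have hy : y.val < N := lt_trans hyz hz
      have hx : x.val < N := lt_trans hxy hy
      simpa [hx, hy, hz] using (KnuthStep.swap_left _ _ hxy hyz).knuth
    · exact Knuth.of_eq (by simp [List.filter_cons, hz])
  | @swap_right a b x y z hxy hyz =>
    by_cases hz : z.val < N
    · have hy : y.val < N := lt_trans hyz hz
      have hx : x.val < N := lt_trans hxy hy
      simpa [hx, hy, hz] using (KnuthStep.swap_right _ _ hxy hyz).knuth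
    · exact Knuth.of_eq (by simp [List.filter_cons, hz])

theorem KnuthStep.perm {u v : List (Fin n)} (h : KnuthStep u v) : u.Perm v := by
  cases h with
  | swap_left a b hxy hyz => exact (List.Perm.swap _ _ _).append_left a
  | swap_right a b hxy hyz => exact ((List.Perm.swap _ _ _).cons _).append_left a

theorem Knuth.perm {u v : List (Fin n)} (h : Knuth u v) : u.Perm v := by
  induction h with
  | rel u v h => exact h.perm
  | refl u => exact .refl _
  | symm u v _ ih => exact ih.symm
  | trans u v v' _ _ ih ih' => exact ih.trans ih'

/-- `u` contains `k` disjoint increasing subsequences of total length at least `m`. They are encoded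
by a colouring `c` of the letters, the letters of colour `≥ k` being those which are not used.
Applied to the reverse of a word this describes decreasing subsequences. -/
def HasInc (k : ℕ) (u : List (Fin n)) (m : ℕ) : Prop :=
  ∃ c : Fin n → ℕ, u.Pairwise (fun x y => c x < k → c x = c y → x < y) ∧
    m ≤ u.countP (fun x => decide (c x < k))

theorem HasInc.mono {k m m' : ℕ} {u : List (Fin n)} (h : HasInc k u m) (hm : m' ≤ m) :
    HasInc k u m' := by
  obtain ⟨c, h1, h2⟩ := h
  exact ⟨c, h1, hm.trans h2⟩

/-- The letters of a word of the form `a ++ v ++ b`, where `v` consists of three letters `x, y, z`,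
can be recoloured by prescribing the colours of `x, y, z` and by applying a map `f` to the colours
of the letters of `b`. -/
theorem exists_recolouring {k : ℕ} {x y z : Fin n} {a b v v' : List (Fin n)}
    (hv : v.Perm [x, y, z]) (hv' : v'.Perm v)
    (hnd : (a ++ (v ++ b)).Nodup) (c : Fin n → ℕ) (X Y Z : ℕ) (f : ℕ → ℕ)
    (hf : ∀ i, f i < k ↔ i < k)
    (hcount : [c x, c y, c z].countP (fun i => decide (i < k)) =
      [X, Y, Z].countP (fun i => decide (i < k))) :
    ∃ c' : Fin n → ℕ, c' x = X ∧ c' y = Y ∧ c' z = Z ∧ (∀ t ∈ a, c' t = c t) ∧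
      (∀ t ∈ b, c' t = f (c t)) ∧ (a ++ (v ++ b)).countP (fun t => decide (c t < k)) =
        (a ++ (v' ++ b)).countP (fun t => decide (c' t < k)) := by
  have hnd' : (a ++ ([x, y, z] ++ b)).Nodup :=
    ((hv.append_right b).append_left a).nodup_iff.1 hnd
  simp only [List.cons_append, List.nil_append, List.nodup_append, List.nodup_cons, List.mem_cons,
    not_or] at hnd'
  obtain ⟨-, ⟨⟨hxy, hxz, hxb⟩, ⟨hyz, hyb⟩, hzb, -⟩, hab⟩ := hnd'
  have hb : ∀ t ∈ b, t ≠ x ∧ t ≠ y ∧ t ≠ z := fun t ht =>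
    ⟨fun h => hxb (h ▸ ht), fun h => hyb (h ▸ ht), fun h => hzb (h ▸ ht)⟩
  have ha : ∀ t ∈ a, t ≠ x ∧ t ≠ y ∧ t ≠ z ∧ t ∉ b := fun t ht =>
    ⟨hab t ht x (by simp), hab t ht y (by simp), hab t ht z (by simp),
      fun h => hab t ht t (by simp [h]) rfl⟩
  let c' : Fin n → ℕ := fun t => if t = x then X else if t = y then Y else if t = z then Z else
    if t ∈ b then f (c t) else c t
  have h1 : c' x = X := by simp [c']
  have h2 : c' y = Y := by simp [c', Ne.symm hxy]
  have h3 : c' z = Z := by simp [c', Ne.symm hxz, Ne.symm hyz]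
  have h4 : ∀ t ∈ a, c' t = c t := fun t ht => by
    obtain ⟨e1, e2, e3, e4⟩ := ha t ht
    simp [c', e1, e2, e3, e4]
  have h5 : ∀ t ∈ b, c' t = f (c t) := fun t ht => by
    obtain ⟨e1, e2, e3⟩ := hb t ht
    simp [c', e1, e2, e3, ht]
  refine ⟨c', h1, h2, h3, h4, h5, ?_⟩
  rw [List.countP_append, List.countP_append, List.countP_append, List.countP_append,
    hv.countP_eq, (hv'.trans hv).countP_eq]
  congr 1
  · exact List.countP_congr fun t ht => by rw [h4 t ht]
  congr 1
  · simpa [List.countP_cons, h1, h2, h3] using hcount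
  · exact List.countP_congr fun t ht => by rw [h5 t ht]; simpa using (hf _).symm

/-- The map which interchanges `i` and `j`. -/
def swapColour (i j t : ℕ) : ℕ := if t = i then j else if t = j then i else t

/-- Invariance under the first Knuth transformation. A colouring of one word fits the other one
unless `x` and `z` have the same colour. -/
theorem HasInc.of_swap_left {k m : ℕ} {a b : List (Fin n)} {x y z : Fin n} (hxy : x < y)
    (hyz : y < z) (hnd : (a ++ x :: z :: y :: b).Nodup) :
    HasInc k (a ++ x :: z :: y :: b) m ↔ HasInc k (a ++ z :: x :: y :: b) m := by
  have hperm : (a ++ x :: z :: y :: b).Perm (a ++ z :: x :: y :: b) :=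
    (KnuthStep.swap_left a b hxy hyz).perm
  have hv : [x, z, y].Perm [x, y, z] := (List.Perm.swap _ _ _).cons _
  have hv' : [z, x, y].Perm [x, z, y] := List.Perm.swap _ _ _
  constructor
  · rintro ⟨c, h1, h2⟩
    by_cases hc : c x = c z ∧ c x < k
    · have hcy : c y ≠ c x := by
        simp only [List.pairwise_append, List.pairwise_cons, List.mem_cons] at h1
        grind
      by_cases hyk : c y < k
      · -- the tails of the chains through `z` and through `y` are interchanged
        obtain ⟨c', e1, e2, e3, e4, e5, e6⟩ := exists_recolouring (k := k) hv hv' hnd c (c x) (c x)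
          (c y) (swapColour (c x) (c y)) (fun i => by unfold swapColour; grind)
          (by simp [← hc.1, hc.2, hyk])
        refine ⟨c', ?_, h2.trans e6.le⟩
        simp only [List.pairwise_append, List.pairwise_cons, List.mem_cons] at h1 ⊢
        obtain ⟨ha, ⟨hx, hz, hy, hb⟩, hab⟩ := h1
        refine ⟨ha.imp_of_mem fun {p q} hp hq h => by rwa [e4 p hp, e4 q hq], ⟨?_, ?_, ?_,
          hb.imp_of_mem fun {p q} hp hq h => by
            rw [e5 p hp, e5 q hq]; unfold swapColour; grind⟩, ?_⟩
        · unfold swapColour at e5; grind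
        · unfold swapColour at e5; grind
        · unfold swapColour at e5; grind
        · unfold swapColour at e5; grind
      · -- `y` takes the place of `z`
        obtain ⟨c', e1, e2, e3, e4, e5, e6⟩ := exists_recolouring (k := k) hv hv' hnd c (c x) (c x)
          (c y) id (fun i => Iff.rfl) (by simp [← hc.1, hc.2, hyk])
        refine ⟨c', ?_, h2.trans e6.le⟩
        simp only [List.pairwise_append, List.pairwise_cons, List.mem_cons] at h1 ⊢
        obtain ⟨ha, ⟨hx, hz, hy, hb⟩, hab⟩ := h1
        refine ⟨ha.imp_of_mem fun {p q} hp hq h => by rwa [e4 p hp, e4 q hq], ⟨?_, ?_, ?_,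
          hb.imp_of_mem fun {p q} hp hq h => by
            rw [e5 p hp, e5 q hq]; exact h⟩, ?_⟩
        · grind
        · grind
        · grind
        · grind
    · refine ⟨c, ?_, h2.trans (hperm.countP_eq _).le⟩
      simp only [List.pairwise_append, List.pairwise_cons, List.mem_cons] at h1 ⊢
      grind
  · rintro ⟨c, h1, h2⟩
    refine ⟨c, ?_, h2.trans (hperm.countP_eq _).ge⟩
    simp only [List.pairwise_append, List.pairwise_cons, List.mem_cons] at h1 ⊢
    grind

/-- Invariance under the second Knuth transformation, in the same way. -/
theorem HasInc.of_swap_right {k m : ℕ} {a b : List (Fin n)} {x y z : Fin n} (hxy : x < y)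
    (hyz : y < z) (hnd : (a ++ y :: x :: z :: b).Nodup) :
    HasInc k (a ++ y :: x :: z :: b) m ↔ HasInc k (a ++ y :: z :: x :: b) m := by
  have hperm : (a ++ y :: x :: z :: b).Perm (a ++ y :: z :: x :: b) :=
    (KnuthStep.swap_right a b hxy hyz).perm
  have hv : [y, x, z].Perm [x, y, z] := List.Perm.swap _ _ _
  have hv' : [y, z, x].Perm [y, x, z] := (List.Perm.swap _ _ _).cons _
  constructor
  · rintro ⟨c, h1, h2⟩
    by_cases hc : c x = c z ∧ c x < k
    · have hcy : c y ≠ c x := by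
        simp only [List.pairwise_append, List.pairwise_cons, List.mem_cons] at h1
        grind
      by_cases hyk : c y < k
      · -- the tails of the chains through `z` and through `y` are interchanged
        obtain ⟨c', e1, e2, e3, e4, e5, e6⟩ := exists_recolouring (k := k) hv hv' hnd c (c x) (c y)
          (c y) (swapColour (c x) (c y)) (fun i => by unfold swapColour; grind)
          (by simp [← hc.1, hc.2, hyk])
        refine ⟨c', ?_, h2.trans e6.le⟩
        simp only [List.pairwise_append, List.pairwise_cons, List.mem_cons] at h1 ⊢
        obtain ⟨ha, ⟨hy, hx, hz, hb⟩, hab⟩ := h1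
        refine ⟨ha.imp_of_mem fun {p q} hp hq h => by rwa [e4 p hp, e4 q hq], ⟨?_, ?_, ?_,
          hb.imp_of_mem fun {p q} hp hq h => by
            rw [e5 p hp, e5 q hq]; unfold swapColour; grind⟩, ?_⟩
        · unfold swapColour at e5; grind
        · unfold swapColour at e5; grind
        · unfold swapColour at e5; grind
        · unfold swapColour at e5; grind
      · -- `y` takes the place of `x`
        obtain ⟨c', e1, e2, e3, e4, e5, e6⟩ := exists_recolouring (k := k) hv hv' hnd c (c y) (c x)
          (c x) id (fun i => Iff.rfl) (by simp [← hc.1, hc.2, hyk])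
        refine ⟨c', ?_, h2.trans e6.le⟩
        simp only [List.pairwise_append, List.pairwise_cons, List.mem_cons] at h1 ⊢
        obtain ⟨ha, ⟨hy, hx, hz, hb⟩, hab⟩ := h1
        refine ⟨ha.imp_of_mem fun {p q} hp hq h => by rwa [e4 p hp, e4 q hq], ⟨?_, ?_, ?_,
          hb.imp_of_mem fun {p q} hp hq h => by
            rw [e5 p hp, e5 q hq]; exact h⟩, ?_⟩
        · grind
        · grind
        · grind
        · grind
    · refine ⟨c, ?_, h2.trans (hperm.countP_eq _).le⟩
      simp only [List.pairwise_append, List.pairwise_cons, List.mem_cons] at h1 ⊢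
      grind
  · rintro ⟨c, h1, h2⟩
    refine ⟨c, ?_, h2.trans (hperm.countP_eq _).ge⟩
    simp only [List.pairwise_append, List.pairwise_cons, List.mem_cons] at h1 ⊢
    grind

theorem KnuthStep.hasInc_iff {u v : List (Fin n)} (h : KnuthStep u v) (hu : u.Nodup) (k m : ℕ) :
    HasInc k u m ↔ HasInc k v m := by
  cases h with
  | swap_left a b hxy hyz => exact HasInc.of_swap_left hxy hyz hu
  | swap_right a b hxy hyz => exact HasInc.of_swap_right hxy hyz hu

theorem Knuth.hasInc_iff {u v : List (Fin n)} (h : Knuth u v) (hu : u.Nodup) (k m : ℕ) :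
    HasInc k u m ↔ HasInc k v m := by
  induction h with
  | rel u v h => exact h.hasInc_iff hu k m
  | refl u => exact Iff.rfl
  | symm u v h ih => exact (ih ((Knuth.perm h).nodup_iff.2 hu)).symm
  | trans u v v' h h' ih ih' => exact (ih hu).trans (ih' ((Knuth.perm h).nodup_iff.1 hu))

/-- An increasing and a decreasing subsequence have at most one letter in common. -/
theorem HasInc.add_le {j k m m' : ℕ} {u : List (Fin n)} (hu : u.Nodup) (h : HasInc j u m)
    (h' : HasInc k u.reverse m') : m + m' ≤ u.length + j * k := by
  obtain ⟨c, h1, h2⟩ := h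
  obtain ⟨d, h3, h4⟩ := h'
  rw [List.pairwise_reverse] at h3
  rw [List.countP_reverse] at h4
  set A := u.toFinset.filter (fun x => c x < j)
  set B := u.toFinset.filter (fun x => d x < k)
  have hA : A.card = u.countP (fun x => decide (c x < j)) := by
    rw [List.countP_eq_length_filter, ← List.toFinset_card_of_nodup (hu.filter _),
      List.toFinset_filter]
    simp [A]
  have hB : B.card = u.countP (fun x => decide (d x < k)) := by
    rw [List.countP_eq_length_filter, ← List.toFinset_card_of_nodup (hu.filter _),
      List.toFinset_filter]
    simp [B]
  have hAB : (A ∪ B).card ≤ u.length := by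
    rw [← List.toFinset_card_of_nodup hu]
    exact Finset.card_le_card
      (Finset.union_subset (Finset.filter_subset _ _) (Finset.filter_subset _ _))
  have hI : (A ∩ B).card ≤ (Finset.range j ×ˢ Finset.range k).card := by
    refine Finset.card_le_card_of_injOn (fun x => (c x, d x)) (fun x hx => ?_) fun x hx y hy e => ?_
    · simp only [A, B, Finset.coe_inter, Set.mem_inter_iff, Finset.mem_coe, Finset.mem_filter] at hx
      simp [hx.1.2, hx.2.2]
    · simp only [A, B, Finset.coe_inter, Set.mem_inter_iff, Finset.mem_coe, Finset.mem_filter,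
        List.mem_toFinset] at hx hy
      simp only [Prod.mk.injEq] at e
      have key := List.Pairwise.forall_of_forall_of_flip (l := u)
        (R := fun x y => c x = c y → d x = d y → c x < j → d x < k → x = y) (by simp)
        ((h1.and h3).imp fun {p q} h => by grind) ((h1.and h3).imp fun {p q} h => by
          simp only [flip]; grind)
      exact key hx.1.1 hy.1.1 e.1 e.2 hx.1.2 hx.2.2
  rw [Finset.card_product, Finset.card_range, Finset.card_range] at hI
  have := Finset.card_union_add_card_inter A B
  omega

/-! ### Partitions given by the sums of their largest parts -/

theorem sum_take_add_sum_min_le (l : List ℕ) (j k : ℕ) :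
    (l.take j).sum + (l.map (min k)).sum ≤ l.sum + j * k := by
  induction l generalizing j with
  | nil => simp
  | cons a l ih =>
    cases j with
    | zero =>
      have := ih 0
      simp only [List.take_zero, List.sum_nil, List.map_cons, List.sum_cons] at this ⊢
      omega
    | succ j =>
      have := ih j
      simp only [List.take_succ_cons, List.map_cons, List.sum_cons, Nat.succ_mul] at this ⊢
      omega

theorem sum_take_add_sum_min_eq {l : List ℕ} {j k : ℕ} (h1 : ∀ x ∈ l.take j, k ≤ x)
    (h2 : ∀ x ∈ l.drop j, x ≤ k) (hj : j ≤ l.length) :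
    (l.take j).sum + (l.map (min k)).sum = l.sum + j * k := by
  have e1 : ((l.take j).map (min k)).sum = j * k := by
    rw [List.map_congr_left (g := fun _ => k) fun x hx => min_eq_left (h1 x hx)]
    simp [hj]
  have e2 : (l.drop j).map (min k) = l.drop j := by
    exact (List.map_congr_left fun x hx => min_eq_right (h2 x hx)).trans (List.map_id' _)
  have e3 : l.map (min k) = (l.take j).map (min k) ++ (l.drop j).map (min k) := by
    rw [← List.map_append, List.take_append_drop]
  have e4 := List.sum_take_add_sum_drop l j
  rw [e3, List.sum_append, e1, e2]
  omega

/-- For every number of parts there is a number of columns for which the two sums are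
complementary. -/
theorem exists_sum_min_eq {l : List ℕ} (hl : l.Pairwise (· ≥ ·)) (j : ℕ) :
    ∃ k, (l.take j).sum + (l.map (min k)).sum = l.sum + j * k := by
  rcases le_total l.length j with hj | hj
  · refine ⟨0, ?_⟩
    rw [List.take_of_length_le hj, List.map_congr_left (g := fun _ => 0) fun x _ => Nat.zero_min x]
    simp
  · refine ⟨(l.drop j).headD 0, sum_take_add_sum_min_eq ?_ ?_ hj⟩
    · intro x hx
      cases h : l.drop j with
      | nil => simp
      | cons a t =>
        exact hl.rel_of_mem_take_of_mem_drop hx (by rw [h]; simp)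
    · intro x hx
      have hd : (l.drop j).Pairwise (· ≥ ·) := hl.sublist (List.drop_sublist j l)
      cases h : l.drop j with
      | nil => rw [h] at hx; simp at hx
      | cons a t =>
        rw [h] at hd hx
        rcases List.mem_cons.1 hx with rfl | hx
        · exact le_rfl
        · exact (List.pairwise_cons.1 hd).1 x hx

/-- For every number of columns there is a number of parts for which the two sums are
complementary. -/
theorem exists_sum_take_eq {l : List ℕ} (hl : l.Pairwise (· ≥ ·)) (k : ℕ) :
    ∃ j, (l.take j).sum + (l.map (min k)).sum = l.sum + j * k := by
  induction l with
  | nil => exact ⟨0, by simp⟩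
  | cons a l ih =>
    rw [List.pairwise_cons] at hl
    by_cases h : k ≤ a
    · obtain ⟨j, hj⟩ := ih hl.2
      refine ⟨j + 1, ?_⟩
      simp only [List.take_succ_cons, List.map_cons, List.sum_cons, Nat.succ_mul]
      omega
    · refine ⟨0, sum_take_add_sum_min_eq (by simp) (fun x hx => ?_) (Nat.zero_le _)⟩
      rw [List.drop_zero] at hx
      rcases List.mem_cons.1 hx with rfl | hx
      · omega
      · exact (hl.1 x hx).trans (by omega)

/-- The sums of the largest parts are determined by the sums over the first columns: the first is
the minimum over `k` of `l.sum + j * k` minus the second. -/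
theorem sum_take_le_of_sum_min_le {l l' : List ℕ} (hl : l.Pairwise (· ≥ ·)) (hsum : l'.sum = l.sum)
    (h : ∀ k, (l.map (min k)).sum ≤ (l'.map (min k)).sum) (j : ℕ) :
    (l'.take j).sum ≤ (l.take j).sum := by
  obtain ⟨k, hk⟩ := exists_sum_min_eq hl j
  have := sum_take_add_sum_min_le l' j k
  have := h k
  omega

theorem eq_of_sum_take_eq {l l' : List ℕ} (hl : ∀ x ∈ l, 0 < x) (hl' : ∀ x ∈ l', 0 < x)
    (h : ∀ j, 1 ≤ j → (l.take j).sum = (l'.take j).sum) : l = l' := by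
  induction l generalizing l' with
  | nil =>
    cases l' with
    | nil => rfl
    | cons a l' =>
      have := h 1 le_rfl
      have := hl' a (by simp)
      simp at *
      omega
  | cons b l ih =>
    cases l' with
    | nil =>
      have := h 1 le_rfl
      have := hl b (by simp)
      simp at *
      omega
    | cons a l' =>
      have h1 := h 1 le_rfl
      simp only [List.take_succ_cons, List.take_zero, List.sum_cons, List.sum_nil,
        Nat.add_zero] at h1
      subst h1
      rw [ih (l' := l') (fun x hx => hl x (by simp [hx])) (fun x hx => hl' x (by simp [hx]))
        fun j _ => ?_]
      have := h (j + 1) (by omega)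
      simpa using this

/-! ### Tableaux -/

/-- The reading word of a tableau: its rows from bottom to top. -/
def rowWord (T : Tableau n) : List (Fin n) := T.reverse.flatten

theorem rowWord_cons (R : List (Fin n)) (T : Tableau n) : rowWord (R :: T) = rowWord T ++ R := by
  simp [rowWord]

theorem rowWord_perm (T : Tableau n) : (rowWord T).Perm T.flatten :=
  (List.reverse_perm T).flatten

/-- The condition on two rows of a tableau, `R` being the upper one, that the columns increase. -/
def ColLT : List (Fin n) → List (Fin n) → Prop
  | _, [] => True
  | [], _ :: _ => False
  | r :: R, s :: S => r < s ∧ ColLT R S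

theorem colLT_nil (R : List (Fin n)) : ColLT R [] := by cases R <;> trivial

theorem colLT_iff {R S : List (Fin n)} :
    ColLT R S ↔ ∀ (j : ℕ) (hS : j < S.length), ∃ hR : j < R.length, R[j] < S[j] := by
  induction S generalizing R with
  | nil => simp [colLT_nil]
  | cons s S ih =>
    cases R with
    | nil =>
      simp only [ColLT, false_iff, not_forall]
      exact ⟨0, by simp, by simp⟩
    | cons r R =>
      rw [ColLT, ih]
      constructor
      · rintro ⟨h1, h2⟩ j hS
        cases j with
        | zero => exact ⟨by simp, h1⟩
        | succ j =>
          obtain ⟨hR, h⟩ := h2 j (by simpa using hS)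
          exact ⟨by simpa using hR, by simpa using h⟩
      · intro h
        refine ⟨(h 0 (by simp)).2, fun j hS => ?_⟩
        obtain ⟨hR, h⟩ := h (j + 1) (by simpa using hS)
        exact ⟨by simpa using hR, by simpa using h⟩

theorem ColLT.length_le {R S : List (Fin n)} (h : ColLT R S) : S.length ≤ R.length := by
  rw [colLT_iff] at h
  by_contra! hlt
  exact (h R.length hlt).1.ne rfl

theorem ColLT.filter_lt (N : ℕ) {R S : List (Fin n)} (hS : S.Pairwise (· < ·)) (h : ColLT R S) :
    ColLT (R.filter (fun x => decide (x.val < N))) (S.filter (fun x => decide (x.val < N))) := by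
  induction S generalizing R with
  | nil => exact colLT_nil _
  | cons s S ih =>
    cases R with
    | nil => exact h.elim
    | cons r R =>
      obtain ⟨h1, h2⟩ := h
      rw [List.pairwise_cons] at hS
      by_cases hs : s.val < N
      · have hr : r.val < N := lt_trans h1 hs
        simpa [List.filter_cons, hs, hr] using ⟨h1, ih hS.2 h2⟩
      · have : (s :: S).filter (fun x => decide (x.val < N)) = [] := by
          rw [List.filter_eq_nil_iff]
          intro x hx
          rcases List.mem_cons.1 hx with rfl | hx
          · simpa using hs
          · have : s.val < x.val := hS.1 x hx
            simp only [decide_eq_true_eq]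
            omega
        rw [this]
        exact colLT_nil _

/-- Tableaux with distinct entries. In contrast to `IsStandard`, empty rows are allowed and not all
elements of `Fin n` need to occur. -/
def IsPartialTableau (T : Tableau n) : Prop :=
  (∀ R ∈ T, R.Pairwise (· < ·)) ∧ T.Pairwise ColLT ∧ T.flatten.Nodup

theorem IsStandard.isPartialTableau {T : Tableau n} (h : IsStandard T) : IsPartialTableau T :=
  ⟨fun R hR => (h.1 R hR).2, h.2.1.imp colLT_iff.2, h.2.2.nodup_iff.2 (List.nodup_finRange n)⟩

theorem IsPartialTableau.filter_lt (N : ℕ) {T : Tableau n} (h : IsPartialTableau T) :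
    IsPartialTableau (T.map (List.filter (fun x => decide (x.val < N)))) := by
  obtain ⟨h1, h2, h3⟩ := h
  refine ⟨?_, ?_, ?_⟩
  · intro R hR
    obtain ⟨S, hS, rfl⟩ := List.mem_map.1 hR
    exact (h1 S hS).filter _
  · rw [List.pairwise_map]
    exact h2.imp_of_mem fun {R S} _ hS h => h.filter_lt N (h1 S hS)
  · rw [← List.filter_flatten]
    exact h3.filter _

theorem rowWord_filter (p : Fin n → Bool) (T : Tableau n) :
    rowWord (T.map (List.filter p)) = (rowWord T).filter p := by
  rw [rowWord, rowWord, ← List.map_reverse, List.filter_flatten]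

theorem IsPartialTableau.shape_pairwise {T : Tableau n} (h : IsPartialTableau T) :
    (shape T).Pairwise (· ≥ ·) := by
  rw [shape, List.pairwise_map]
  exact h.2.1.imp ColLT.length_le

theorem sum_shape (T : Tableau n) : (shape T).sum = (rowWord T).length := by
  rw [(rowWord_perm T).length_eq, List.length_flatten, shape]

theorem rowWord_nodup_iff (T : Tableau n) : (rowWord T).Nodup ↔ T.flatten.Nodup :=
  (rowWord_perm T).nodup_iff

/-- The rows of a tableau are increasing subsequences of its reading word. -/
theorem hasInc_rowWord {T : Tableau n} (h1 : ∀ R ∈ T, R.Pairwise (· < ·)) (h2 : (rowWord T).Nodup)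
    (k : ℕ) : HasInc k (rowWord T) ((shape T).take k).sum := by
  induction T generalizing k with
  | nil => exact ⟨fun _ => 0, by simp [rowWord], by simp [shape]⟩
  | cons R T ih =>
    cases k with
    | zero => exact ⟨fun _ => 0, List.pairwise_of_forall (by simp), by simp⟩
    | succ k =>
      rw [rowWord_cons] at h2 ⊢
      obtain ⟨h3, h4, h5⟩ := List.nodup_append.1 h2
      obtain ⟨c, h6, h7⟩ := ih (fun R hR => h1 R (by simp [hR])) h3 k
      -- the row `R` gets the colour `k`, and the unused letters the colour `k + 1`
      have hT : ∀ x ∈ rowWord T, x ∉ R := fun x hx hR => h5 x hx x hR rfl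
      obtain ⟨c', h8, h9⟩ : ∃ c' : Fin n → ℕ, (∀ x ∈ R, c' x = k) ∧
          ∀ x ∈ rowWord T, c' x = if c x < k then c x else k + 1 :=
        ⟨fun x => if x ∈ R then k else if c x < k then c x else k + 1,
          fun x hx => by simp [hx], fun x hx => by simp [hT x hx]⟩
      refine ⟨c', ?_, ?_⟩
      · rw [List.pairwise_append]
        refine ⟨h6.imp_of_mem fun {x y} hx hy h => ?_, ?_, ?_⟩
        · rw [h9 x hx, h9 y hy]; grind
        · exact (h1 R (by simp)).imp fun h _ _ => h
        · intro x hx y hy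
          rw [h9 x hx, h8 y hy]; grind
      · rw [List.countP_append, List.countP_eq_length (l := R).2 (fun x hx => by simp [h8 x hx])]
        simp only [shape, List.map_cons, List.take_succ_cons, List.sum_cons]
        rw [Nat.add_comm]
        refine Nat.add_le_add_right (h7.trans (le_of_eq (List.countP_congr fun x hx => ?_))) _
        rw [h9 x hx]
        simp only [decide_eq_true_eq]
        grind

theorem countP_idxOf_lt {R : List (Fin n)} (hR : R.Nodup) (k : ℕ) :
    R.countP (fun x => decide (R.idxOf x < k)) = min k R.length := by
  have h1 : R.countP (fun x => decide (R.idxOf x < k)) =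
      (List.range R.length).countP (fun i => decide (i < k)) := by
    have e : R.map R.idxOf = List.range R.length := by
      refine List.ext_getElem (by simp) fun i h1 h2 => ?_
      simp [hR.idxOf_getElem]
    rw [← e, List.countP_map]
    rfl
  rw [h1]
  generalize R.length = m
  induction m with
  | zero => simp
  | succ m ih =>
    rw [List.range_succ, List.countP_append, ih, List.countP_singleton]
    simp only [decide_eq_true_eq]
    split_ifs <;> omega

/-- The columns of a tableau are decreasing subsequences of its reading word. -/
theorem hasInc_reverse_rowWord {T : Tableau n} (h : IsPartialTableau T) (k : ℕ) :
    HasInc k (rowWord T).reverse ((shape T).map (min k)).sum := by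
  obtain ⟨h1, h2, h3⟩ := h
  obtain ⟨c, hc⟩ : ∃ c : Fin n → ℕ, ∀ R ∈ T, ∀ x ∈ R, c x = R.idxOf x := by
    clear h1 h2
    induction T with
    | nil => exact ⟨fun _ => 0, by simp⟩
    | cons R T ih =>
      rw [List.flatten_cons, List.nodup_append] at h3
      obtain ⟨c, hc⟩ := ih h3.2.1
      refine ⟨fun x => if x ∈ R then R.idxOf x else c x, fun S hS x hx => ?_⟩
      dsimp only
      rcases List.mem_cons.1 hS with rfl | hS
      · rw [if_pos hx]
      · rw [if_neg fun hR => h3.2.2 x hR x (List.mem_flatten.2 ⟨S, hS, hx⟩) rfl, hc S hS x hx]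
  have hnd : ∀ R ∈ T, R.Nodup := fun R hR => (h1 R hR).imp ne_of_lt
  have e : (rowWord T).reverse = (T.map List.reverse).flatten := by
    rw [rowWord, List.reverse_flatten, List.map_reverse, List.reverse_reverse]
  refine ⟨c, ?_, ?_⟩
  · rw [e, List.pairwise_flatten]
    constructor
    · intro R' hR'
      obtain ⟨R, hR, rfl⟩ := List.mem_map.1 hR'
      rw [List.pairwise_reverse]
      refine (h1 R hR).imp_of_mem fun {x y} hx hy hxy _ h => ?_
      rw [hc R hR x hx, hc R hR y hy] at h
      exact absurd (List.idxOf_inj hy |>.1 h).symm hxy.ne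
    · rw [List.pairwise_map]
      refine h2.imp_of_mem fun {R S} hR hS h x hx y hy _ hxy => ?_
      rw [List.mem_reverse] at hx hy
      rw [hc R hR x hx, hc S hS y hy] at hxy
      obtain ⟨h4, h5⟩ := colLT_iff.1 h (S.idxOf y) (List.idxOf_lt_length_iff.2 hy)
      simp only [← hxy, List.getElem_idxOf] at h5
      simpa [hxy] using h5
  · rw [List.countP_reverse, (rowWord_perm T).countP_eq, List.countP_flatten, shape, List.map_map]
    refine le_of_eq (congrArg List.sum (List.map_congr_left fun R hR => ?_))
    rw [Function.comp, ← countP_idxOf_lt (hnd R hR)]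
    exact List.countP_congr fun x hx => by rw [hc R hR x hx]

/-- Greene's theorem: the maximal size of a `k`-increasing subsequence. -/
theorem hasInc_iff_of_knuth {u : List (Fin n)} {T : Tableau n} (hT : IsPartialTableau T)
    (h : Knuth u (rowWord T)) (k m : ℕ) : HasInc k u m ↔ m ≤ ((shape T).take k).sum := by
  have hT' := (rowWord_nodup_iff T).2 hT.2.2
  rw [h.hasInc_iff (h.perm.nodup_iff.2 hT')]
  constructor
  · intro hm
    obtain ⟨d, hd⟩ := exists_sum_min_eq hT.shape_pairwise k
    have := hm.add_le hT' (hasInc_reverse_rowWord hT d)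
    rw [← sum_shape] at this
    omega
  · exact (hasInc_rowWord hT.1 hT' k).mono

/-- Greene's theorem: the maximal size of a `k`-decreasing subsequence. -/
theorem hasInc_reverse_iff_of_knuth {u : List (Fin n)} {T : Tableau n} (hT : IsPartialTableau T)
    (h : Knuth u (rowWord T)) (k m : ℕ) :
    HasInc k u.reverse m ↔ m ≤ ((shape T).map (min k)).sum := by
  have hT' := (rowWord_nodup_iff T).2 hT.2.2
  rw [h.reverse.hasInc_iff (h.reverse.perm.nodup_iff.2 (List.nodup_reverse.2 hT'))]
  constructor
  · intro hm
    obtain ⟨j, hj⟩ := exists_sum_take_eq hT.shape_pairwise k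
    have := (hasInc_rowWord hT.1 hT' j).add_le hT' hm
    rw [← sum_shape] at this
    omega
  · exact (hasInc_reverse_rowWord hT k).mono

/-! ### Uniqueness of the tableau in a Knuth class -/

theorem countP_lt_succ (R : List (Fin n)) (x : Fin n) :
    R.countP (fun y => decide (y.val < x.val + 1)) =
      R.countP (fun y => decide (y.val < x.val)) + R.count x := by
  induction R with
  | nil => simp
  | cons r R ih =>
    simp only [List.countP_cons, List.count_cons, ih, decide_eq_true_eq, beq_iff_eq, Fin.ext_iff]
    split_ifs <;> omega

theorem eq_of_countP_lt_eq {R S : List (Fin n)} (hR : R.Pairwise (· < ·)) (hS : S.Pairwise (· < ·))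
    (h : ∀ N, R.countP (fun y => decide (y.val < N)) = S.countP (fun y => decide (y.val < N))) :
    R = S := by
  refine List.Perm.eq_of_pairwise (fun a b _ _ h h' => absurd h (lt_asymm h')) hR hS ?_
  rw [List.perm_iff_count]
  intro x
  have h1 := h (x.val + 1)
  have h2 := h x.val
  rw [countP_lt_succ, countP_lt_succ] at h1
  omega

/-- Two standard tableaux with Knuth equivalent reading words agree: by Greene's theorem, applied to
the subwords of the letters less than `N`, their entries less than `N` form the same shape. -/
theorem IsStandard.eq_of_knuth {T T' : Tableau n} (hT : IsStandard T) (hT' : IsStandard T')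
    (h : Knuth (rowWord T) (rowWord T')) : T = T' := by
  have key : ∀ N k, ((T.map (List.countP (fun x => decide (x.val < N)))).take k).sum =
      ((T'.map (List.countP (fun x => decide (x.val < N)))).take k).sum := by
    intro N k
    have hN := h.filter_lt N
    rw [← rowWord_filter, ← rowWord_filter] at hN
    have h1 := hasInc_iff_of_knuth (hT.isPartialTableau.filter_lt N) (Knuth.refl _) k
    have h2 := hasInc_iff_of_knuth (hT'.isPartialTableau.filter_lt N) hN k
    have h3 := fun m => (h1 m).symm.trans (h2 m)
    have e : ∀ T : Tableau n, shape (T.map (List.filter (fun x => decide (x.val < N)))) =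
        T.map (List.countP (fun x => decide (x.val < N))) := by
      intro T
      rw [shape, List.map_map]
      exact List.map_congr_left fun R _ => List.countP_eq_length_filter.symm
    rw [e, e] at h3
    exact le_antisymm ((h3 _).1 le_rfl) ((h3 _).2 le_rfl)
  clear h
  have h1 := hT.1
  have h2 := hT'.1
  clear hT hT'
  induction T generalizing T' with
  | nil =>
    cases T' with
    | nil => rfl
    | cons S T' =>
      have h3 := key n 1
      simp only [List.map_nil, List.take_nil, List.sum_nil, List.map_cons, List.take_succ_cons,
        List.take_zero, List.sum_cons, Nat.add_zero] at h3
      rw [List.countP_eq_length.2 (fun x _ => by simp)] at h3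
      exact absurd (List.length_eq_zero_iff.1 h3.symm) (h2 S (by simp)).1
  | cons R T ih =>
    cases T' with
    | nil =>
      have h3 := key n 1
      simp only [List.map_nil, List.take_nil, List.sum_nil, List.map_cons, List.take_succ_cons,
        List.take_zero, List.sum_cons, Nat.add_zero] at h3
      rw [List.countP_eq_length.2 (fun x _ => by simp)] at h3
      exact absurd (List.length_eq_zero_iff.1 h3) (h1 R (by simp)).1
    | cons S T' =>
      have h3 : ∀ N, R.countP (fun y => decide (y.val < N)) =
          S.countP (fun y => decide (y.val < N)) := fun N => by simpa using key N 1
      rw [eq_of_countP_lt_eq (h1 R (by simp)).2 (h2 S (by simp)).2 h3,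
        ih (T' := T') (fun N k => ?_) (fun R hR => h1 R (by simp [hR]))
          (fun R hR => h2 R (by simp [hR]))]
      have h4 := key N (k + 1)
      simp only [List.map_cons, List.take_succ_cons, List.sum_cons, h3] at h4
      omega

/-! ### Row insertion -/

theorem rowInsert_none {x : Fin n} {R : List (Fin n)} (h : (rowInsert x R).2 = none) :
    (rowInsert x R).1 = R ++ [x] ∧ ∀ r ∈ R, r ≤ x := by
  induction R with
  | nil => simp [rowInsert]
  | cons r R ih =>
    rw [rowInsert] at h ⊢
    by_cases hx : x < r
    · simp [hx] at h
    · rw [if_neg hx] at h ⊢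
      obtain ⟨h1, h2⟩ := ih h
      refine ⟨by simp [h1], fun t ht => ?_⟩
      rcases List.mem_cons.1 ht with rfl | ht
      · exact not_lt.1 hx
      · exact h2 t ht

theorem rowInsert_some {x y : Fin n} {R : List (Fin n)} (h : (rowInsert x R).2 = some y) :
    (x :: R).Perm (y :: (rowInsert x R).1) ∧ x < y ∧ y ∈ R := by
  induction R with
  | nil => simp [rowInsert] at h
  | cons r R ih =>
    rw [rowInsert] at h ⊢
    by_cases hx : x < r
    · simp only [hx, if_true, Option.some.injEq] at h ⊢
      subst h
      exact ⟨List.Perm.swap _ _ _, hx, by simp⟩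
    · rw [if_neg hx] at h ⊢
      obtain ⟨h1, h2, h3⟩ := ih h
      exact ⟨(List.Perm.swap _ _ _).trans ((h1.cons r).trans (List.Perm.swap _ _ _)), h2,
        by simp [h3]⟩

theorem rowInsert_perm (x : Fin n) (R : List (Fin n)) :
    (R ++ [x]).Perm ((rowInsert x R).2.toList ++ (rowInsert x R).1) := by
  cases h : (rowInsert x R).2 with
  | none => simp [(rowInsert_none h).1]
  | some y => exact (List.perm_append_singleton x R).trans (rowInsert_some h).1

theorem mem_of_mem_rowInsert {x t : Fin n} {R : List (Fin n)} (h : t ∈ (rowInsert x R).1) :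
    t = x ∨ t ∈ R := by
  have := (rowInsert_perm x R).mem_iff.2 (List.mem_append_right _ h)
  simpa [or_comm] using this

theorem rowInsert_pairwise {x : Fin n} {R : List (Fin n)} (hR : R.Pairwise (· < ·)) (hx : x ∉ R) :
    (rowInsert x R).1.Pairwise (· < ·) := by
  induction R with
  | nil => simp [rowInsert]
  | cons r R ih =>
    rw [rowInsert]
    rw [List.pairwise_cons] at hR
    simp only [List.mem_cons, not_or] at hx
    by_cases hxr : x < r
    · rw [if_pos hxr, List.pairwise_cons]
      exact ⟨fun t ht => hxr.trans (hR.1 t ht), hR.2⟩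
    · rw [if_neg hxr, List.pairwise_cons]
      refine ⟨fun t ht => ?_, ih hR.2 hx.2⟩
      rcases mem_of_mem_rowInsert ht with rfl | ht
      · exact lt_of_le_of_ne (not_lt.1 hxr) (Ne.symm hx.1)
      · exact hR.1 t ht

/-- The bumped entry is the smallest one larger than `x`. -/
theorem rowInsert_some_le {x y : Fin n} {R : List (Fin n)} (hR : R.Pairwise (· < ·))
    (h : (rowInsert x R).2 = some y) {t : Fin n} (ht : t ∈ R) (hxt : x < t) : y ≤ t := by
  induction R with
  | nil => simp at ht
  | cons r R ih =>
    rw [rowInsert] at h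
    rw [List.pairwise_cons] at hR
    by_cases hx : x < r
    · simp only [hx, if_true, Option.some.injEq] at h
      subst h
      rcases List.mem_cons.1 ht with rfl | ht
      · exact le_rfl
      · exact (hR.1 t ht).le
    · rw [if_neg hx] at h
      rcases List.mem_cons.1 ht with rfl | ht
      · exact absurd hxt hx
      · exact ih hR.2 h ht

/-- The first entry of a row after a bump is smaller than the bumped entry. -/
theorem exists_rowInsert_eq_cons {x y : Fin n} {R : List (Fin n)} (hR : R.Pairwise (· < ·))
    (h : (rowInsert x R).2 = some y) : ∃ t R', (rowInsert x R).1 = t :: R' ∧ t < y := by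
  cases R with
  | nil => simp [rowInsert] at h
  | cons r R =>
    rw [rowInsert] at h ⊢
    rw [List.pairwise_cons] at hR
    by_cases hx : x < r
    · simp only [hx, if_true, Option.some.injEq] at h ⊢
      exact ⟨x, R, rfl, h ▸ hx⟩
    · rw [if_neg hx] at h ⊢
      exact ⟨r, _, rfl, hR.1 y (rowInsert_some h).2.2⟩

/-- Bumping from the first place. -/
theorem knuth_of_lt {x r : Fin n} {R : List (Fin n)} (hR : (r :: R).Pairwise (· < ·)) (hx : x < r) :
    Knuth (r :: R ++ [x]) (r :: x :: R) := by
  induction R generalizing r with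
  | nil => exact Knuth.refl _
  | cons s R ih =>
    rw [List.pairwise_cons] at hR
    have hrs := hR.1 s (by simp)
    refine ((ih hR.2 (hx.trans hrs)).cons r).trans ?_
    exact (KnuthStep.swap_right [] R hx hrs).knuth.symm

theorem knuth_rowInsert {x : Fin n} {R : List (Fin n)} (hR : R.Pairwise (· < ·)) (hx : x ∉ R) :
    Knuth (R ++ [x]) ((rowInsert x R).2.toList ++ (rowInsert x R).1) := by
  cases h : (rowInsert x R).2 with
  | none =>
    rw [(rowInsert_none h).1]
    exact Knuth.refl _
  | some y =>
    show Knuth (R ++ [x]) (y :: (rowInsert x R).1)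
    induction R with
    | nil => simp [rowInsert] at h
    | cons r R ih =>
      have hR' := hR
      rw [rowInsert] at h ⊢
      rw [List.pairwise_cons] at hR
      simp only [List.mem_cons, not_or] at hx
      by_cases hxr : x < r
      · simp only [hxr, if_true, Option.some.injEq] at h ⊢
        subst h
        exact knuth_of_lt hR' hxr
      · rw [if_neg hxr] at h ⊢
        refine ((ih hR.2 hx.2 h).cons r).trans ?_
        obtain ⟨t, R', h1, h2⟩ := exists_rowInsert_eq_cons hR.2 h
        have h3 : r < t := by
          rcases mem_of_mem_rowInsert (x := x) (R := R) (t := t) (by simp [h1]) with rfl | ht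
          · exact lt_of_le_of_ne (not_lt.1 hxr) (Ne.symm hx.1)
          · exact hR.1 t ht
        simp only [h1]
        exact (KnuthStep.swap_left [] R' h3 h2).knuth

/-! ### The insertion tableau -/

/-- Row insertion lowers the entries of a row. -/
theorem ColLT.rowInsert_left {x : Fin n} {R S : List (Fin n)} (h : ColLT R S) :
    ColLT (rowInsert x R).1 S := by
  induction S generalizing R with
  | nil => exact colLT_nil _
  | cons s S ih =>
    cases R with
    | nil => exact h.elim
    | cons r R =>
      rw [rowInsert]
      by_cases hx : x < r
      · rw [if_pos hx]
        exact ⟨hx.trans h.1, h.2⟩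
      · rw [if_neg hx]
        exact ⟨h.1, ih h.2⟩

/-- The entry bumped from a row is inserted into the next row weakly to the left. -/
theorem ColLT.rowInsert {x y : Fin n} {R S : List (Fin n)} (hR : R.Pairwise (· < ·))
    (h : ColLT R S) (hy : (rowInsert x R).2 = some y) :
    ColLT (rowInsert x R).1 (BoxBall.rowInsert y S).1 := by
  induction S generalizing R with
  | nil =>
    obtain ⟨t, R', h1, h2⟩ := exists_rowInsert_eq_cons hR hy
    rw [h1]
    exact ⟨h2, colLT_nil _⟩
  | cons s S ih =>
    cases R with
    | nil => exact h.elim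
    | cons r R =>
      obtain ⟨h1, h2⟩ := h
      rw [List.pairwise_cons] at hR
      rw [BoxBall.rowInsert] at hy ⊢
      by_cases hx : x < r
      · simp only [hx, if_true, Option.some.injEq] at hy ⊢
        subst hy
        rw [BoxBall.rowInsert, if_pos h1]
        exact ⟨hx, h2⟩
      · rw [if_neg hx] at hy ⊢
        rw [BoxBall.rowInsert]
        by_cases hys : y < s
        · rw [if_pos hys]
          exact ⟨hR.1 y (rowInsert_some hy).2.2, h2.rowInsert_left⟩
        · rw [if_neg hys]
          exact ⟨h1, ih hR.2 h2 hy⟩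

theorem tableauInsert_cons (x : Fin n) (R : List (Fin n)) (T : Tableau n) :
    tableauInsert x (R :: T) =
      (rowInsert x R).1 :: ((rowInsert x R).2.elim T fun y => tableauInsert y T) := by
  rw [tableauInsert]
  rcases rowInsert x R with ⟨R', _ | y⟩ <;> rfl

/-- Tableaux whose entries are not prescribed: the rows are nonempty and increase, and consecutive
rows satisfy the column condition. -/
def IsRowTableau (T : Tableau n) : Prop :=
  (∀ R ∈ T, R ≠ [] ∧ R.Pairwise (· < ·)) ∧ T.IsChain ColLT

/-- Insertion preserves tableaux and Knuth classes. The description of the new first row is what the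
induction needs to compare it with the row above. -/
theorem tableauInsert_spec {x : Fin n} {T : Tableau n} (hT : IsRowTableau T) (hnd : T.flatten.Nodup)
    (hx : x ∉ T.flatten) :
    IsRowTableau (tableauInsert x T) ∧
      (tableauInsert x T).head? = some (rowInsert x (T.head?.getD [])).1 ∧
      Knuth (rowWord T ++ [x]) (rowWord (tableauInsert x T)) := by
  induction T generalizing x with
  | nil =>
    refine ⟨⟨by simp [tableauInsert], by simp [tableauInsert]⟩, rfl, ?_⟩
    simp [tableauInsert, rowWord, Knuth.refl]
  | cons R T ih =>
    obtain ⟨h1, h2⟩ := hT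
    simp only [List.flatten_cons, List.mem_append, not_or] at hx
    rw [List.flatten_cons, List.nodup_append] at hnd
    obtain ⟨hR0, hR⟩ := h1 R (by simp)
    have hne : (rowInsert x R).1 ≠ [] := by
      cases R with
      | nil => simp [rowInsert]
      | cons r R => rw [rowInsert]; split_ifs <;> simp
    have hR' := rowInsert_pairwise hR hx.1
    have hK := (knuth_rowInsert hR hx.1).append_left (rowWord T)
    rw [tableauInsert_cons, rowWord_cons, rowWord_cons, List.append_assoc]
    rw [List.isChain_cons] at h2
    cases h : (rowInsert x R).2 with
    | none =>
      rw [h] at hK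
      refine ⟨⟨?_, ?_⟩, rfl, hK⟩
      · intro S hS
        rcases List.mem_cons.1 hS with rfl | hS
        · exact ⟨hne, hR'⟩
        · exact h1 S (by simpa using Or.inr hS)
      · rw [Option.elim_none, List.isChain_cons]
        exact ⟨fun S hS => (h2.1 S hS).rowInsert_left, h2.2⟩
    | some y =>
      rw [h] at hK
      have hT : IsRowTableau T := ⟨fun S hS => h1 S (by simp [hS]), h2.2⟩
      obtain ⟨⟨h3, h4⟩, h5, h6⟩ := ih hT hnd.2.1 fun hy => hnd.2.2 y (rowInsert_some h).2.2 y hy rfl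
      refine ⟨⟨?_, ?_⟩, rfl, hK.trans ?_⟩
      · intro S hS
        rcases List.mem_cons.1 hS with rfl | hS
        · exact ⟨hne, hR'⟩
        · exact h3 S hS
      · rw [Option.elim_some, List.isChain_cons]
        refine ⟨fun S hS => ?_, h4⟩
        rw [h5, Option.mem_some_iff] at hS
        subst hS
        refine ColLT.rowInsert hR ?_ h
        cases T with
        | nil => exact colLT_nil R
        | cons S T => exact h2.1 S (by simp)
      · simpa using h6.append_right (rowInsert x R).1

instance : IsTrans (List (Fin n)) ColLT where
  trans R S R' h h' := by
    rw [colLT_iff] at h h' ⊢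
    intro j hj
    obtain ⟨h1, h2⟩ := h' j hj
    obtain ⟨h3, h4⟩ := h j h1
    exact ⟨h3, h4.trans h2⟩

/-- Inserting the letters of a word yields a tableau in the Knuth class of the word. -/
theorem foldl_tableauInsert {u : List (Fin n)} (hu : u.Nodup) :
    IsRowTableau (u.foldl (fun T x => tableauInsert x T) []) ∧
      Knuth u (rowWord (u.foldl (fun T x => tableauInsert x T) [])) := by
  induction u using List.reverseRecOn with
  | nil => exact ⟨⟨by simp, by simp⟩, Knuth.refl _⟩
  | append_singleton u x ih =>
    rw [List.nodup_append] at hu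
    obtain ⟨h1, h2⟩ := ih hu.1
    rw [List.foldl_append, List.foldl_cons, List.foldl_nil]
    have hperm := h2.perm.trans (rowWord_perm _)
    obtain ⟨h3, -, h4⟩ := tableauInsert_spec (x := x) h1 (hperm.nodup_iff.1 hu.1) fun hx =>
      hu.2.2 x (hperm.mem_iff.2 hx) x (by simp) rfl
    exact ⟨h3, (h2.append_right [x]).trans h4⟩

theorem word_perm (w : Equiv.Perm (Fin n)) : (word w).Perm (List.finRange n) := by
  rw [List.perm_ext_iff_of_nodup (word_nodup w) (List.nodup_finRange n)]
  intro x
  simp only [word, List.mem_map, List.mem_finRange, true_and, iff_true]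
  exact w.surjective x

/-- The word of `w` is Knuth equivalent to the reading word of its insertion tableau. -/
theorem knuth_P (w : Equiv.Perm (Fin n)) : Knuth (word w) (rowWord (P w)) :=
  (foldl_tableauInsert (word_nodup w)).2

theorem isStandard_P (w : Equiv.Perm (Fin n)) : IsStandard (P w) := by
  obtain ⟨⟨h1, h2⟩, h3⟩ := foldl_tableauInsert (word_nodup w)
  refine ⟨h1, (List.isChain_iff_pairwise.1 h2).imp colLT_iff.1, ?_⟩
  exact ((h3.perm.trans (rowWord_perm _)).symm).trans (word_perm w)

/-! ### The balls of the box-ball system form a fixed Knuth class -/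

theorem ballsInOrder_eq_filterMap {s : State n} (hs : Function.Injective s) {M : ℕ}
    (hM : ∀ b, s b < M) : ballsInOrder s = (List.range M).filterMap (ballAt s) := by
  have h1 : ((List.range M).filterMap (ballAt s)).Pairwise (fun a b => s a < s b) := by
    rw [List.pairwise_filterMap]
    refine List.pairwise_lt_range.imp fun {p q} hpq a ha b hb => ?_
    rw [ballAt_eq_some hs] at ha hb
    omega
  have h2 : (ballsInOrder s).Pairwise (fun a b => s a ≤ s b) := by
    have : Std.Total (fun a b : Fin n => s a ≤ s b) := ⟨fun a b => le_total _ _⟩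
    have : IsTrans (Fin n) (fun a b => s a ≤ s b) := ⟨fun _ _ _ => le_trans⟩
    exact List.pairwise_insertionSort _ _
  refine List.Perm.eq_of_pairwise (fun a b _ _ h h' => hs (le_antisymm h h')) h2
    (h1.imp le_of_lt) ?_
  refine (List.perm_insertionSort _ _).trans ?_
  rw [List.perm_ext_iff_of_nodup (List.nodup_finRange n) (h1.imp fun h e => by simp [e] at h)]
  intro b
  simp only [List.mem_finRange, List.mem_filterMap, List.mem_range, true_iff]
  exact ⟨s b, hM b, (ballAt_eq_some hs).2 rfl⟩

/-- The balls of the carrier in increasing order. -/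
def carrierList (s : State n) (p : ℕ) : List (Fin n) :=
  (List.finRange n).filter (fun b => decide (b ∈ carrier s p))

theorem mem_carrierList {s : State n} {p : ℕ} {b : Fin n} :
    b ∈ carrierList s p ↔ b ∈ carrier s p := by simp [carrierList]

theorem carrierList_pairwise (s : State n) (p : ℕ) : (carrierList s p).Pairwise (· < ·) :=
  (List.sortedLT_finRange n).pairwise.filter _

theorem carrierList_eq {s : State n} {p : ℕ} {R : List (Fin n)} (hR : R.Pairwise (· < ·))
    (h : ∀ b, b ∈ R ↔ b ∈ carrier s p) : carrierList s p = R := by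
  refine List.Perm.eq_of_pairwise (fun a b _ _ h h' => absurd h (lt_asymm h'))
    (carrierList_pairwise s p) hR ?_
  rw [List.perm_ext_iff_of_nodup ((carrierList_pairwise s p).imp ne_of_lt) (hR.imp ne_of_lt)]
  exact fun b => mem_carrierList.trans (h b).symm

/-- Reading one box, the carrier performs a row insertion. -/
theorem knuth_carrierList {s : State n} (hs : Function.Injective s) (p : ℕ) :
    Knuth (carrierList s p ++ (ballAt s p).toList)
      ((ballAt (bbsMove s) p).toList ++ carrierList s (p + 1)) := by
  have hq := bbsMove_injective s
  have hC := carrierList_pairwise s p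
  cases hx : ballAt s p with
  | none =>
    have hx' := ballAt_eq_none.1 hx
    refine Knuth.of_eq ?_
    cases hy : ballAt (bbsMove s) p with
    | none =>
      have hy' := ballAt_eq_none.1 hy
      simp only [Option.toList_none, List.append_nil, List.nil_append]
      refine carrierList_eq (carrierList_pairwise s _) fun b => ?_
      rw [mem_carrierList, mem_carrier_succ]
      simp [hx', hy']
    | some y =>
      rw [ballAt_eq_some hq] at hy
      simp only [Option.toList_none, List.append_nil, Option.toList_some, List.singleton_append]
      have hle : ∀ c ∈ carrier s p, y ≤ c := by
        intro c hc
        have := letter_bbsMove_le hs hc (Or.inr (letter_eq_top hx'))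
        rw [← hy, letter_apply hq] at this
        exact this
      refine carrierList_eq ?_ fun b => ?_
      · rw [List.pairwise_cons]
        refine ⟨fun c hc => ?_, carrierList_pairwise s _⟩
        rw [mem_carrierList, mem_carrier_succ] at hc
        obtain ⟨hc, hcp⟩ := hc.resolve_right (hx' c)
        exact lt_of_le_of_ne (hle c hc) fun e => hcp (e ▸ hy)
      · rw [List.mem_cons, mem_carrierList, mem_carrier_succ]
        have := mem_carrier_of_bbsMove_eq hy
        constructor
        · rintro (rfl | h)
          · exact this
          · exact (h.resolve_right (hx' b)).1
        · intro h
          by_cases e : b = y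
          · exact Or.inl e
          · exact Or.inr (Or.inl ⟨h, fun e' => e (hq (e'.trans hy.symm))⟩)
  | some x =>
    rw [ballAt_eq_some hs] at hx
    have hxC : x ∉ carrierList s p := by
      rw [mem_carrierList, mem_carrier]; omega
    have hxl : letter s p = x := (letter_eq_iff hs).2 hx
    have hR' := rowInsert_pairwise hC hxC
    refine (knuth_rowInsert hC hxC).trans (Knuth.of_eq ?_)
    cases h : (rowInsert x (carrierList s p)).2 with
    | none =>
      obtain ⟨h1, h2⟩ := rowInsert_none h
      have hy : ballAt (bbsMove s) p = none := by
        rw [ballAt_eq_none]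
        intro y hy
        exact (lt_of_bbsMove_eq s (hy.trans hx.symm)).not_ge
          (h2 y (mem_carrierList.2 (mem_carrier_of_bbsMove_eq hy)))
      rw [hy]
      simp only [Option.toList_none, List.nil_append]
      rw [h1] at hR' ⊢
      refine (carrierList_eq hR' fun b => ?_).symm
      rw [mem_carrier_succ, List.mem_append, mem_carrierList, List.mem_singleton]
      have := ballAt_eq_none.1 hy b
      have : s b = p ↔ b = x := ⟨fun e => hs (e.trans hx.symm), fun e => e ▸ hx⟩
      tauto
    | some y =>
      obtain ⟨h1, h2, h3⟩ := rowInsert_some h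
      rw [mem_carrierList] at h3
      have h4 := letter_bbsMove_le hs h3 (Or.inl (by rw [hxl]; exact h2))
      obtain ⟨y', h5, h6⟩ := exists_of_letter_lt hq (h4.trans_lt y.2)
      have h7 : y ≤ y' := rowInsert_some_le hC h
        (mem_carrierList.2 (mem_carrier_of_bbsMove_eq h5)) (lt_of_bbsMove_eq s (h5.trans hx.symm))
      obtain rfl : y = y' := le_antisymm h7 (by rw [h6] at h4; exact h4)
      rw [(ballAt_eq_some hq).2 h5]
      congr 1
      refine (carrierList_eq hR' fun b => ?_).symm
      have hnd : (y :: (rowInsert x (carrierList s p)).1).Nodup := by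
        rw [← h1.nodup_iff, List.nodup_cons]
        exact ⟨hxC, hC.imp ne_of_lt⟩
      have h8 := h1.mem_iff (a := b)
      rw [List.mem_cons, List.mem_cons, mem_carrierList] at h8
      rw [mem_carrier_succ]
      have h9 : s b = p ↔ b = x := ⟨fun e => hs (e.trans hx.symm), fun e => e ▸ hx⟩
      have h10 : bbsMove s b = p ↔ b = y := ⟨fun e => hq (e.trans h5.symm), fun e => e ▸ h5⟩
      have h11 : b = y → b ∉ (rowInsert x (carrierList s p)).1 := fun e =>
        e ▸ (List.nodup_cons.1 hnd).1
      have h12 : b = x → b ≠ y := fun e e' => h2.ne (e.symm.trans e')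
      tauto

theorem knuth_ballsInOrder_bbsMove {s : State n} (hs : Function.Injective s) :
    Knuth (ballsInOrder s) (ballsInOrder (bbsMove s)) := by
  have hq := bbsMove_injective s
  obtain ⟨M, hM⟩ : ∃ M, ∀ b, bbsMove s b < M :=
    ⟨Finset.univ.sup (bbsMove s) + 1, fun b => Nat.lt_succ_of_le
      (Finset.le_sup (f := bbsMove s) (Finset.mem_univ b))⟩
  have hM' : ∀ b, s b < M := fun b => (lt_bbsMove s b).trans (hM b)
  have key : ∀ d p, p + d = M → Knuth (carrierList s p ++ (List.range' p d).filterMap (ballAt s))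
      ((List.range' p d).filterMap (ballAt (bbsMove s))) := by
    intro d
    induction d with
    | zero =>
      rintro p rfl
      refine Knuth.of_eq ?_
      simp only [List.range'_zero, List.filterMap_nil, List.append_nil]
      refine carrierList_eq List.Pairwise.nil fun b => ?_
      have := hM b
      rw [mem_carrier]
      simp only [List.not_mem_nil, false_iff]
      omega
    | succ d ih =>
      intro p hp
      have e : ∀ s : State n, (List.range' p (d + 1)).filterMap (ballAt s) =
          (ballAt s p).toList ++ (List.range' (p + 1) d).filterMap (ballAt s) := by
        intro s
        rw [List.range'_succ, List.filterMap_cons]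
        cases ballAt s p <;> rfl
      rw [e, e, ← List.append_assoc]
      refine ((knuth_carrierList hs p).append_right _).trans ?_
      rw [List.append_assoc]
      exact (ih (p + 1) (by omega)).append_left _
  have h0 := key M 0 (by omega)
  have : carrierList s 0 = [] := carrierList_eq List.Pairwise.nil fun b => by simp [mem_carrier]
  rw [this, List.nil_append, ← List.range_eq_range'] at h0
  rwa [ballsInOrder_eq_filterMap hs hM', ballsInOrder_eq_filterMap hq hM]

theorem ballsInOrder_initialState (w : Equiv.Perm (Fin n)) :
    ballsInOrder (initialState w) = word w := by
  have hs := initialState_injective w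
  have hM : ∀ b, initialState w b < n := fun b => (w.symm b).2
  rw [ballsInOrder_eq_filterMap hs hM, word, ← List.map_coe_finRange_eq_range, List.filterMap_map,
    ← List.filterMap_eq_map]
  refine List.filterMap_congr fun i _ => ?_
  simp only [Function.comp]
  rw [ballAt_eq_some hs]
  simp [initialState]

/-- All states of the system of `w` are Knuth equivalent to `w`. -/
theorem knuth_ballsInOrder (w : Equiv.Perm (Fin n)) (t : ℕ) :
    Knuth (word w) (ballsInOrder (stateAt w t)) := by
  induction t with
  | zero => exact Knuth.of_eq (ballsInOrder_initialState w).symm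
  | succ t ih =>
    have h := knuth_ballsInOrder_bbsMove (stateAt_injective w t)
    rw [stateAt, ← Function.iterate_succ_apply' bbsMove t (initialState w)] at h
    exact ih.trans h

/-! ### Subsequences as sets of positions -/

theorem word_pairwise_iff (w : Equiv.Perm (Fin n)) (R : Fin n → Fin n → Prop) :
    (word w).Pairwise R ↔ ∀ i j, i < j → R (w i) (w j) := by
  rw [word, List.pairwise_map, List.pairwise_iff_getElem]
  simp only [List.length_finRange, List.getElem_finRange]
  exact ⟨fun h i j hij => h i j i.2 j.2 hij, fun h i j hi hj hij => h _ _ hij⟩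

theorem word_countP (w : Equiv.Perm (Fin n)) (c : Fin n → ℕ) (k : ℕ) :
    (word w).countP (fun x => decide (c x < k)) =
      (Finset.univ.filter (fun i => c (w i) < k)).card := by
  rw [word, List.countP_map, List.countP_eq_length_filter, ← List.toFinset_card_of_nodup
    ((List.nodup_finRange n).filter _), List.toFinset_filter]
  congr 1
  ext i
  simp

/-- Colourings of the letters correspond to families of disjoint sets of positions. -/
theorem exists_colouring_iff (w : Equiv.Perm (Fin n)) (R : Fin n → Fin n → Prop) (k m : ℕ) :
    (∃ c : Fin n → ℕ, (word w).Pairwise (fun x y => c x < k → c x = c y → R x y) ∧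
      m ≤ (word w).countP (fun x => decide (c x < k))) ↔
    ∃ σ : Finset (Fin n), (∃ c : Fin k → Finset (Fin n),
      Pairwise (fun i j => Disjoint (c i) (c j)) ∧
      Finset.univ.biUnion c = σ ∧ ∀ j, ∀ ⦃a⦄, a ∈ c j → ∀ ⦃b⦄, b ∈ c j → a < b → R (w a) (w b)) ∧
      m ≤ σ.card := by
  classical
  constructor
  · rintro ⟨c, h1, h2⟩
    rw [word_pairwise_iff] at h1
    rw [word_countP] at h2
    refine ⟨_, ⟨fun j => Finset.univ.filter (fun i => c (w i) = j), ?_, ?_, ?_⟩, h2⟩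
    · intro i j hij
      rw [Finset.disjoint_filter]
      intro x _ h1 h2
      exact hij (Fin.ext (h1.symm.trans h2))
    · ext i
      simp only [Finset.mem_biUnion, Finset.mem_univ, true_and, Finset.mem_filter]
      exact ⟨fun ⟨j, hj⟩ => hj ▸ j.2, fun h => ⟨⟨_, h⟩, rfl⟩⟩
    · intro j x hx y hy hxy
      simp only [Finset.mem_univ, true_and, Finset.mem_filter] at hx hy
      exact h1 x y hxy (hx ▸ j.2) (hx.trans hy.symm)
  · rintro ⟨_, ⟨c, h1, rfl, h2⟩, hm⟩
    let d : Fin n → ℕ := fun i => if h : ∃ j, i ∈ c j then h.choose else k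
    have hd : ∀ i, d i < k → ∃ j : Fin k, d i = j ∧ i ∈ c j := by
      intro i hi
      by_cases h : ∃ j, i ∈ c j
      · exact ⟨h.choose, by simp only [d, dif_pos h], h.choose_spec⟩
      · simp only [d, dif_neg h, lt_irrefl] at hi
    refine ⟨fun x => d (w.symm x), ?_, ?_⟩
    · rw [word_pairwise_iff]
      intro a b hab h3 h4
      simp only [Equiv.symm_apply_apply] at h3 h4
      obtain ⟨j, h5, h6⟩ := hd a h3
      obtain ⟨j', h7, h8⟩ := hd b (h4 ▸ h3)
      obtain rfl : j = j' := Fin.ext (by omega)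
      exact h2 j h6 h8 hab
    · rw [word_countP]
      refine hm.trans (Finset.card_le_card fun i hi => ?_)
      simp only [Finset.mem_biUnion, Finset.mem_univ, true_and] at hi
      simp [d, hi]

open Classical in
theorem le_sup_card_iff {p : Finset (Fin n) → Prop} (hp : ∃ σ, p σ) (m : ℕ) :
    m ≤ (Finset.univ.filter p).sup Finset.card ↔ ∃ σ, p σ ∧ m ≤ σ.card := by
  constructor
  · intro hm
    obtain ⟨σ₀, h₀⟩ := hp
    obtain ⟨σ, hσ, hsup⟩ := Finset.exists_mem_eq_sup _
      ⟨σ₀, Finset.mem_filter.2 ⟨Finset.mem_univ _, h₀⟩⟩ Finset.card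
    exact ⟨σ, (Finset.mem_filter.1 hσ).2, hm.trans hsup.le⟩
  · rintro ⟨σ, h, hm⟩
    exact hm.trans (Finset.le_sup (f := Finset.card)
      (Finset.mem_filter.2 ⟨Finset.mem_univ _, h⟩))

/-- The colourings of `HasInc` compute `incr`. -/
theorem hasInc_word_iff (w : Equiv.Perm (Fin n)) (k m : ℕ) :
    HasInc k (word w) m ↔ m ≤ incr k w := by
  have h0 : IsKIncreasing w k ∅ := ⟨fun _ => ∅, fun _ _ _ => Finset.disjoint_empty_left _,
    by ext; simp, fun _ _ ha => absurd ha (by simp)⟩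
  rw [incr, le_sup_card_iff ⟨∅, h0⟩]
  exact exists_colouring_iff w (· < ·) k m

/-- The colourings of `HasInc` for the reversed word compute `decr`. -/
theorem hasInc_reverse_word_iff (w : Equiv.Perm (Fin n)) (k m : ℕ) :
    HasInc k (word w).reverse m ↔ m ≤ decr k w := by
  have h0 : IsKDecreasing w k ∅ := ⟨fun _ => ∅, fun _ _ _ => Finset.disjoint_empty_left _,
    by ext; simp, fun _ _ ha => absurd ha (by simp)⟩
  rw [decr, le_sup_card_iff ⟨∅, h0⟩]
  refine Iff.trans ?_ (exists_colouring_iff w (· > ·) k m)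
  refine exists_congr fun c => ?_
  rw [List.pairwise_reverse, List.countP_reverse]
  refine and_congr_left fun _ => ?_
  constructor
  · intro h
    refine h.imp ?_
    intro x y h h1 h2
    exact h (h2 ▸ h1) h2.symm
  · intro h
    refine h.imp ?_
    intro x y h h1 h2
    exact h (h2 ▸ h1) h2.symm

/-! ### Arrays of the shape of the insertion tableau -/

theorem sum_map_eq_of_le {l : List (List (Fin n))} {f g : List (Fin n) → ℕ}
    (h : ∀ R ∈ l, f R ≤ g R) (hs : (l.map g).sum ≤ (l.map f).sum) : ∀ R ∈ l, f R = g R := by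
  induction l with
  | nil => simp
  | cons R l ih =>
    have h1 := List.sum_le_sum (fun R hR => h R (List.mem_cons_of_mem _ hR) : ∀ R ∈ l, f R ≤ g R)
    have h2 := h R (by simp)
    simp only [List.map_cons, List.sum_cons] at hs
    intro S hS
    rcases List.mem_cons.1 hS with rfl | hS
    · omega
    · exact ih (fun R hR => h R (by simp [hR])) (by omega) S hS

/-- Increasing rows satisfy the column condition if the lower one can be matched into the upper one
by a map which decreases the entries. -/
theorem colLT_of_matching {R S : List (Fin n)} (hR : R.Pairwise (· < ·)) (hS : S.Pairwise (· < ·))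
    (f : Fin n → Fin n) (hf : ∀ s ∈ S, f s ∈ R ∧ f s < s)
    (hinj : ∀ s ∈ S, ∀ s' ∈ S, f s = f s' → s = s') : ColLT R S := by
  rw [colLT_iff]
  intro j hj
  by_contra hcon
  -- the entries of `R` below `S[j]` are among the first `j` ones
  have hmem : ∀ r ∈ R, r < S[j] → r ∈ R.take j := by
    intro r hr hlt
    obtain ⟨i, hi, rfl⟩ := List.mem_iff_getElem.1 hr
    rw [List.mem_take_iff_getElem]
    refine ⟨i, ?_, rfl⟩
    rw [lt_min_iff]
    refine ⟨?_, hi⟩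
    by_contra hij
    refine hcon ⟨by omega, lt_of_le_of_lt ?_ hlt⟩
    rcases (not_lt.1 hij).eq_or_lt with h | h
    · simp [h]
    · exact (List.pairwise_iff_getElem.1 hR j i _ hi h).le
  have hcard : (S.take (j + 1)).toFinset.card ≤ (R.take j).toFinset.card := by
    refine Finset.card_le_card_of_injOn f (fun s hs => ?_) fun s hs s' hs' h => ?_
    · have hs' : s ∈ S.take (j + 1) := by simpa using hs
      obtain ⟨i, hi, rfl⟩ := List.mem_take_iff_getElem.1 hs'
      rw [lt_min_iff] at hi
      obtain ⟨h1, h2⟩ := hf _ (List.getElem_mem hi.2)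
      simp only [List.coe_toFinset, Set.mem_ofPred_eq]
      refine hmem _ h1 (h2.trans_le ?_)
      rcases (Nat.lt_succ_iff.1 hi.1).eq_or_lt with h | h
      · simp [h]
      · exact (List.pairwise_iff_getElem.1 hS i j hi.2 hj h).le
    · exact hinj s (List.mem_of_mem_take (by simpa using hs)) s'
        (List.mem_of_mem_take (by simpa using hs')) h
  rw [List.toFinset_card_of_nodup ((hS.imp ne_of_lt).sublist (List.take_sublist _ _)),
    List.length_take, min_eq_left (by omega)] at hcard
  have := (List.toFinset_card_le (R.take j)).trans (List.length_take_le j R)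
  omega

/-- An array with increasing rows of weakly decreasing lengths is a tableau if, for every `k`, its
reading word has as large a `k`-decreasing subsequence as that of a tableau of the same shape. In
such a subsequence for the length `k` of a row `S`, the row `S` and every longer row contribute one
letter to every decreasing sequence. -/
theorem pairwise_colLT_of_hasInc {T : Tableau n} (h1 : ∀ R ∈ T, R.Pairwise (· < ·))
    (h2 : (shape T).Pairwise (· ≥ ·))
    (h : ∀ k, HasInc k (rowWord T).reverse ((shape T).map (min k)).sum) : T.Pairwise ColLT := by
  rw [shape, List.pairwise_map] at h2
  rw [List.pairwise_iff_getElem] at h2 ⊢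
  intro i j hi hj hij
  have hlen := h2 i j hi hj hij
  have hR := List.getElem_mem hi
  have hS := List.getElem_mem hj
  obtain ⟨c, h3, h4⟩ := h T[j].length
  set k := T[j].length with hk
  have e : (rowWord T).reverse = (T.map List.reverse).flatten := by
    rw [rowWord, List.reverse_flatten, List.map_reverse, List.reverse_reverse]
  rw [e, List.pairwise_flatten, List.pairwise_map] at h3
  obtain ⟨h3, h5⟩ := h3
  have h6 := List.pairwise_iff_getElem.1 h5 i j hi hj hij
  -- the letters of a row have different colours
  have hinj : ∀ R ∈ T, ∀ x ∈ R, ∀ y ∈ R, c x < k → c x = c y → x = y := by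
    intro R hR
    have h7 := h3 _ (List.mem_map_of_mem hR)
    rw [List.pairwise_reverse] at h7
    refine List.Pairwise.forall_of_forall_of_flip (l := R)
      (R := fun x y => c x < k → c x = c y → x = y) (by simp) ?_ ?_
    · refine ((h1 R hR).and h7).imp fun {x y} h h8 h9 => ?_
      exact absurd h.1 (lt_asymm (h.2 (h9 ▸ h8) h9.symm))
    · refine ((h1 R hR).and h7).imp fun {x y} h h8 h9 => ?_
      exact absurd h.1 (lt_asymm (h.2 h8 h9))
  have himg : ∀ R ∈ T, ((R.toFinset.filter (fun x => c x < k)).image c).card =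
      R.countP (fun x => decide (c x < k)) := by
    intro R hR
    rw [Finset.card_image_of_injOn, List.countP_eq_length_filter, ← List.toFinset_card_of_nodup
      (((h1 R hR).imp ne_of_lt).filter _), List.toFinset_filter]
    · simp
    · intro x hx y hy hxy
      simp only [Finset.coe_filter, List.mem_toFinset, Set.mem_ofPred_eq] at hx hy
      exact hinj R hR x hx.1 y hy.1 hx.2 hxy
  have hsub : ∀ R : List (Fin n),
      (R.toFinset.filter (fun x => c x < k)).image c ⊆ Finset.range k := by
    intro R t ht
    obtain ⟨x, hx, rfl⟩ := Finset.mem_image.1 ht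
    simpa using (Finset.mem_filter.1 hx).2
  have hle : ∀ R ∈ T, R.countP (fun x => decide (c x < k)) ≤ min k R.length := by
    intro R hR
    rw [le_min_iff]
    refine ⟨?_, List.countP_le_length⟩
    rw [← himg R hR]
    simpa using Finset.card_le_card (hsub R)
  have heq := sum_map_eq_of_le hle (by
    rw [List.countP_reverse, (rowWord_perm T).countP_eq, List.countP_flatten, shape,
      List.map_map] at h4
    exact h4)
  have hSc : ∀ s ∈ T[j], c s < k := by
    have h7 := heq _ hS
    rw [← hk, min_self, hk, List.countP_eq_length] at h7
    simpa [hk] using h7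
  have hRc : ∀ s ∈ T[j], ∃ r ∈ T[i], c r = c s := by
    have h7 := heq _ hR
    rw [min_eq_left hlen, ← himg _ hR] at h7
    have h8 := Finset.eq_of_subset_of_card_le (hsub T[i]) (by rw [h7, Finset.card_range])
    intro s hs
    have h9 := Finset.mem_range.2 (hSc s hs)
    rw [← h8] at h9
    obtain ⟨x, hx, hx'⟩ := Finset.mem_image.1 h9
    exact ⟨x, by simpa using (Finset.mem_filter.1 hx).1, hx'⟩
  choose! g hg1 hg2 using hRc
  refine colLT_of_matching (h1 _ hR) (h1 _ hS) g (fun s hs => ?_) fun s hs s' hs' hss => ?_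
  · have h7 := hg2 s hs
    exact ⟨hg1 s hs, h6 _ (List.mem_reverse.2 (hg1 s hs)) _ (List.mem_reverse.2 hs)
      (h7 ▸ hSc s hs) h7⟩
  · refine hinj _ hS s hs s' hs' (hSc s hs) ?_
    rw [← hg2 s hs, ← hg2 s' hs', hss]

/-! ### The shape of the soliton decomposition -/

theorem sum_shape_runTableau {s : State n} (hs : Function.Injective s) (j : ℕ) :
    ((shape (runTableau s)).take j).sum = topSum s j := by
  have e : shape (runTableau s) =
      ((List.range' 1 (numRuns s)).map fun r => (runAt s r).length).reverse := by
    rw [shape, runTableau, runs_eq hs, List.map_reverse, List.map_map]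
    rfl
  rw [e, List.take_reverse, List.sum_reverse, List.length_map, List.length_range', ← List.map_drop,
    List.drop_range', topSum, ← List.sum_toFinset _ (List.nodup_range')]
  refine Finset.sum_congr ?_ fun _ _ => rfl
  ext r
  simp only [List.mem_toFinset, List.mem_range'_1, Finset.mem_Ioc]
  omega

theorem rowWord_runTableau {s : State n} (hs : Function.Injective s) :
    rowWord (runTableau s) = ballsInOrder s := by
  rw [rowWord, runTableau, List.reverse_reverse, runs_eq hs, flatten_runAt hs]

/-- The soliton decomposition has nonempty increasing rows of weakly decreasing lengths, its reading
word is Knuth equivalent to `w`, and its shape governs the chains in the cut word of `w`. -/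
theorem SD_spec (w : Equiv.Perm (Fin n)) :
    (∀ R ∈ SD w, R ≠ [] ∧ R.Pairwise (· < ·)) ∧ (shape (SD w)).Pairwise (· ≥ ·) ∧
      Knuth (word w) (rowWord (SD w)) ∧
      ∀ j m, SegChain (natWord w) n j m ↔ m ≤ ((shape (SD w)).take j).sum := by
  obtain ⟨t, ht⟩ := exists_settled (initialState_injective w)
  have hs := stateAt_injective w t
  have hst : IsSteady (stateAt w t) := Settled.isSteady hs ht
  rw [SD_eq_of_isSteady w t hst]
  refine ⟨fun R hR => ?_, ?_, ?_, fun j m => ?_⟩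
  · rw [runTableau, runs_eq hs, List.mem_reverse, List.mem_map] at hR
    obtain ⟨r, hr, rfl⟩ := hR
    rw [List.mem_range'_1] at hr
    exact ⟨runAt_ne_nil hs hr.1 (by omega), runAt_pairwise _ r⟩
  · rw [shape, runTableau, List.pairwise_map, List.pairwise_reverse]
    exact hst.2
  · rw [rowWord_runTableau hs]
    exact knuth_ballsInOrder w t
  · rw [sum_shape_runTableau hs]
    exact segChain_natWord_iff w ht j m

theorem localIncr_eq (w : Equiv.Perm (Fin n)) {k : ℕ} (hk : 1 ≤ k) :
    localIncr k w = ((shape (SD w)).take k).sum := by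
  have h := (SD_spec w).2.2.2
  refine le_antisymm ((h _ _).1 (segChain_localIncr w hk n)) ?_
  rcases segChain_of_top (fun a => lt_of_mem_natWord) ((h k _).2 le_rfl) with
    ⟨rfl, -⟩ | ⟨j, rfl, h1⟩
  · omega
  · exact le_localIncr h1

theorem sum_shape_SD (w : Equiv.Perm (Fin n)) : (shape (SD w)).sum = n := by
  rw [sum_shape, ← (SD_spec w).2.2.1.perm.length_eq]
  simp [word]

theorem localDecr_eq (w : Equiv.Perm (Fin n)) {k : ℕ} (hk : 1 ≤ k) :
    localDecr k w = ((shape (SD w)).map (min k)).sum := by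
  obtain ⟨-, h1, -, h2⟩ := SD_spec w
  have hn := sum_shape_SD w
  apply le_antisymm
  · obtain ⟨j, hj⟩ := exists_sum_take_eq h1 k
    have := localDecr_add_le w k ((h2 j _).2 le_rfl)
    rw [Nat.mul_comm] at this
    omega
  · obtain ⟨j, m, h3, h4⟩ := exists_le_localDecr w hk
    have := (h2 _ _).1 h3
    have := sum_take_add_sum_min_le (shape (SD w)) j k
    rw [Nat.mul_comm] at this
    omega

theorem incr_eq (w : Equiv.Perm (Fin n)) (k : ℕ) : incr k w = ((shape (P w)).take k).sum := by
  have h := fun m => (hasInc_word_iff w k m).symm.trans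
    (hasInc_iff_of_knuth (isStandard_P w).isPartialTableau (knuth_P w) k m)
  exact le_antisymm ((h _).1 le_rfl) ((h _).2 le_rfl)

theorem decr_eq (w : Equiv.Perm (Fin n)) (k : ℕ) :
    decr k w = ((shape (P w)).map (min k)).sum := by
  have h := fun m => (hasInc_reverse_word_iff w k m).symm.trans
    (hasInc_reverse_iff_of_knuth (isStandard_P w).isPartialTableau (knuth_P w) k m)
  exact le_antisymm ((h _).1 le_rfl) ((h _).2 le_rfl)

theorem shape_pos {T : Tableau n} (hT : ∀ R ∈ T, R ≠ [] ∧ R.Pairwise (· < ·)) :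
    ∀ x ∈ shape T, 0 < x := by
  intro x hx
  obtain ⟨R, hR, rfl⟩ := List.mem_map.1 hx
  exact List.length_pos_iff.2 (hT R hR).1

theorem isStandard_SD_of_shape_eq {w : Equiv.Perm (Fin n)} (h : shape (SD w) = shape (P w)) :
    IsStandard (SD w) := by
  obtain ⟨h1, h2, h3, -⟩ := SD_spec w
  refine ⟨h1,
    (pairwise_colLT_of_hasInc (fun R hR => (h1 R hR).2) h2 fun k => ?_).imp colLT_iff.1, ?_⟩
  · rw [h, hasInc_reverse_iff_of_knuth (isStandard_P w).isPartialTableau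
      (h3.symm.trans (knuth_P w))]
  · exact (h3.perm.trans (rowWord_perm _)).symm.trans (word_perm w)

end BoxBall

theorem corollary4p3 {n : ℕ} (w : Equiv.Perm (Fin n)) :
    (∃ t : ℕ, BoxBall.IsSteady (BoxBall.stateAt w t)) ∧
    [ BoxBall.SD w = BoxBall.P w,
      BoxBall.IsStandard (BoxBall.SD w),
      BoxBall.shape (BoxBall.SD w) = BoxBall.shape (BoxBall.P w),
      ∀ k : ℕ, 1 ≤ k → BoxBall.localIncr k w = BoxBall.incr k w,
      ∀ k : ℕ, 1 ≤ k → BoxBall.localDecr k w = BoxBall.decr k w ].TFAE := by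
  obtain ⟨t, ht⟩ := BoxBall.exists_settled (BoxBall.initialState_injective w)
  refine ⟨⟨t, BoxBall.Settled.isSteady (BoxBall.stateAt_injective w t) ht⟩, ?_⟩
  obtain ⟨h1, h2, h3, -⟩ := BoxBall.SD_spec w
  have hP := BoxBall.isStandard_P w
  have hPS := hP.isPartialTableau.shape_pairwise
  have hsum : (BoxBall.shape (BoxBall.P w)).sum = (BoxBall.shape (BoxBall.SD w)).sum := by
    rw [BoxBall.sum_shape, BoxBall.sum_shape, ← h3.perm.length_eq,
      ← (BoxBall.knuth_P w).perm.length_eq]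
  tfae_have 1 → 2 := fun h => h ▸ hP
  tfae_have 2 → 1 := fun h => h.eq_of_knuth hP (h3.symm.trans (BoxBall.knuth_P w))
  tfae_have 1 → 3 := fun h => by rw [h]
  tfae_have 3 → 2 := BoxBall.isStandard_SD_of_shape_eq
  tfae_have 3 → 4 := fun h k hk => by rw [BoxBall.localIncr_eq w hk, BoxBall.incr_eq, h]
  tfae_have 4 → 3 := fun h =>
    BoxBall.eq_of_sum_take_eq (BoxBall.shape_pos h1) (BoxBall.shape_pos hP.1) fun k hk => by
      rw [← BoxBall.localIncr_eq w hk, ← BoxBall.incr_eq, h k hk]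
  tfae_have 3 → 5 := fun h k hk => by rw [BoxBall.localDecr_eq w hk, BoxBall.decr_eq, h]
  tfae_have 5 → 3 := fun h => by
    have key : ∀ k, ((BoxBall.shape (BoxBall.SD w)).map (min k)).sum =
        ((BoxBall.shape (BoxBall.P w)).map (min k)).sum := by
      intro k
      rcases k.eq_zero_or_pos with rfl | hk
      · have h0 : min 0 = fun _ : ℕ => 0 := funext Nat.zero_min
        simp [h0]
      · rw [← BoxBall.localDecr_eq w hk, ← BoxBall.decr_eq, h k hk]
    refine BoxBall.eq_of_sum_take_eq (BoxBall.shape_pos h1) (BoxBall.shape_pos hP.1) fun j _ => ?_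
    exact le_antisymm
      (BoxBall.sum_take_le_of_sum_min_le hPS hsum.symm (fun k => (key k).ge) j)
      (BoxBall.sum_take_le_of_sum_min_le h2 hsum (fun k => (key k).le) j)
  tfae_finish
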